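/- Let $l>0$, $\nu>0$, $C_1\in\mathbb{R}$ and $s\ge 0$, let $\mathbb{T}_l=\mathbb{R}/l\mathbb{Z}$, and let $H^s$ denote the Sobolev spaces of real-valued functions, with norm $\|f\|_{H^s}^2=\sum_k (1+|\kappa|^2)^{s}|\widehat f(k)|^2$, $\kappa=2\pi k/l$. For a function (or distribution) $f$ on $\mathbb{T}_l^2$ write $\overline f(y)=\frac1l\int_0^l f(x,y)\,dx$, and let $\nabla^{-2}$ be the Fourier multiplier $-1/|\kappa|^2$ for $k\ne0$ and $0$ for $k=0$. Consider, for unknowns $\overline u=\overline u(t,y)$ and $\zeta'=\zeta'(t,x,y)$, the initial value problem $$\partial_t\zeta'+C_1\partial_x\nabla^{-2}\zeta'-\nu\nabla^2\zeta'=F(\overline u,\zeta'),\qquad \partial_t\overline u-\nu\partial_{yy}\overline u=G(\zeta'),\qquad \zeta'(0)=\zeta'_0,\quad \overline u(0)=\overline u_0,$$ where $$F(\overline u,\zeta')=(\partial_y\nabla^{-2}\zeta')\,\partial_x\zeta'-(\partial_x\nabla^{-2}\zeta')\,\partial_y\zeta'-\overline u\,\partial_x\zeta'+\partial_y\overline{(\partial_x\nabla^{-2}\zeta')\,\zeta'},\qquad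 G(\zeta')=\partial_y\overline{(\partial_x\nabla^{-2}\zeta')(\partial_y\nabla^{-2}\zeta')},$$ the products being understood through convolution of Fourier coefficients. A global (mild) solution in $L^\infty((0,\infty);H^s(\mathbb{T}_l)\times H^s(\mathbb{T}_l^2))$ is a pair $(\overline u,\zeta')$ in this space such that, for almost every $t>0$ and for every Fourier coefficient, $$\overline u(t)=e^{\nu t\partial_{yy}}\overline u_0+\int_0^t e^{\nu(t-\tau)\partial_{yy}}G(\zeta'(\tau))\,d\tau,\qquad \zeta'(t)=e^{tA}\zeta'_0+\int_0^t e^{(t-\tau)A}F(\overline u(\tau),\zeta'(\tau))\,d\tau,\qquad A=\nu\nabla^2-C_1\partial_x\nabla^{-2}.$$ Theorem. For all $\overline u_0\in H^s(\mathbb{T}_l)$ and $\zeta'_0\in H^s(\mathbb{T}_l^2)$ there is exactly one global mild solution $(\overline u,\zeta')\in L^\infty((0,\infty);H^s(\mathbb{T}_l)\times H^s(\mathbb{T}_l^2))$, where solutions that agree for almost every $t>0$ are identified; moreover it has a representative that satisfies the two integral identities for every $t\ge0$ (so that it takes the values $\overline u_0,\zeta'_0$ at $t=0$). -/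

import Mathlib

open MeasureTheory Set

noncomputable section

namespace EddyMean

/-! ### Function spaces on the circle and the two-torus of side length `l`

`AddCircle l` is `ℝ / lℤ`; the first coordinate of `AddCircle l × AddCircle l` is `x`,
the second one is `y`. The Lebesgue measure is normalised to total mass one. -/

/-- Real-valued square integrable functions of `y`. -/
abbrev L2y (l : ℝ) [Fact (0 < l)] : Type :=
  Lp ℝ 2 (AddCircle.haarAddCircle : Measure (AddCircle l))

/-- Real-valued square integrable functions of `(x, y)`. -/
abbrev L2xy (l : ℝ) [Fact (0 < l)] : Type :=
  Lp ℝ 2 ((AddCircle.haarAddCircle : Measure (AddCircle l)).prod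
    (AddCircle.haarAddCircle : Measure (AddCircle l)))

/-- Fourier coefficients `(1/l) ∫ f(y) exp(-2πi n y / l) dy`. -/
def hat1 {l : ℝ} [Fact (0 < l)] (f : L2y l) (n : ℤ) : ℂ :=
  fourierCoeff (fun y : AddCircle l => ((f y : ℝ) : ℂ)) n

/-- Fourier coefficients `(1/l²) ∫∫ f(x,y) exp(-2πi (k₁ x + k₂ y) / l) dx dy`. -/
def hat2 {l : ℝ} [Fact (0 < l)] (f : L2xy l) (k : ℤ × ℤ) : ℂ :=
  ∫ p : AddCircle l × AddCircle l,
    fourier (-k.1) p.1 * fourier (-k.2) p.2 * ((f p : ℝ) : ℂ)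
      ∂((AddCircle.haarAddCircle : Measure (AddCircle l)).prod
        (AddCircle.haarAddCircle : Measure (AddCircle l)))

/-- The frequency `2π n / l`. -/
def freq (l : ℝ) (n : ℤ) : ℝ := 2 * Real.pi * n / l

/-- `|κ|²` for the frequency vector `κ = (2π k₁ / l, 2π k₂ / l)`. -/
def freqSq (l : ℝ) (k : ℤ × ℤ) : ℝ := freq l k.1 ^ 2 + freq l k.2 ^ 2

/-- Square of the `H^s` norm of a function of `y`, with value `∞` outside `H^s`. -/
def sobolevSq1 {l : ℝ} [Fact (0 < l)] (s : ℝ) (f : L2y l) : ENNReal :=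
  ∑' n : ℤ, ENNReal.ofReal ((1 + freq l n ^ 2) ^ s * ‖hat1 f n‖ ^ 2)

/-- Square of the `H^s` norm of a function of `(x, y)`, with value `∞` outside `H^s`. -/
def sobolevSq2 {l : ℝ} [Fact (0 < l)] (s : ℝ) (f : L2xy l) : ENNReal :=
  ∑' k : ℤ × ℤ, ENNReal.ofReal ((1 + freqSq l k) ^ s * ‖hat2 f k‖ ^ 2)

/-- `f ∈ H^s` on the circle, for `s ≥ 0`. -/
def MemHs1 {l : ℝ} [Fact (0 < l)] (s : ℝ) (f : L2y l) : Prop := sobolevSq1 s f < ⊤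

/-- `f ∈ H^s` on the two-torus, for `s ≥ 0`. -/
def MemHs2 {l : ℝ} [Fact (0 < l)] (s : ℝ) (f : L2xy l) : Prop := sobolevSq2 s f < ⊤

/-! ### Operations on periodic distributions, acting on Fourier coefficients

A periodic distribution in `y` is given by its coefficients `ℤ → ℂ`, one in `(x, y)` by its
coefficients `ℤ × ℤ → ℂ`. -/

/-- `∂_y` for a distribution in `y`. -/
def dy1 (l : ℝ) (a : ℤ → ℂ) : ℤ → ℂ := fun n => Complex.I * (freq l n : ℂ) * a n

/-- `∂_x`. -/
def dx (l : ℝ) (a : ℤ × ℤ → ℂ) : ℤ × ℤ → ℂ := fun k => Complex.I * (freq l k.1 : ℂ) * a k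

/-- `∂_y`. -/
def dy (l : ℝ) (a : ℤ × ℤ → ℂ) : ℤ × ℤ → ℂ := fun k => Complex.I * (freq l k.2 : ℂ) * a k

/-- `∇⁻²`: the inverse Laplacian with values of mean zero, the multiplier `-1/|κ|²` for `k ≠ 0`
and `0` for `k = 0`. -/
def invLap (l : ℝ) (a : ℤ × ℤ → ℂ) : ℤ × ℤ → ℂ :=
  fun k => if k = 0 then 0 else -(a k / (freqSq l k : ℂ))

/-- The product of two distributions in `(x, y)`: convolution of the coefficients. In all the
products below the series converges absolutely when the factors come from functions in `L²`. -/
def mul2 (a b : ℤ × ℤ → ℂ) : ℤ × ℤ → ℂ := fun k => ∑' h : ℤ × ℤ, a h * b (k - h)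

/-- The zonal average `(1/l) ∫ f(x, y) dx`, a distribution in `y`. -/
def zonalMean (a : ℤ × ℤ → ℂ) : ℤ → ℂ := fun n => a (0, n)

/-- A distribution in `y` regarded as a distribution in `(x, y)` that does not depend on `x`. -/
def lift (a : ℤ → ℂ) : ℤ × ℤ → ℂ := fun k => if k.1 = 0 then a k.2 else 0

/-- The nonlinearity
`(∂_y ∇⁻² ζ) ζ_x - (∂_x ∇⁻² ζ) ζ_y - u ζ_x + ∂_y (zonal mean of (∂_x ∇⁻² ζ) ζ)`
of the eddy equation. -/
def nonlinF (l : ℝ) (u : ℤ → ℂ) (ζ : ℤ × ℤ → ℂ) : ℤ × ℤ → ℂ :=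
  mul2 (dy l (invLap l ζ)) (dx l ζ) - mul2 (dx l (invLap l ζ)) (dy l ζ)
    - mul2 (lift u) (dx l ζ)
    + lift (dy1 l (zonalMean (mul2 (dx l (invLap l ζ)) ζ)))

/-- The nonlinearity `∂_y (zonal mean of (∂_x ∇⁻² ζ) (∂_y ∇⁻² ζ))` of the mean equation. -/
def nonlinG (l : ℝ) (ζ : ℤ × ℤ → ℂ) : ℤ → ℂ :=
  dy1 l (zonalMean (mul2 (dx l (invLap l ζ)) (dy l (invLap l ζ))))

/-- The semigroup `exp(t ν ∂_yy)`. -/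
def semigroup1 (l ν t : ℝ) (a : ℤ → ℂ) : ℤ → ℂ :=
  fun n => Complex.exp ((t * (-ν * freq l n ^ 2) : ℝ) : ℂ) * a n

/-- The symbol of `ν ∇² - C₁ ∂_x ∇⁻²`. -/
def symbol2 (l ν C₁ : ℝ) (k : ℤ × ℤ) : ℂ :=
  -(ν : ℂ) * (freqSq l k : ℂ) - (C₁ : ℂ) * dx l (invLap l (fun _ => 1)) k

/-- The semigroup `exp(t (ν ∇² - C₁ ∂_x ∇⁻²))`. -/
def semigroup2 (l ν C₁ t : ℝ) (a : ℤ × ℤ → ℂ) : ℤ × ℤ → ℂ :=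
  fun k => Complex.exp ((t : ℂ) * symbol2 l ν C₁ k) * a k

/-! ### Mild solutions -/

/-- The Duhamel formula at time `t`, for every Fourier coefficient:
`u(t) = exp(tν∂_yy) u₀ + ∫₀ᵗ exp((t-τ)ν∂_yy) G(ζ(τ)) dτ` and
`ζ(t) = exp(tA) ζ₀ + ∫₀ᵗ exp((t-τ)A) F(u(τ), ζ(τ)) dτ` with `A = ν∇² - C₁∂_x∇⁻²`. -/
def DuhamelAt {l : ℝ} [Fact (0 < l)] (ν C₁ : ℝ) (u₀ : L2y l) (ζ₀ : L2xy l)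
    (u : ℝ → L2y l) (ζ : ℝ → L2xy l) (t : ℝ) : Prop :=
  (∀ n : ℤ, hat1 (u t) n = semigroup1 l ν t (hat1 u₀) n
      + ∫ τ in (0 : ℝ)..t, semigroup1 l ν (t - τ) (nonlinG l (hat2 (ζ τ))) n) ∧
  (∀ k : ℤ × ℤ, hat2 (ζ t) k = semigroup2 l ν C₁ t (hat2 ζ₀) k
      + ∫ τ in (0 : ℝ)..t,
          semigroup2 l ν C₁ (t - τ) (nonlinF l (hat1 (u τ)) (hat2 (ζ τ))) k)

/-- `(u, ζ) ∈ L^∞((0,∞); H^s × H^s)`. For `s ≥ 0` strong measurability of a map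
taking values in `H^s` is the same whether it is understood in `H^s` or in `L²`. -/
structure MemLinftyHs {l : ℝ} [Fact (0 < l)] (s : ℝ)
    (u : ℝ → L2y l) (ζ : ℝ → L2xy l) : Prop where
  meas_u : AEStronglyMeasurable u (volume.restrict (Ioi (0 : ℝ)))
  meas_ζ : AEStronglyMeasurable ζ (volume.restrict (Ioi (0 : ℝ)))
  bdd_u : essSup (fun t => sobolevSq1 s (u t)) (volume.restrict (Ioi (0 : ℝ))) < ⊤
  bdd_ζ : essSup (fun t => sobolevSq2 s (ζ t)) (volume.restrict (Ioi (0 : ℝ))) < ⊤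

/-- `(u, ζ)` is a global mild solution in `L^∞((0,∞); H^s × H^s)`: it belongs to this space and
satisfies the Duhamel formula as an identity in it, that is for almost every `t > 0`. -/
structure IsMildSolution {l : ℝ} [Fact (0 < l)] (ν C₁ s : ℝ) (u₀ : L2y l) (ζ₀ : L2xy l)
    (u : ℝ → L2y l) (ζ : ℝ → L2xy l) : Prop where
  mem : MemLinftyHs s u ζ
  duhamel : ∀ᵐ t ∂(volume.restrict (Ioi (0 : ℝ))), DuhamelAt ν C₁ u₀ ζ₀ u ζ t

end EddyMean

end

/-!
On Fourier coefficients the nonlinearity is one bilinear operator, which loses half a power of the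
weight `1 + |κ|²`, whereas the time integral of the semigroup gains a full power. The half power
that is left makes the difference of two solutions contract in the supremum norm with weight
`exp (-μ t) (1 + |κ|²) ^ (3 / 8)` for large `μ`, which gives uniqueness.

For existence, take Galerkin approximations. Transport conserves the enstrophy of the eddies;
subtracting the zonal average breaks this, but the resulting production carries a derivative of the
zonal part as a factor. The zonal enstrophy `E₁` dissipates the square of that factor, so that
`E₂ * exp (g * E₁)` is nonincreasing for the eddy enstrophy `E₂` and a suitable `g`, which bounds
the enstrophy uniformly in time. Inserting this bound in the Duhamel formula repeatedly yields a
time-independent square summable majorant of all approximations, and dominated convergence passes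
to the limit. Each further insertion gains a fixed fraction of a derivative, up to the regularity
of the initial data.
-/

noncomputable section

open MeasureTheory Set Filter Topology
open scoped ComplexConjugate ENNReal NNReal

namespace EddyMean

/-! ### Real square integrable functions and a conjugation-symmetric Hilbert basis -/

section RealFourier

variable {X ι : Type*} [MeasurableSpace X] {μ : Measure X}

/-- A real-valued square integrable function regarded as a complex-valued one. -/
def complexify (μ : Measure X) : Lp ℝ 2 μ →L[ℝ] Lp ℂ 2 μ :=
  Complex.ofRealCLM.compLpL 2 μ

theorem coeFn_complexify (f : Lp ℝ 2 μ) : complexify μ f =ᵐ[μ] fun x => ((f x : ℝ) : ℂ) :=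
  Complex.ofRealCLM.coeFn_compLpL f

theorem complexify_injective : Function.Injective (complexify μ) := by
  intro f g h
  apply Lp.ext
  filter_upwards [coeFn_complexify f, coeFn_complexify g] with x hf hg
  rw [h, hg] at hf
  exact (Complex.ofReal_injective hf).symm

/-- The basis element `b (-k)` is the complex conjugate of `b k`. -/
def ConjSymm [Neg ι] (b : HilbertBasis ι ℂ (Lp ℂ 2 μ)) : Prop :=
  ∀ k, (b (-k) : X → ℂ) =ᵐ[μ] fun x => conj ((b k : X → ℂ) x)

theorem repr_conj [Neg ι] {b : HilbertBasis ι ℂ (Lp ℂ 2 μ)} (hb : ConjSymm b)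
    {f g : Lp ℂ 2 μ} (hfg : f =ᵐ[μ] fun x => conj (g x)) (k : ι) :
    b.repr f (-k) = conj (b.repr g k) := by
  rw [b.repr_apply_apply, b.repr_apply_apply, L2.inner_def, L2.inner_def, ← integral_conj]
  apply integral_congr_ae
  filter_upwards [hb k, hfg] with x hx hf
  simp [hx, hf, RCLike.inner_apply]

theorem repr_complexify_neg [Neg ι] {b : HilbertBasis ι ℂ (Lp ℂ 2 μ)} (hb : ConjSymm b)
    (f : Lp ℝ 2 μ) (k : ι) :
    b.repr (complexify μ f) (-k) = conj (b.repr (complexify μ f) k) := by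
  apply repr_conj hb
  filter_upwards [coeFn_complexify f] with x hx
  simp [hx]

theorem tsum_enorm_sq_repr_lt_top (b : HilbertBasis ι ℂ (Lp ℂ 2 μ)) (f : Lp ℂ 2 μ) :
    ∑' k, ‖b.repr f k‖ₑ ^ 2 < ∞ := by
  have h_summable : Summable fun k => ‖b.repr f k‖ ^ 2 := by
    simpa using (memℓp_gen_iff (by norm_num : (0 : ℝ) < (2 : ℝ≥0∞).toReal)).1 (b.repr f).2
  simp_rw [← ofReal_norm, ← ENNReal.ofReal_pow (norm_nonneg _)]
  exact lt_top_iff_ne_top.2 h_summable.tsum_ofReal_ne_top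

theorem memℓp_two_of_tsum_lt_top {c : ι → ℂ} (hc : ∑' k, ‖c k‖ₑ ^ 2 < ∞) : Memℓp c 2 := by
  apply memℓp_gen
  simpa using ENNReal.summable_toReal hc.ne

theorem complexify_re_of_conj_eq {F : Lp ℂ 2 μ} (hF : (fun x => conj (F x)) =ᵐ[μ] F) :
    complexify μ (Complex.reCLM.compLpL 2 μ F) = F := by
  apply Lp.ext
  filter_upwards [coeFn_complexify (Complex.reCLM.compLpL 2 μ F), Complex.reCLM.coeFn_compLpL F, hF]
    with x h_complexify h_re h_conj
  rw [h_complexify, h_re]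
  exact Complex.conj_eq_iff_re.1 h_conj

theorem conj_ae_eq_of_repr_neg [InvolutiveNeg ι] {b : HilbertBasis ι ℂ (Lp ℂ 2 μ)}
    (hb : ConjSymm b) {F : Lp ℂ 2 μ} (hF : ∀ k, b.repr F (-k) = conj (b.repr F k)) :
    (fun x => conj (F x)) =ᵐ[μ] F := by
  let conjF : Lp ℂ 2 μ := (Complex.conjCLE : ℂ →L[ℝ] ℂ).compLpL 2 μ F
  have h_coe : conjF =ᵐ[μ] fun x => conj (F x) := by
    simpa using ContinuousLinearMap.coeFn_compLpL (Complex.conjCLE : ℂ →L[ℝ] ℂ) F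
  have h_eq : conjF = F := by
    apply b.repr.injective
    ext k
    have h_repr := repr_conj hb h_coe (-k)
    rwa [neg_neg, hF, Complex.conj_conj] at h_repr
  exact h_coe.symm.trans (by rw [h_eq])

theorem stronglyMeasurable_repr_symm {T : Type*} [MeasurableSpace T] [Countable ι]
    (b : HilbertBasis ι ℂ (Lp ℂ 2 μ)) {c : T → lp (fun _ : ι => ℂ) 2}
    (hc : ∀ k, StronglyMeasurable fun t => c t k) :
    StronglyMeasurable fun t => b.repr.symm (c t) := by
  refine stronglyMeasurable_of_tendsto (u := Filter.atTop)
    (f := fun (s : Finset ι) t => ∑ k ∈ s, c t k • (b k : Lp ℂ 2 μ)) (fun s => ?_)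
    (tendsto_pi_nhds.2 fun t => b.hasSum_repr_symm (c t))
  exact Finset.stronglyMeasurable_fun_sum _ fun k _ => (hc k).smul stronglyMeasurable_const

theorem exists_stronglyMeasurable_repr_eq {T : Type*} [MeasurableSpace T] [InvolutiveNeg ι]
    [Countable ι] {b : HilbertBasis ι ℂ (Lp ℂ 2 μ)} (hb : ConjSymm b) {c : T → ι → ℂ}
    (hmeas : ∀ k, StronglyMeasurable fun t => c t k) (hc : ∀ t, ∑' k, ‖c t k‖ₑ ^ 2 < ∞)
    (hconj : ∀ t k, c t (-k) = conj (c t k)) :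
    ∃ f : T → Lp ℝ 2 μ, StronglyMeasurable f ∧ ∀ t k, b.repr (complexify μ (f t)) k = c t k := by
  let cLp : T → lp (fun _ : ι => ℂ) 2 := fun t => ⟨c t, memℓp_two_of_tsum_lt_top (hc t)⟩
  let F : T → Lp ℂ 2 μ := fun t => b.repr.symm (cLp t)
  have h_repr : ∀ t k, b.repr (F t) k = c t k := fun t k => by simp [F, cLp]
  refine ⟨fun t => Complex.reCLM.compLpL 2 μ (F t),
    (Complex.reCLM.compLpL 2 μ).continuous.comp_stronglyMeasurable
      (stronglyMeasurable_repr_symm b hmeas), fun t k => ?_⟩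
  rw [complexify_re_of_conj_eq
    (conj_ae_eq_of_repr_neg hb fun j => by rw [h_repr, h_repr, hconj]), h_repr]

end RealFourier

/-! ### The Fourier basis of the two-torus -/

section Torus

variable {l : ℝ}

/-- The normalised Lebesgue measure of the two-torus. -/
abbrev haar2 (l : ℝ) [Fact (0 < l)] : Measure (AddCircle l × AddCircle l) :=
  (AddCircle.haarAddCircle : Measure (AddCircle l)).prod
    (AddCircle.haarAddCircle : Measure (AddCircle l))

/-- The exponential monomials on the two-torus. -/
def fourier2 (k : ℤ × ℤ) : C(AddCircle l × AddCircle l, ℂ) where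
  toFun p := fourier k.1 p.1 * fourier k.2 p.2
  continuous_toFun := by fun_prop

theorem fourier2_apply (k : ℤ × ℤ) (p : AddCircle l × AddCircle l) :
    fourier2 k p = fourier k.1 p.1 * fourier k.2 p.2 := rfl

theorem fourier2_neg (k : ℤ × ℤ) (p : AddCircle l × AddCircle l) :
    fourier2 (-k) p = conj (fourier2 k p) := by
  simp [fourier2_apply]

theorem fourier2_add (j k : ℤ × ℤ) (p : AddCircle l × AddCircle l) :
    fourier2 (j + k) p = fourier2 j p * fourier2 k p := by
  simp only [fourier2_apply, Prod.fst_add, Prod.snd_add, fourier_add]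
  ring

/-- The star algebra generated by the exponential monomials. -/
def fourier2Subalgebra (l : ℝ) : StarSubalgebra ℂ C(AddCircle l × AddCircle l, ℂ) where
  toSubalgebra := Algebra.adjoin ℂ (range (fourier2 (l := l)))
  star_mem' := by
    change Algebra.adjoin ℂ (range (fourier2 (l := l))) ≤
      star (Algebra.adjoin ℂ (range (fourier2 (l := l))))
    refine Algebra.adjoin_le ?_
    rintro _ ⟨n, rfl⟩
    refine Algebra.subset_adjoin ⟨-n, ?_⟩
    ext1 x
    simp only [fourier2_neg, starRingEnd_apply, ContinuousMap.star_apply]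

theorem fourier2Subalgebra_coe :
    Subalgebra.toSubmodule (fourier2Subalgebra l).toSubalgebra =
      Submodule.span ℂ (range (fourier2 (l := l))) := by
  apply Algebra.adjoin_eq_span_of_subset
  refine .trans (fun x ↦ Submonoid.closure_induction (fun _ ↦ id) ⟨0, ?_⟩ ?_) Submodule.subset_span
  · ext z
    simp [fourier2_apply]
  · rintro _ _ _ _ ⟨m, rfl⟩ ⟨n, rfl⟩
    refine ⟨m + n, ?_⟩
    ext z
    simp [fourier2_add]

variable [hl : Fact (0 < l)]

theorem fourier2Subalgebra_separatesPoints : (fourier2Subalgebra l).SeparatesPoints := by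
  intro p r hpr
  have hmem : ∀ k, fourier2 k ∈ fourier2Subalgebra l := fun k => Algebra.subset_adjoin ⟨k, rfl⟩
  have h_inj : Function.Injective fun x : AddCircle l => (fourier 1 x : ℂ) := fun x y hxy => by
    simp only [fourier_one] at hxy
    exact AddCircle.injective_toCircle hl.out.ne' (Subtype.coe_injective hxy)
  rcases not_and_or.1 (mt Prod.ext_iff.2 hpr) with h_fst | h_snd
  · refine ⟨fourier2 (1, 0), ⟨fourier2 (1, 0), hmem _, rfl⟩, fun h => h_fst (h_inj ?_)⟩
    simpa only [fourier2_apply, fourier_zero, mul_one] using h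
  · refine ⟨fourier2 (0, 1), ⟨fourier2 (0, 1), hmem _, rfl⟩, fun h => h_snd (h_inj ?_)⟩
    simpa only [fourier2_apply, fourier_zero, one_mul] using h

theorem span_fourier2_closure_eq_top :
    (Submodule.span ℂ (range (fourier2 (l := l)))).topologicalClosure = ⊤ := by
  rw [← fourier2Subalgebra_coe]
  exact congr_arg (Subalgebra.toSubmodule <| StarSubalgebra.toSubalgebra ·)
    (ContinuousMap.starSubalgebra_topologicalClosure_eq_top_of_separatesPoints _
      (fourier2Subalgebra_separatesPoints (l := l)))

/-- The exponential monomials as elements of `L²`. -/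
abbrev fourier2Lp (k : ℤ × ℤ) : Lp ℂ 2 (haar2 l) :=
  ContinuousMap.toLp (E := ℂ) 2 (haar2 l) ℂ (fourier2 k)

theorem span_fourier2Lp_closure_eq_top :
    (Submodule.span ℂ (range (fourier2Lp (l := l)))).topologicalClosure = ⊤ := by
  simpa only [Submodule.map_span, ContinuousLinearMap.coe_coe, ← range_comp, Function.comp_def]
    using (ContinuousMap.toLp_denseRange ℂ (haar2 l) ℂ (by simp)).topologicalClosure_map_submodule
      span_fourier2_closure_eq_top

theorem orthonormal_fourier2 : Orthonormal ℂ (fourier2Lp (l := l)) := by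
  rw [orthonormal_iff_ite]
  intro m n
  have h_circle := orthonormal_iff_ite.mp (orthonormal_fourier (T := l))
  simp only [ContinuousMap.inner_toLp, ← fourier_neg, ← fourier_add] at h_circle
  rw [ContinuousMap.inner_toLp]
  simp only [← fourier2_neg, ← fourier2_add]
  simp only [fourier2_apply, Prod.fst_add, Prod.snd_add, Prod.fst_neg, Prod.snd_neg]
  rw [integral_prod_mul (fun x : AddCircle l => (fourier (n.1 + -m.1) x : ℂ))
    (fun y : AddCircle l => (fourier (n.2 + -m.2) y : ℂ)), h_circle, h_circle]
  simp only [Prod.ext_iff, ite_and, ite_mul, one_mul, zero_mul]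

/-- The Hilbert basis of exponential monomials. -/
def fourier2Basis (l : ℝ) [Fact (0 < l)] : HilbertBasis (ℤ × ℤ) ℂ (Lp ℂ 2 (haar2 l)) :=
  HilbertBasis.mk orthonormal_fourier2 span_fourier2Lp_closure_eq_top.ge

theorem coeFn_fourier2Basis (k : ℤ × ℤ) :
    (fourier2Basis l k : AddCircle l × AddCircle l → ℂ) =ᵐ[haar2 l] fourier2 k := by
  rw [fourier2Basis, HilbertBasis.coe_mk]
  exact ContinuousMap.coeFn_toLp _ _

theorem coeFn_fourierBasis (k : ℤ) :
    (fourierBasis k : AddCircle l → ℂ) =ᵐ[AddCircle.haarAddCircle] fourier k := by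
  rw [coe_fourierBasis]
  exact coeFn_fourierLp 2 k

theorem conjSymm_fourierBasis : ConjSymm (fourierBasis (T := l)) := by
  intro k
  filter_upwards [coeFn_fourierBasis (l := l) k, coeFn_fourierBasis (l := l) (-k)] with x hx hx_neg
  rw [hx, hx_neg, fourier_neg]

theorem conjSymm_fourier2Basis : ConjSymm (fourier2Basis l) := by
  intro k
  filter_upwards [coeFn_fourier2Basis (l := l) k, coeFn_fourier2Basis (l := l) (-k)]
    with x hx hx_neg
  rw [hx, hx_neg, fourier2_neg]

theorem hat1_eq_repr (f : L2y l) (n : ℤ) :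
    hat1 f n = fourierBasis.repr (complexify _ f) n := by
  rw [fourierBasis_repr, hat1, fourierCoeff_congr_ae (coeFn_complexify f).symm]

theorem hat2_eq_repr (f : L2xy l) (k : ℤ × ℤ) :
    hat2 f k = (fourier2Basis l).repr (complexify _ f) k := by
  rw [HilbertBasis.repr_apply_apply, L2.inner_def, hat2]
  apply integral_congr_ae
  filter_upwards [coeFn_complexify f, coeFn_fourier2Basis (l := l) k] with p hf hk
  rw [hf, hk, RCLike.inner_apply', ← fourier2_neg]
  rfl

theorem hat1_neg (f : L2y l) (n : ℤ) : hat1 f (-n) = conj (hat1 f n) := by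
  rw [hat1_eq_repr, hat1_eq_repr, repr_complexify_neg conjSymm_fourierBasis]

theorem hat2_neg (f : L2xy l) (k : ℤ × ℤ) : hat2 f (-k) = conj (hat2 f k) := by
  rw [hat2_eq_repr, hat2_eq_repr, repr_complexify_neg conjSymm_fourier2Basis]

theorem hat1_injective {f g : L2y l} (h : ∀ n, hat1 f n = hat1 g n) : f = g := by
  apply complexify_injective
  apply fourierBasis.repr.injective
  ext n
  rw [← hat1_eq_repr, ← hat1_eq_repr, h]

theorem hat2_injective {f g : L2xy l} (h : ∀ k, hat2 f k = hat2 g k) : f = g := by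
  apply complexify_injective
  apply (fourier2Basis l).repr.injective
  ext n
  rw [← hat2_eq_repr, ← hat2_eq_repr, h]

theorem tsum_enorm_sq_hat2_lt_top (f : L2xy l) : ∑' k, ‖hat2 f k‖ₑ ^ 2 < ∞ := by
  simp_rw [hat2_eq_repr]
  exact tsum_enorm_sq_repr_lt_top _ _

theorem continuous_hat1 (n : ℤ) : Continuous fun f : L2y l => hat1 f n := by
  simp_rw [hat1_eq_repr, HilbertBasis.repr_apply_apply]
  exact continuous_const.inner (complexify _).continuous

theorem continuous_hat2 (k : ℤ × ℤ) : Continuous fun f : L2xy l => hat2 f k := by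
  simp_rw [hat2_eq_repr, HilbertBasis.repr_apply_apply]
  exact continuous_const.inner (complexify _).continuous

end Torus

/-! ### Sums over the frequency lattice with values in `[0, ∞]` -/

section Sums

theorem sq_tsum_mul_le {ι : Type*} (f g : ι → ℝ≥0∞) :
    (∑' i, f i * g i) ^ 2 ≤ (∑' i, f i ^ 2) * ∑' i, g i ^ 2 := by
  have h : ∑' i, f i * g i ≤ ((∑' i, f i ^ 2) * ∑' i, g i ^ 2) ^ (1 / 2 : ℝ) := by
    rw [ENNReal.tsum_eq_iSup_sum]
    refine iSup_le fun s => ?_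
    refine (ENNReal.inner_le_Lp_mul_Lq s f g (Real.HolderConjugate.two_two)).trans ?_
    rw [ENNReal.mul_rpow_of_nonneg _ _ (by norm_num)]
    gcongr <;> simp only [ENNReal.rpow_two] <;> exact ENNReal.sum_le_tsum s
  calc (∑' i, f i * g i) ^ 2
      ≤ (((∑' i, f i ^ 2) * ∑' i, g i ^ 2) ^ (1 / 2 : ℝ)) ^ 2 := by gcongr
    _ = _ := by rw [← ENNReal.rpow_natCast, ← ENNReal.rpow_mul]; norm_num

theorem add_sq_le_two_mul (a b : ℝ≥0∞) : (a + b) ^ 2 ≤ 2 * (a ^ 2 + b ^ 2) := by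
  have h := ENNReal.rpow_add_le_mul_rpow_add_rpow a b (one_le_two)
  norm_num at h
  exact h

theorem rpow_neg_le_rpow_neg {x y : ℝ≥0∞} {a : ℝ} (ha : 0 ≤ a) (h : x ≤ y) :
    y ^ (-a) ≤ x ^ (-a) := by
  rw [ENNReal.rpow_neg, ENNReal.rpow_neg, ENNReal.inv_le_inv]
  gcongr

theorem rpow_neg_mul_rpow_neg_le {x y : ℝ≥0∞} (hx : x ≠ 0) (hy : y ≠ 0) (hx' : x ≠ ∞)
    (hy' : y ≠ ∞) {a b : ℝ} (ha : 0 ≤ a) (hb : 0 ≤ b) :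
    x ^ (-a) * y ^ (-b) ≤ x ^ (-(a + b)) + y ^ (-(a + b)) := by
  rcases le_total x y with h | h
  · refine le_trans ?_ le_self_add
    rw [neg_add, ENNReal.rpow_add _ _ hx hx']
    gcongr x ^ (-a) * ?_
    exact rpow_neg_le_rpow_neg (by assumption) h
  · refine le_trans ?_ le_add_self
    rw [neg_add, ENNReal.rpow_add _ _ hy hy']
    gcongr ?_ * y ^ (-b)
    exact rpow_neg_le_rpow_neg (by assumption) h

theorem tsum_prod_mul {α β : Type*} (f : α → ℝ≥0∞) (g : β → ℝ≥0∞) :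
    ∑' k : α × β, f k.1 * g k.2 = (∑' a, f a) * ∑' b, g b := by
  rw [ENNReal.tsum_prod (f := fun a b => f a * g b)]
  simp_rw [ENNReal.tsum_mul_left, ENNReal.tsum_mul_right]

end Sums

section Weights

variable (l : ℝ)

/-- The weight `1 + κ²` in one dimension. -/
def wt1 (n : ℤ) : ℝ≥0∞ := ENNReal.ofReal (1 + freq l n ^ 2)

/-- The weight `1 + |κ|²` in two dimensions. -/
def wt2 (k : ℤ × ℤ) : ℝ≥0∞ := ENNReal.ofReal (1 + freqSq l k)

theorem freqSq_nonneg (k : ℤ × ℤ) : 0 ≤ freqSq l k := by unfold freqSq; positivity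

theorem freq_zero : freq l 0 = 0 := by simp [freq]

theorem freq_neg (n : ℤ) : freq l (-n) = -freq l n := by simp [freq, neg_div]

theorem freq_sub (m n : ℤ) : freq l (m - n) = freq l m - freq l n := by
  simp only [freq, Int.cast_sub]; ring

theorem freqSq_zonal (n : ℤ) : freqSq l (0, n) = freq l n ^ 2 := by simp [freqSq, freq_zero]

theorem wt2_zonal (n : ℤ) : wt2 l (0, n) = wt1 l n := by simp [wt1, wt2, freqSq_zonal]

theorem one_le_wt1 (n : ℤ) : 1 ≤ wt1 l n := by
  rw [wt1, ENNReal.one_le_ofReal]; nlinarith [sq_nonneg (freq l n)]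

theorem one_le_wt2 (k : ℤ × ℤ) : 1 ≤ wt2 l k := by
  rw [wt2, ENNReal.one_le_ofReal]; linarith [freqSq_nonneg l k]

theorem wt1_ne_zero (n : ℤ) : wt1 l n ≠ 0 := (zero_lt_one.trans_le (one_le_wt1 l n)).ne'

theorem wt2_ne_zero (k : ℤ × ℤ) : wt2 l k ≠ 0 := (zero_lt_one.trans_le (one_le_wt2 l k)).ne'

theorem wt1_ne_top (n : ℤ) : wt1 l n ≠ ∞ := ENNReal.ofReal_ne_top

theorem wt2_ne_top (k : ℤ × ℤ) : wt2 l k ≠ ∞ := ENNReal.ofReal_ne_top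

theorem wt1_fst_le (k : ℤ × ℤ) : wt1 l k.1 ≤ wt2 l k := by
  apply ENNReal.ofReal_le_ofReal
  rw [freqSq]; nlinarith [sq_nonneg (freq l k.2)]

theorem wt1_snd_le (k : ℤ × ℤ) : wt1 l k.2 ≤ wt2 l k := by
  apply ENNReal.ofReal_le_ofReal
  rw [freqSq]; nlinarith [sq_nonneg (freq l k.1)]

theorem wt2_neg (k : ℤ × ℤ) : wt2 l (-k) = wt2 l k := by
  simp [wt2, freqSq, freq_neg]

theorem wt2_rpow_add (k : ℤ × ℤ) (a b : ℝ) : wt2 l k ^ (a + b) = wt2 l k ^ a * wt2 l k ^ b :=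
  ENNReal.rpow_add _ _ (wt2_ne_zero l k) (wt2_ne_top l k)

theorem wt1_rpow_add (n : ℤ) (a b : ℝ) : wt1 l n ^ (a + b) = wt1 l n ^ a * wt1 l n ^ b :=
  ENNReal.rpow_add _ _ (wt1_ne_zero l n) (wt1_ne_top l n)

theorem freqSq_le_two_mul (k h : ℤ × ℤ) :
    freqSq l k ≤ 2 * (freqSq l h + freqSq l (k - h)) := by
  simp only [freqSq, Prod.fst_sub, Prod.snd_sub, freq_sub]
  nlinarith [sq_nonneg (2 * freq l h.1 - freq l k.1), sq_nonneg (2 * freq l h.2 - freq l k.2)]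

theorem wt2_le_two_mul_add (k h : ℤ × ℤ) : wt2 l k ≤ 2 * (wt2 l h + wt2 l (k - h)) := by
  have h_two : (2 : ℝ≥0∞) = ENNReal.ofReal 2 := by simp
  have hh := freqSq_nonneg l h
  have hkh := freqSq_nonneg l (k - h)
  rw [wt2, wt2, wt2, h_two, ← ENNReal.ofReal_add (by linarith) (by linarith),
    ← ENNReal.ofReal_mul (by norm_num)]
  apply ENNReal.ofReal_le_ofReal
  linarith [freqSq_le_two_mul l k h]

theorem wt2_le_two_mul_mul (m h : ℤ × ℤ) : wt2 l m ≤ 2 * (wt2 l (m + h) * wt2 l h) := by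
  have h_two : (2 : ℝ≥0∞) = ENNReal.ofReal 2 := by simp
  have hh := freqSq_nonneg l h
  have hmh := freqSq_nonneg l (m + h)
  rw [wt2, wt2, wt2, h_two, ← ENNReal.ofReal_mul (by linarith),
    ← ENNReal.ofReal_mul (by norm_num)]
  apply ENNReal.ofReal_le_ofReal
  have h_diff : freqSq l (m - (m + h)) = freqSq l h := by
    simp [freqSq, freq_neg]
  have h_le := freqSq_le_two_mul l m (m + h)
  rw [h_diff] at h_le
  nlinarith [mul_nonneg hh hmh]

theorem wt2_rpow_le (k h : ℤ × ℤ) {r : ℝ} (hr : 0 ≤ r) :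
    wt2 l k ^ r ≤ 4 ^ r * (wt2 l h ^ r + wt2 l (k - h) ^ r) := by
  have h_max : wt2 l k ≤ 4 * max (wt2 l h) (wt2 l (k - h)) := by
    calc wt2 l k ≤ 2 * (wt2 l h + wt2 l (k - h)) := wt2_le_two_mul_add l k h
      _ ≤ 2 * (max (wt2 l h) (wt2 l (k - h)) + max (wt2 l h) (wt2 l (k - h))) := by
          gcongr
          exacts [le_max_left _ _, le_max_right _ _]
      _ = _ := by ring
  calc wt2 l k ^ r ≤ (4 * max (wt2 l h) (wt2 l (k - h))) ^ r := by gcongr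
    _ = 4 ^ r * max (wt2 l h ^ r) (wt2 l (k - h) ^ r) := by
        rw [ENNReal.mul_rpow_of_nonneg _ _ hr, ENNReal.max_rpow hr]
    _ ≤ _ := by
        gcongr
        exact max_le le_self_add le_add_self

theorem wt2_rpow_neg_le (k : ℤ × ℤ) {a b : ℝ} (ha : 0 ≤ a) (hb : 0 ≤ b) :
    wt2 l k ^ (-(a + b)) ≤ wt1 l k.1 ^ (-a) * wt1 l k.2 ^ (-b) := by
  rw [neg_add, wt2_rpow_add]
  gcongr ?_ * ?_
  · exact rpow_neg_le_rpow_neg (by assumption) (wt1_fst_le l k)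
  · exact rpow_neg_le_rpow_neg (by assumption) (wt1_snd_le l k)

/-- The lattice sums `∑ (1 + κ²)^(-p)`. -/
def latticeSum1 (p : ℝ) : ℝ≥0∞ := ∑' n, wt1 l n ^ (-p)

/-- The lattice sums `∑ (1 + |κ|²)^(-p)`. -/
def latticeSum2 (p : ℝ) : ℝ≥0∞ := ∑' k, wt2 l k ^ (-p)

variable {l}

theorem summable_one_add_freq_sq_rpow (hl : 0 < l) {p : ℝ} (hp : 1 / 2 < p) :
    Summable fun n : ℤ => (1 + freq l n ^ 2) ^ (-p) := by
  have h_int : Summable fun n : ℤ => (2 * Real.pi / l) ^ (-(2 * p)) * |(n : ℝ)| ^ (-(2 * p)) :=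
    (Real.summable_abs_int_rpow (by linarith)).mul_left _
  refine h_int.of_norm_bounded_eventually ?_
  filter_upwards [(finite_singleton (0 : ℤ)).compl_mem_cofinite] with n hn
  have hn' : 0 < |(n : ℝ)| := abs_pos.2 (by exact_mod_cast hn)
  have h_freq : freq l n ^ 2 = (2 * Real.pi / l * |(n : ℝ)|) ^ 2 := by
    rw [mul_pow, sq_abs, ← mul_pow, freq]
    ring
  calc ‖(1 + freq l n ^ 2) ^ (-p)‖ = (1 + freq l n ^ 2) ^ (-p) :=
        Real.norm_of_nonneg (by positivity)
    _ ≤ ((2 * Real.pi / l * |(n : ℝ)|) ^ 2) ^ (-p) :=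
        Real.rpow_le_rpow_of_nonpos (by positivity) (by linarith) (by linarith)
    _ = (2 * Real.pi / l * |(n : ℝ)|) ^ (-(2 * p)) := by
        rw [← Real.rpow_natCast, ← Real.rpow_mul (by positivity)]
        push_cast
        ring_nf
    _ = _ := Real.mul_rpow (by positivity) hn'.le

theorem latticeSum1_lt_top (hl : 0 < l) {p : ℝ} (hp : 1 / 2 < p) : latticeSum1 l p < ∞ := by
  have h_ofReal : ∀ n, wt1 l n ^ (-p) = ENNReal.ofReal ((1 + freq l n ^ 2) ^ (-p)) := fun n => by
    rw [wt1, ENNReal.ofReal_rpow_of_pos (by positivity)]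
  simp_rw [latticeSum1, h_ofReal]
  exact lt_top_iff_ne_top.2 (summable_one_add_freq_sq_rpow hl hp).tsum_ofReal_ne_top

theorem latticeSum2_lt_top (hl : 0 < l) {p : ℝ} (hp : 1 < p) : latticeSum2 l p < ∞ := by
  have h_prod : latticeSum2 l p ≤ latticeSum1 l (p / 2) * latticeSum1 l (p / 2) := by
    rw [latticeSum1, ← tsum_prod_mul, latticeSum2]
    refine ENNReal.tsum_le_tsum fun k => ?_
    simpa only [add_halves] using
      wt2_rpow_neg_le l k (a := p / 2) (b := p / 2) (by linarith) (by linarith)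
  have h_half := latticeSum1_lt_top hl (p := p / 2) (by linarith)
  exact h_prod.trans_lt (ENNReal.mul_lt_top h_half h_half)

variable (l)

theorem tsum_wt2_mul_wt2_le (m : ℤ × ℤ) {a b : ℝ} (ha : 0 ≤ a) (hb : 0 ≤ b) :
    ∑' h, wt2 l (m + h) ^ (-a) * wt2 l h ^ (-b) ≤ 2 * latticeSum2 l (a + b) := by
  calc ∑' h, wt2 l (m + h) ^ (-a) * wt2 l h ^ (-b)
      ≤ ∑' h, (wt2 l (m + h) ^ (-(a + b)) + wt2 l h ^ (-(a + b))) :=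
        ENNReal.tsum_le_tsum fun h => rpow_neg_mul_rpow_neg_le (wt2_ne_zero _ _) (wt2_ne_zero _ _)
          (wt2_ne_top _ _) (wt2_ne_top _ _) ha hb
    _ = 2 * latticeSum2 l (a + b) := by
        have h_shift : ∑' h, wt2 l (m + h) ^ (-(a + b)) = latticeSum2 l (a + b) :=
          (Equiv.addLeft m).tsum_eq fun h => wt2 l h ^ (-(a + b))
        rw [ENNReal.tsum_add, h_shift, two_mul, latticeSum2]

theorem tsum_wt2_mul_wt2_sub_le (m : ℤ × ℤ) {a b : ℝ} (ha : 0 ≤ a) (hb : 0 ≤ b) :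
    ∑' h, wt2 l h ^ (-a) * wt2 l (m - h) ^ (-b) ≤ 2 * latticeSum2 l (a + b) := by
  rw [add_comm a b]
  refine le_trans (le_of_eq (tsum_congr fun h => ?_)) (tsum_wt2_mul_wt2_le l (-m) hb ha)
  rw [show -m + h = -(m - h) by abel, wt2_neg, mul_comm]

theorem wt2_rpow_neg_mul_wt2_rpow_neg_le (m h : ℤ × ℤ) {a : ℝ} (ha : 0 ≤ a) (ha' : a ≤ 1) :
    wt2 l (m + h) ^ (-a) * wt2 l h ^ (-a) ≤ 2 * wt1 l m.1 ^ (-a) := by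
  have h_two : (2 : ℝ≥0∞) ^ a ≤ 2 :=
    (ENNReal.rpow_le_rpow_of_exponent_le one_le_two ha').trans_eq (ENNReal.rpow_one 2)
  have h_wt : wt1 l m.1 ^ a ≤ 2 * (wt2 l (m + h) * wt2 l h) ^ a := by
    calc wt1 l m.1 ^ a ≤ (2 * (wt2 l (m + h) * wt2 l h)) ^ a := by
          gcongr
          exact (wt1_fst_le l m).trans (wt2_le_two_mul_mul l m h)
      _ = 2 ^ a * (wt2 l (m + h) * wt2 l h) ^ a := ENNReal.mul_rpow_of_nonneg _ _ ha
      _ ≤ _ := by gcongr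
  rw [← ENNReal.mul_rpow_of_ne_top (wt2_ne_top _ _) (wt2_ne_top _ _), ENNReal.rpow_neg,
    ENNReal.rpow_neg]
  calc ((wt2 l (m + h) * wt2 l h) ^ a)⁻¹ = 2 * (2 * (wt2 l (m + h) * wt2 l h) ^ a)⁻¹ := by
        rw [ENNReal.mul_inv (by simp) (by simp), ← mul_assoc,
          ENNReal.mul_inv_cancel two_ne_zero ENNReal.ofNat_ne_top, one_mul]
    _ ≤ 2 * (wt1 l m.1 ^ a)⁻¹ := mul_le_mul' le_rfl (ENNReal.inv_le_inv' h_wt)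

theorem tsum_wt2_rpow_mul_wt2_rpow_le (m : ℤ × ℤ) {a p q : ℝ} (ha : 0 ≤ a) (ha' : a ≤ 1)
    (hp : 0 ≤ p) (hq : 0 ≤ q) :
    ∑' h, wt2 l (m + h) ^ (-(a + p)) * wt2 l h ^ (-(a + q)) ≤
      4 * latticeSum2 l (p + q) * wt1 l m.1 ^ (-a) := by
  calc ∑' h, wt2 l (m + h) ^ (-(a + p)) * wt2 l h ^ (-(a + q))
      = ∑' h, (wt2 l (m + h) ^ (-a) * wt2 l h ^ (-a)) *
          (wt2 l (m + h) ^ (-p) * wt2 l h ^ (-q)) := by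
        simp only [neg_add, wt2_rpow_add, mul_mul_mul_comm]
    _ ≤ ∑' h, 2 * wt1 l m.1 ^ (-a) * (wt2 l (m + h) ^ (-p) * wt2 l h ^ (-q)) := by
        gcongr ∑' h, ?_ * _ with h
        exact wt2_rpow_neg_mul_wt2_rpow_neg_le l m h ha ha'
    _ ≤ 2 * wt1 l m.1 ^ (-a) * (2 * latticeSum2 l (p + q)) := by
        rw [ENNReal.tsum_mul_left]
        gcongr
        exact tsum_wt2_mul_wt2_le l m hp hq
    _ = _ := by ring

theorem tsum_mul_convolution_eq {G : Type*} [AddCommGroup G] (c d f : G → ℝ≥0∞) :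
    ∑' k, c k * ∑' h, d h * f (k - h) = ∑' m, f m * ∑' h, c (m + h) * d h := by
  calc ∑' k, c k * ∑' h, d h * f (k - h) = ∑' h, ∑' k, c k * (d h * f (k - h)) := by
        simp_rw [← ENNReal.tsum_mul_left]
        exact ENNReal.tsum_comm
    _ = ∑' h, ∑' m, c (m + h) * (d h * f m) := by
        refine tsum_congr fun h => ?_
        rw [← (Equiv.addRight h).tsum_eq]
        simp
    _ = ∑' m, f m * ∑' h, c (m + h) * d h := by
        rw [ENNReal.tsum_comm]
        refine tsum_congr fun m => ?_
        rw [← ENNReal.tsum_mul_left]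
        exact tsum_congr fun h => by ring

theorem tsum_wt2_mul_convolution_le (f : ℤ × ℤ → ℝ≥0∞) {a p q : ℝ} (ha : 0 ≤ a) (ha' : a ≤ 1)
    (hp : 0 ≤ p) (hq : 0 ≤ q) :
    ∑' k, wt2 l k ^ (-(a + p)) * ∑' h, wt2 l h ^ (-(a + q)) * f (k - h) ≤
      4 * latticeSum2 l (p + q) * ∑' m : ℤ × ℤ, wt1 l m.1 ^ (-a) * f m := by
  rw [tsum_mul_convolution_eq, ← ENNReal.tsum_mul_left]
  refine ENNReal.tsum_le_tsum fun m => ?_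
  calc f m * ∑' h, wt2 l (m + h) ^ (-(a + p)) * wt2 l h ^ (-(a + q))
      ≤ f m * (4 * latticeSum2 l (p + q) * wt1 l m.1 ^ (-a)) := by
        gcongr
        exact tsum_wt2_rpow_mul_wt2_rpow_le l m ha ha' hp hq
    _ = _ := by ring

theorem tsum_wt2_mul_fiber_le (f : ℤ × ℤ → ℝ≥0∞) {a b : ℝ} (ha : 0 ≤ a) (hb : 0 ≤ b) :
    ∑' k : ℤ × ℤ, wt2 l k ^ (-(a + b)) * ∑' n, f (k.1, n) ≤
      latticeSum1 l b * ∑' m : ℤ × ℤ, wt1 l m.1 ^ (-a) * f m := by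
  calc ∑' k : ℤ × ℤ, wt2 l k ^ (-(a + b)) * ∑' n, f (k.1, n)
      ≤ ∑' k : ℤ × ℤ, (wt1 l k.1 ^ (-a) * ∑' n, f (k.1, n)) * wt1 l k.2 ^ (-b) := by
        refine ENNReal.tsum_le_tsum fun k => ?_
        rw [mul_right_comm]
        gcongr
        exact wt2_rpow_neg_le l k ha hb
    _ = (∑' j, wt1 l j ^ (-a) * ∑' n, f (j, n)) * latticeSum1 l b := by
        rw [tsum_prod_mul (fun j => wt1 l j ^ (-a) * ∑' n, f (j, n)) fun n => wt1 l n ^ (-b),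
          latticeSum1]
    _ = _ := by
        rw [mul_comm, ENNReal.tsum_prod (f := fun j n => wt1 l j ^ (-a) * f (j, n))]
        simp_rw [ENNReal.tsum_mul_left]

end Weights

/-! ### The nonlinearity as one bilinear operator on the coefficients -/

/-- Indices of the coefficients of the pair `(u, ζ)`. -/
abbrev Mode : Type := ℤ ⊕ (ℤ × ℤ)

/-- The weight `1 + |κ|²` of a mode. -/
def wt (l : ℝ) : Mode → ℝ≥0∞ := Sum.elim (wt1 l) (wt2 l)

/-- The square of the `ℓ²` norm. -/
def l2Sq (a : Mode → ℝ≥0∞) : ℝ≥0∞ := (∑' n, a (.inl n) ^ 2) + ∑' k, a (.inr k) ^ 2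

/-- Kernel of the transport term in divergence form. -/
def eddyKernel (l : ℝ) (k h : ℤ × ℤ) : ℝ :=
  (freq l h.2 * freq l k.1 - freq l h.1 * freq l k.2) / freqSq l h

/-- Kernel of the Reynolds stress. -/
def meanKernel (l : ℝ) (n : ℤ) (h : ℤ × ℤ) : ℝ :=
  freq l h.1 * freq l (n - h.2) / (freqSq l h * freqSq l ((0, n) - h))

/-- The bilinear operator whose diagonal is the nonlinearity `(G, F)`. It vanishes on the zonal
modes `k.1 = 0`, where the last term of `F` cancels the zonal mean of the transport term. -/
def bilin (l : ℝ) (z w : Mode → ℂ) : Mode → ℂ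
  | .inl n => -(Complex.I * freq l n) *
      ∑' h, (meanKernel l n h : ℂ) * (z (.inr h) * w (.inr ((0, n) - h)))
  | .inr k => if k.1 = 0 then 0 else
      ∑' h, (eddyKernel l k h : ℂ) * (z (.inr h) * w (.inr (k - h))) -
        Complex.I * freq l k.1 * ∑' n, z (.inl n) * w (.inr (k - (0, n)))

/-- The majorant of `bilin`, up to a constant and the square root of the weight. -/
def majorant (l : ℝ) (a b : Mode → ℝ≥0∞) : Mode → ℝ≥0∞
  | .inl n => ∑' h, a (.inr h) * wt2 l h ^ (-(1 / 2) : ℝ) * b (.inr ((0, n) - h))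
  | .inr k => (∑' h, a (.inr h) * wt2 l h ^ (-(1 / 2) : ℝ) * b (.inr (k - h))) +
      ∑' n, a (.inl n) * b (.inr (k - (0, n)))

/-- The constant `1 + (l / 2π)²`, which compares `|κ|²` with `1 + |κ|²`. -/
def gapConst (l : ℝ) : ℝ := 1 + (l / (2 * Real.pi)) ^ 2

theorem one_le_gapConst (l : ℝ) : 1 ≤ gapConst l := by
  unfold gapConst; nlinarith [sq_nonneg (l / (2 * Real.pi))]

section Kernel

variable {l : ℝ}

theorem one_add_freq_sq_le (hl : 0 < l) {n : ℤ} (hn : n ≠ 0) :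
    1 + freq l n ^ 2 ≤ gapConst l * freq l n ^ 2 := by
  have h_one_le : (1 : ℝ) ≤ (n : ℝ) ^ 2 := by
    exact_mod_cast Int.one_le_abs (pow_ne_zero 2 hn) |>.trans_eq (abs_of_nonneg (sq_nonneg n))
  have h_freq : (l / (2 * Real.pi)) ^ 2 * freq l n ^ 2 = (n : ℝ) ^ 2 := by
    have := Real.pi_pos
    rw [freq]
    field_simp
  unfold gapConst
  nlinarith

theorem one_add_freqSq_le (hl : 0 < l) {k : ℤ × ℤ} (hk : k ≠ 0) :
    1 + freqSq l k ≤ gapConst l * freqSq l k := by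
  have h_gap := one_le_gapConst l
  rw [freqSq]
  by_cases h_fst : k.1 = 0
  · have h_snd := one_add_freq_sq_le hl fun h_snd : k.2 = 0 => hk (Prod.ext h_fst h_snd)
    nlinarith [sq_nonneg (freq l k.1)]
  · have h_fst := one_add_freq_sq_le hl h_fst
    nlinarith [sq_nonneg (freq l k.2)]

theorem freqSq_pos (hl : 0 < l) {k : ℤ × ℤ} (hk : k ≠ 0) : 0 < freqSq l k := by
  by_contra! h_nonpos
  have h_zero : freqSq l k = 0 := h_nonpos.antisymm (freqSq_nonneg l k)
  have h_gap := one_add_freqSq_le hl hk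
  rw [h_zero] at h_gap
  linarith

theorem sq_freq_fst_le (k : ℤ × ℤ) : freq l k.1 ^ 2 ≤ freqSq l k :=
  le_add_of_nonneg_right (sq_nonneg _)

theorem sq_freq_snd_le (k : ℤ × ℤ) : freq l k.2 ^ 2 ≤ freqSq l k :=
  le_add_of_nonneg_left (sq_nonneg _)

theorem freqSq_zero : freqSq l 0 = 0 := by simp [freqSq, freq_zero]

theorem enorm_ofReal_le_wt2 {x c : ℝ} (hc : 0 ≤ c) {k h : ℤ × ℤ}
    (hx : x ^ 2 * (1 + freqSq l h) ≤ c ^ 2 * (1 + freqSq l k)) :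
    ‖(x : ℂ)‖ₑ ≤ ENNReal.ofReal c * wt2 l k ^ (1 / 2 : ℝ) * wt2 l h ^ (-(1 / 2) : ℝ) := by
  have hk : 0 < 1 + freqSq l k := by linarith [freqSq_nonneg l k]
  have hh : 0 < 1 + freqSq l h := by linarith [freqSq_nonneg l h]
  rw [wt2, wt2, ENNReal.ofReal_rpow_of_pos hk, ENNReal.ofReal_rpow_of_pos hh,
    ← ENNReal.ofReal_mul hc, ← ENNReal.ofReal_mul (by positivity), ← ofReal_norm,
    Complex.norm_real, Real.norm_eq_abs]
  apply ENNReal.ofReal_le_ofReal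
  apply abs_le_of_sq_le_sq _ (by positivity)
  have h_sq_pos : ((1 + freqSq l k) ^ (1 / 2 : ℝ)) ^ 2 = 1 + freqSq l k := by
    rw [← Real.rpow_natCast, ← Real.rpow_mul hk.le]
    norm_num
  have h_sq_neg : ((1 + freqSq l h) ^ (-(1 / 2) : ℝ)) ^ 2 = (1 + freqSq l h)⁻¹ := by
    rw [← Real.rpow_natCast, ← Real.rpow_mul hh.le]
    norm_num [Real.rpow_neg_one]
  rwa [mul_pow, mul_pow, h_sq_pos, h_sq_neg, ← div_eq_mul_inv, le_div_iff₀ hh]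

theorem enorm_eddyKernel_le (hl : 0 < l) (k h : ℤ × ℤ) :
    ‖(eddyKernel l k h : ℂ)‖ₑ ≤ ENNReal.ofReal (gapConst l ^ 2) * wt2 l k ^ (1 / 2 : ℝ) *
      wt2 l h ^ (-(1 / 2) : ℝ) := by
  have h_gap := one_le_gapConst l
  apply enorm_ofReal_le_wt2 (by positivity)
  have hk := freqSq_nonneg l k
  rcases eq_or_ne h 0 with rfl | h_ne
  · simp only [eddyKernel, freqSq_zero, div_zero, ne_eq, OfNat.ofNat_ne_zero, not_false_eq_true,
      zero_pow, zero_mul]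
    positivity
  have h_pos := freqSq_pos hl h_ne
  rw [eddyKernel, div_pow, div_mul_eq_mul_div, div_le_iff₀ (by positivity)]
  have h_cauchy_schwarz : (freq l h.2 * freq l k.1 - freq l h.1 * freq l k.2) ^ 2 ≤
      freqSq l h * freqSq l k := by
    unfold freqSq
    nlinarith [sq_nonneg (freq l h.2 * freq l k.2 + freq l h.1 * freq l k.1)]
  calc (freq l h.2 * freq l k.1 - freq l h.1 * freq l k.2) ^ 2 * (1 + freqSq l h)
      ≤ (freqSq l h * freqSq l k) * (gapConst l * freqSq l h) := by
        gcongr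
        exact one_add_freqSq_le hl h_ne
    _ = gapConst l * (freqSq l k * freqSq l h ^ 2) := by ring
    _ ≤ gapConst l ^ 4 * ((1 + freqSq l k) * freqSq l h ^ 2) := by
        gcongr
        · exact le_self_pow₀ h_gap (by norm_num)
        · linarith
    _ = _ := by ring

theorem sq_meanKernel_mul_le (hl : 0 < l) (n : ℤ) (h : ℤ × ℤ) :
    meanKernel l n h ^ 2 * (1 + freqSq l h) ≤ (gapConst l ^ 2) ^ 2 := by
  have h_gap := one_le_gapConst l
  rcases eq_or_ne h 0 with rfl | h_ne
  · simp only [meanKernel, freqSq_zero, zero_mul, div_zero, ne_eq, OfNat.ofNat_ne_zero,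
      not_false_eq_true, zero_pow]
    positivity
  rcases eq_or_ne ((0, n) - h) 0 with h_sub | h_sub
  · simp only [meanKernel, h_sub, freqSq_zero, mul_zero, div_zero, ne_eq, OfNat.ofNat_ne_zero,
      not_false_eq_true, zero_pow, zero_mul]
    positivity
  have h_snd := sq_freq_snd_le (l := l) ((0, n) - h)
  rw [Prod.snd_sub] at h_snd
  have h_fst := sq_freq_fst_le (l := l) h
  have hf := one_add_freqSq_le hl h_ne
  have hg := one_add_freqSq_le hl h_sub
  have hf_pos := freqSq_pos hl h_ne
  have hg_pos := freqSq_pos hl h_sub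
  rw [meanKernel, div_pow, div_mul_eq_mul_div, div_le_iff₀ (by positivity)]
  set f := freqSq l h
  set g := freqSq l ((0, n) - h)
  calc (freq l h.1 * freq l (n - h.2)) ^ 2 * (1 + f)
      = freq l h.1 ^ 2 * freq l (n - h.2) ^ 2 * (1 + f) := by ring
    _ ≤ f * g * (gapConst l * f) := by gcongr
    _ = gapConst l * f ^ 2 * g * 1 := by ring
    _ ≤ gapConst l * f ^ 2 * g * (gapConst l * g) := by gcongr; linarith
    _ = gapConst l ^ 2 * (f * g) ^ 2 := by ring
    _ ≤ gapConst l ^ 4 * (f * g) ^ 2 := by gcongr; norm_num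
    _ = (gapConst l ^ 2) ^ 2 * (f * g) ^ 2 := by ring

theorem enorm_meanKernel_le (hl : 0 < l) (n : ℤ) (h : ℤ × ℤ) :
    ‖(meanKernel l n h : ℂ)‖ₑ ≤ ENNReal.ofReal (gapConst l ^ 2) * wt2 l h ^ (-(1 / 2) : ℝ) := by
  have h_wt_zero : wt2 l 0 = 1 := by simp [wt2, freqSq_zero]
  simpa only [h_wt_zero, ENNReal.one_rpow, mul_one] using
    enorm_ofReal_le_wt2 (l := l) (x := meanKernel l n h) (c := gapConst l ^ 2) (k := 0) (h := h)
      (by positivity) (by simpa only [freqSq_zero, add_zero, mul_one] using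
        sq_meanKernel_mul_le hl n h)

theorem enorm_I_mul_freq_le (n : ℤ) : ‖Complex.I * (freq l n : ℂ)‖ₑ ≤ wt1 l n ^ (1 / 2 : ℝ) := by
  rw [wt1, ENNReal.ofReal_rpow_of_pos (by positivity), ← ofReal_norm, norm_mul, Complex.norm_I,
    one_mul, Complex.norm_real, Real.norm_eq_abs, ← Real.sqrt_eq_rpow]
  exact ENNReal.ofReal_le_ofReal (Real.abs_le_sqrt (by linarith))

/-- The constant in the bilinear estimate. -/
def bilinConst (l : ℝ) : ℝ≥0∞ := ENNReal.ofReal (gapConst l ^ 2)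

theorem one_le_bilinConst (l : ℝ) : 1 ≤ bilinConst l := by
  rw [bilinConst, ENNReal.one_le_ofReal]
  exact one_le_pow₀ (one_le_gapConst l)

theorem bilinConst_ne_top (l : ℝ) : bilinConst l ≠ ∞ := ENNReal.ofReal_ne_top

theorem enorm_bilin_inl_le (hl : 0 < l) (z w : Mode → ℂ) (n : ℤ) :
    ‖bilin l z w (.inl n)‖ₑ ≤ bilinConst l * wt1 l n ^ (1 / 2 : ℝ) *
      majorant l (fun j => ‖z j‖ₑ) (fun j => ‖w j‖ₑ) (.inl n) := by
  have h_term : ∀ h, ‖(meanKernel l n h : ℂ) * (z (.inr h) * w (.inr ((0, n) - h)))‖ₑ ≤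
      bilinConst l *
        (‖z (.inr h)‖ₑ * wt2 l h ^ (-(1 / 2) : ℝ) * ‖w (.inr ((0, n) - h))‖ₑ) := fun h => by
    rw [enorm_mul, enorm_mul]
    calc _ ≤ (bilinConst l * wt2 l h ^ (-(1 / 2) : ℝ)) *
          (‖z (.inr h)‖ₑ * ‖w (.inr ((0, n) - h))‖ₑ) := by
          gcongr
          exact enorm_meanKernel_le hl n h
      _ = _ := by ring
  simp only [bilin, majorant]
  rw [enorm_mul, enorm_neg]
  calc _ ≤ wt1 l n ^ (1 / 2 : ℝ) *
        ∑' h, ‖(meanKernel l n h : ℂ) * (z (.inr h) * w (.inr ((0, n) - h)))‖ₑ := by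
        gcongr
        · exact enorm_I_mul_freq_le n
        · exact enorm_tsum_le_tsum_enorm
    _ ≤ wt1 l n ^ (1 / 2 : ℝ) * ∑' h, bilinConst l *
        (‖z (.inr h)‖ₑ * wt2 l h ^ (-(1 / 2) : ℝ) * ‖w (.inr ((0, n) - h))‖ₑ) := by
        gcongr with h
        exact h_term h
    _ = _ := by rw [ENNReal.tsum_mul_left]; ring

theorem enorm_tsum_eddyKernel_mul_le (hl : 0 < l) (f g : ℤ × ℤ → ℂ) (k : ℤ × ℤ) :
    ‖∑' h, (eddyKernel l k h : ℂ) * (f h * g (k - h))‖ₑ ≤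
      bilinConst l * wt2 l k ^ (1 / 2 : ℝ) *
        ∑' h, ‖f h‖ₑ * wt2 l h ^ (-(1 / 2) : ℝ) * ‖g (k - h)‖ₑ := by
  refine enorm_tsum_le_tsum_enorm.trans ?_
  rw [← ENNReal.tsum_mul_left]
  gcongr with h
  rw [enorm_mul, enorm_mul]
  calc _ ≤ (bilinConst l * wt2 l k ^ (1 / 2 : ℝ) * wt2 l h ^ (-(1 / 2) : ℝ)) *
        (‖f h‖ₑ * ‖g (k - h)‖ₑ) := by
        gcongr
        exact enorm_eddyKernel_le hl k h
    _ = _ := by ring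

theorem enorm_freq_mul_tsum_le (f : ℤ → ℂ) (g : ℤ × ℤ → ℂ) (k : ℤ × ℤ) :
    ‖Complex.I * freq l k.1 * ∑' n, f n * g (k - (0, n))‖ₑ ≤
      bilinConst l * wt2 l k ^ (1 / 2 : ℝ) * ∑' n, ‖f n‖ₑ * ‖g (k - (0, n))‖ₑ := by
  have h_wt : wt1 l k.1 ^ (1 / 2 : ℝ) ≤ bilinConst l * wt2 l k ^ (1 / 2 : ℝ) := by
    rw [← one_mul (wt1 l k.1 ^ _)]
    gcongr
    · exact one_le_bilinConst l
    · exact wt1_fst_le l k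
  rw [enorm_mul]
  gcongr
  · exact (enorm_I_mul_freq_le k.1).trans h_wt
  · exact enorm_tsum_le_tsum_enorm.trans_eq (by simp only [enorm_mul])

theorem enorm_bilin_le (hl : 0 < l) (z w : Mode → ℂ) (i : Mode) :
    ‖bilin l z w i‖ₑ ≤ bilinConst l * wt l i ^ (1 / 2 : ℝ) *
      majorant l (fun j => ‖z j‖ₑ) (fun j => ‖w j‖ₑ) i := by
  rcases i with n | k
  · exact enorm_bilin_inl_le hl z w n
  · simp only [bilin, wt, majorant, Sum.elim_inr]
    split_ifs with hk
    · simp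
    · rw [mul_add]
      exact enorm_sub_le.trans (add_le_add
        (enorm_tsum_eddyKernel_mul_le hl (fun h => z (.inr h)) (fun h => w (.inr h)) k)
        (enorm_freq_mul_tsum_le (fun n => z (.inl n)) (fun h => w (.inr h)) k))

end Kernel

section Majorant

variable (l : ℝ)

theorem wt2_rpow_le_one (k : ℤ × ℤ) {a : ℝ} (ha : 0 < a) : wt2 l k ^ (-a) ≤ 1 := by
  rw [ENNReal.rpow_neg, ENNReal.inv_le_one]
  exact ENNReal.one_le_rpow (one_le_wt2 l k) ha

theorem majorant_mono {a a' b b' : Mode → ℝ≥0∞} (ha : ∀ i, a i ≤ a' i) (hb : ∀ i, b i ≤ b' i)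
    (i : Mode) : majorant l a b i ≤ majorant l a' b' i := by
  rcases i with n | k <;> simp only [majorant]
  · gcongr <;> first | exact ha _ | exact hb _
  · gcongr <;> first | exact ha _ | exact hb _

theorem tsum_sub_left (b : ℤ × ℤ → ℝ≥0∞) (k : ℤ × ℤ) : ∑' h, b (k - h) = ∑' h, b h := by
  simpa using (Equiv.subLeft k).tsum_eq b

theorem tsum_fiber_sub (b : ℤ × ℤ → ℝ≥0∞) (k : ℤ × ℤ) :
    ∑' n, b (k - (0, n)) = ∑' n, b (k.1, n) := by
  rw [← (Equiv.subLeft k.2).tsum_eq fun n => b (k.1, n)]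
  exact tsum_congr fun n => congrArg b (Prod.ext (sub_zero _) rfl)

theorem tsum_fiber_le (b : ℤ × ℤ → ℝ≥0∞) (j : ℤ) : ∑' n, b (j, n) ≤ ∑' k, b k :=
  ENNReal.tsum_comp_le_tsum_of_injective (Prod.mk_right_injective j) b

theorem sq_conv_le_weight_right (a b : ℤ × ℤ → ℝ≥0∞) (k : ℤ × ℤ) :
    (∑' h, a h * wt2 l h ^ (-(1 / 2) : ℝ) * b (k - h)) ^ 2 ≤
      (∑' h, a h ^ 2) * ∑' h, wt2 l h ^ (-1 : ℝ) * b (k - h) ^ 2 := by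
  calc _ = (∑' h, a h * (wt2 l h ^ (-(1 / 2) : ℝ) * b (k - h))) ^ 2 := by
        simp_rw [mul_assoc]
    _ ≤ _ := sq_tsum_mul_le _ _
    _ = _ := by
        congr 1
        refine tsum_congr fun h => ?_
        rw [mul_pow, ← ENNReal.rpow_natCast, ← ENNReal.rpow_mul]
        norm_num

theorem sq_conv_le_weight_left (a b : ℤ × ℤ → ℝ≥0∞) (k : ℤ × ℤ) :
    (∑' h, a h * wt2 l h ^ (-(1 / 2) : ℝ) * b (k - h)) ^ 2 ≤
      (∑' h, wt2 l h ^ (-1 : ℝ) * a h ^ 2) * ∑' h, b h ^ 2 := by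
  refine (sq_tsum_mul_le _ _).trans ?_
  rw [tsum_sub_left (fun h => b h ^ 2)]
  gcongr with h
  rw [mul_pow, ← ENNReal.rpow_natCast (wt2 l h ^ _), ← ENNReal.rpow_mul, mul_comm]
  norm_num

theorem sq_fiber_conv_le (a : ℤ → ℝ≥0∞) (b : ℤ × ℤ → ℝ≥0∞) (k : ℤ × ℤ) :
    (∑' n, a n * b (k - (0, n))) ^ 2 ≤ (∑' n, a n ^ 2) * ∑' n, b (k.1, n) ^ 2 := by
  refine (sq_tsum_mul_le _ _).trans ?_
  rw [tsum_fiber_sub (fun h => b h ^ 2)]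

theorem sq_majorant_le (a b : Mode → ℝ≥0∞) (i : Mode) :
    majorant l a b i ^ 2 ≤ 4 * (l2Sq a * l2Sq b) := by
  have h_conv : ∀ k, (∑' h, a (.inr h) * wt2 l h ^ (-(1 / 2) : ℝ) * b (.inr (k - h))) ^ 2 ≤
      l2Sq a * l2Sq b := by
    intro k
    refine (sq_conv_le_weight_right l (fun h => a (.inr h)) (fun h => b (.inr h)) k).trans ?_
    gcongr
    · exact le_add_self
    · calc _ ≤ ∑' h, 1 * b (.inr (k - h)) ^ 2 := by
            gcongr with h; exact wt2_rpow_le_one l h zero_lt_one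
        _ = ∑' h, b (.inr h) ^ 2 := by
            simp_rw [one_mul]; exact tsum_sub_left (fun h => b (.inr h) ^ 2) k
        _ ≤ _ := le_add_self
  rcases i with n | k
  · simp only [majorant]
    exact (h_conv (0, n)).trans (le_mul_of_one_le_left' (by norm_num))
  · simp only [majorant]
    have h_fiber : (∑' n, a (.inl n) * b (.inr (k - (0, n)))) ^ 2 ≤ l2Sq a * l2Sq b := by
      refine (sq_fiber_conv_le (fun n => a (.inl n)) (fun h => b (.inr h)) k).trans ?_
      gcongr
      · exact le_self_add
      · exact (tsum_fiber_le (fun h => b (.inr h) ^ 2) k.1).trans le_add_self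
    calc _ ≤ 2 * (l2Sq a * l2Sq b + l2Sq a * l2Sq b) :=
          (add_sq_le_two_mul _ _).trans (by gcongr; exact h_conv k)
      _ = _ := by ring

theorem majorant_lt_top {a b : Mode → ℝ≥0∞} (ha : l2Sq a < ∞) (hb : l2Sq b < ∞) (i : Mode) :
    majorant l a b i < ∞ := by
  have h_sq : majorant l a b i ^ 2 < ∞ := (sq_majorant_le l a b i).trans_lt
    (ENNReal.mul_lt_top (by norm_num) (ENNReal.mul_lt_top ha hb))
  simpa using h_sq

end Majorant

section Bridge

variable {l : ℝ}

theorem summable_of_enorm {ι : Type*} {f : ι → ℂ} (h : ∑' i, ‖f i‖ₑ < ∞) : Summable f := by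
  apply Summable.of_norm
  simpa using ENNReal.summable_toReal h.ne

theorem tsum_enorm_conv_lt_top {a b : ℤ × ℤ → ℂ} (ha : ∑' k, ‖a k‖ₑ ^ 2 < ∞)
    (hb : ∑' k, ‖b k‖ₑ ^ 2 < ∞) (k : ℤ × ℤ) : ∑' h, ‖a h * b (k - h)‖ₑ < ∞ := by
  simp_rw [enorm_mul]
  have h_cauchy_schwarz := sq_tsum_mul_le (fun h => ‖a h‖ₑ) (fun h => ‖b (k - h)‖ₑ)
  rw [tsum_sub_left (fun h => ‖b h‖ₑ ^ 2)] at h_cauchy_schwarz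
  simpa using h_cauchy_schwarz.trans_lt (ENNReal.mul_lt_top ha hb)

theorem summable_ofReal_mul {ι : Type*} {f : ι → ℂ} {c : ι → ℝ} {C : ℝ} (hc : ∀ i, |c i| ≤ C)
    (hf : ∑' i, ‖f i‖ₑ < ∞) : Summable fun i => (c i : ℂ) * f i := by
  apply summable_of_enorm
  calc ∑' i, ‖(c i : ℂ) * f i‖ₑ ≤ ∑' i, ENNReal.ofReal C * ‖f i‖ₑ := by
        gcongr with i
        rw [enorm_mul, ← ofReal_norm (c i : ℂ), Complex.norm_real, Real.norm_eq_abs]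
        gcongr
        exact hc i
    _ < ∞ := by
        rw [ENNReal.tsum_mul_left]
        exact ENNReal.mul_lt_top ENNReal.ofReal_lt_top hf

theorem invLap_eq (ζ : ℤ × ℤ → ℂ) (h : ℤ × ℤ) :
    invLap l ζ h = -(((freqSq l h)⁻¹ : ℝ) : ℂ) * ζ h := by
  unfold invLap
  split_ifs with h_zero
  · simp [h_zero, freqSq_zero]
  · push_cast
    rw [div_eq_mul_inv]; ring

theorem abs_freq_mul_freq_div_le (hl : 0 < l) (h : ℤ × ℤ) {x y c : ℝ} (hx : x ^ 2 ≤ freqSq l h)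
    (hy : y ^ 2 ≤ freqSq l h) : |x * (c - y) * (freqSq l h)⁻¹| ≤ gapConst l * |c| + 1 := by
  have h_gap := one_le_gapConst l
  rcases eq_or_ne h 0 with rfl | h_ne
  · simp only [freqSq_zero, inv_zero, mul_zero, abs_zero]
    positivity
  have h_pos := freqSq_pos hl h_ne
  rw [abs_mul, abs_inv, abs_of_pos h_pos, ← div_eq_mul_inv, div_le_iff₀ h_pos, abs_mul]
  have hx_abs : |x| ≤ gapConst l * freqSq l h := by
    nlinarith [sq_nonneg (|x| - 1), sq_abs x, one_add_freqSq_le hl h_ne]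
  have hxy_abs : |x| * |y| ≤ freqSq l h := by
    nlinarith [sq_nonneg (|x| - |y|), sq_abs x, sq_abs y]
  calc |x| * |c - y| ≤ |x| * (|c| + |y|) := by gcongr; exact abs_sub _ _
    _ = |x| * |c| + |x| * |y| := by ring
    _ ≤ gapConst l * freqSq l h * |c| + freqSq l h := by gcongr
    _ = _ := by ring

theorem nonlinG_eq_bilin (u : ℤ → ℂ) (ζ : ℤ × ℤ → ℂ) (n : ℤ) :
    nonlinG l ζ n = bilin l (Sum.elim u ζ) (Sum.elim u ζ) (.inl n) := by
  simp only [nonlinG, dy1, zonalMean, mul2, bilin, Sum.elim_inr, dx, dy, invLap_eq]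
  rw [neg_mul, ← mul_neg, ← tsum_neg]
  congr 1
  refine tsum_congr fun h => ?_
  simp only [meanKernel, Prod.snd_sub]
  push_cast
  linear_combination (freq l h.1 * freq l (n - h.2) * (freqSq l h : ℂ)⁻¹ *
    (freqSq l ((0, n) - h) : ℂ)⁻¹ * ζ h * ζ ((0, n) - h)) * Complex.I_sq

theorem mul2_dy_invLap_dx_eq (ζ : ℤ × ℤ → ℂ) (k : ℤ × ℤ) :
    mul2 (dy l (invLap l ζ)) (dx l ζ) k =
      ∑' h, ((freq l h.2 * (freq l k.1 - freq l h.1) * (freqSq l h)⁻¹ : ℝ) : ℂ) *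
        (ζ h * ζ (k - h)) := by
  refine tsum_congr fun h => ?_
  simp only [dy, dx, invLap_eq, Prod.fst_sub, freq_sub]
  push_cast
  linear_combination (-freq l h.2 * (freq l k.1 - freq l h.1) * (freqSq l h : ℂ)⁻¹ *
    ζ h * ζ (k - h)) * Complex.I_sq

theorem mul2_dx_invLap_dy_eq (ζ : ℤ × ℤ → ℂ) (k : ℤ × ℤ) :
    mul2 (dx l (invLap l ζ)) (dy l ζ) k =
      ∑' h, ((freq l h.1 * (freq l k.2 - freq l h.2) * (freqSq l h)⁻¹ : ℝ) : ℂ) *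
        (ζ h * ζ (k - h)) := by
  refine tsum_congr fun h => ?_
  simp only [dy, dx, invLap_eq, Prod.snd_sub, freq_sub]
  push_cast
  linear_combination (-freq l h.1 * (freq l k.2 - freq l h.2) * (freqSq l h : ℂ)⁻¹ *
    ζ h * ζ (k - h)) * Complex.I_sq

theorem mul2_sub_mul2_eq_tsum_eddyKernel (hl : 0 < l) {ζ : ℤ × ℤ → ℂ}
    (hζ : ∑' k, ‖ζ k‖ₑ ^ 2 < ∞) (k : ℤ × ℤ) :
    mul2 (dy l (invLap l ζ)) (dx l ζ) k - mul2 (dx l (invLap l ζ)) (dy l ζ) k =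
      ∑' h, (eddyKernel l k h : ℂ) * (ζ h * ζ (k - h)) := by
  have h_conv := tsum_enorm_conv_lt_top hζ hζ k
  have h_summable_dx := summable_ofReal_mul (fun h : ℤ × ℤ => abs_freq_mul_freq_div_le hl h
    (c := freq l k.1) (sq_freq_snd_le h) (sq_freq_fst_le h)) h_conv
  have h_summable_dy := summable_ofReal_mul (fun h : ℤ × ℤ => abs_freq_mul_freq_div_le hl h
    (c := freq l k.2) (sq_freq_fst_le h) (sq_freq_snd_le h)) h_conv
  rw [mul2_dy_invLap_dx_eq, mul2_dx_invLap_dy_eq, ← h_summable_dx.tsum_sub h_summable_dy]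
  refine tsum_congr fun h => ?_
  rw [← sub_mul, ← Complex.ofReal_sub, eddyKernel]
  congr 2
  ring

theorem mul2_lift_dx_eq (u : ℤ → ℂ) (ζ : ℤ × ℤ → ℂ) (k : ℤ × ℤ) :
    mul2 (lift u) (dx l ζ) k = Complex.I * freq l k.1 * ∑' n, u n * ζ (k - (0, n)) := by
  rw [mul2, ← tsum_mul_left, ← (Prod.mk_right_injective (0 : ℤ)).tsum_eq]
  · refine tsum_congr fun n => ?_
    simp only [lift, dx, Prod.fst_sub, sub_zero, if_true]
    ring
  · intro h hh
    refine ⟨h.2, Prod.ext ?_ rfl⟩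
    by_contra h_ne
    exact hh (by simp only [lift, if_neg (Ne.symm h_ne), zero_mul])

theorem dy1_zonalMean_eq (ζ : ℤ × ℤ → ℂ) (n : ℤ) :
    dy1 l (zonalMean (mul2 (dx l (invLap l ζ)) ζ)) n =
      -∑' h, (eddyKernel l (0, n) h : ℂ) * (ζ h * ζ ((0, n) - h)) := by
  simp only [dy1, zonalMean, mul2]
  rw [← tsum_mul_left, ← tsum_neg]
  refine tsum_congr fun h => ?_
  simp only [dx, invLap_eq, eddyKernel, freq_zero]
  push_cast
  linear_combination (-(freq l n * freq l h.1 * (freqSq l h : ℂ)⁻¹ *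
    ζ h * ζ ((0, n) - h))) * Complex.I_sq

theorem nonlinF_eq_bilin (hl : 0 < l) {u : ℤ → ℂ} {ζ : ℤ × ℤ → ℂ} (hζ : ∑' k, ‖ζ k‖ₑ ^ 2 < ∞)
    (k : ℤ × ℤ) :
    nonlinF l u ζ k = bilin l (Sum.elim u ζ) (Sum.elim u ζ) (.inr k) := by
  simp only [nonlinF, Pi.add_apply, Pi.sub_apply, mul2_sub_mul2_eq_tsum_eddyKernel hl hζ,
    mul2_lift_dx_eq, bilin, Sum.elim_inl, Sum.elim_inr]
  by_cases hk : k.1 = 0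
  · obtain ⟨m, n⟩ := k
    obtain rfl : m = 0 := hk
    simp only [lift, dy1_zonalMean_eq, freq_zero, Complex.ofReal_zero, mul_zero, zero_mul,
      sub_zero, if_true, add_neg_cancel]
  · simp [lift, hk]

end Bridge

/-! ### Continuity and measurability of the bilinear operator -/

section Bilinear

variable {l : ℝ}

theorem l2Sq_mono {a b : Mode → ℝ≥0∞} (h : ∀ i, a i ≤ b i) : l2Sq a ≤ l2Sq b := by
  unfold l2Sq
  gcongr <;> exact h _

theorem tsum_eddyKernel_lt_top (hl : 0 < l) {a b : Mode → ℝ≥0∞} (ha : l2Sq a < ∞) (hb : l2Sq b < ∞)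
    (k : ℤ × ℤ) : ∑' h, ‖(eddyKernel l k h : ℂ)‖ₑ * (a (.inr h) * b (.inr (k - h))) < ∞ := by
  have h_le : ∑' h, ‖(eddyKernel l k h : ℂ)‖ₑ * (a (.inr h) * b (.inr (k - h))) ≤
      (bilinConst l * wt2 l k ^ (1 / 2 : ℝ)) * majorant l a b (.inr k) := by
    simp only [majorant]
    rw [mul_add, ← ENNReal.tsum_mul_left]
    refine le_trans (ENNReal.tsum_le_tsum fun h => ?_) le_self_add
    calc _ ≤ (bilinConst l * wt2 l k ^ (1 / 2 : ℝ) * wt2 l h ^ (-(1 / 2) : ℝ)) *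
          (a (.inr h) * b (.inr (k - h))) := by gcongr; exact enorm_eddyKernel_le hl k h
      _ = _ := by ring
  refine h_le.trans_lt (ENNReal.mul_lt_top (ENNReal.mul_lt_top (bilinConst_ne_top l).lt_top ?_)
    (majorant_lt_top l ha hb _))
  exact ENNReal.rpow_lt_top_of_nonneg (by norm_num) (wt2_ne_top l k)

theorem tsum_meanKernel_lt_top (hl : 0 < l) {a b : Mode → ℝ≥0∞} (ha : l2Sq a < ∞) (hb : l2Sq b < ∞)
    (n : ℤ) : ∑' h, ‖(meanKernel l n h : ℂ)‖ₑ * (a (.inr h) * b (.inr ((0, n) - h))) < ∞ := by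
  have h_le : ∑' h, ‖(meanKernel l n h : ℂ)‖ₑ * (a (.inr h) * b (.inr ((0, n) - h))) ≤
      bilinConst l * majorant l a b (.inl n) := by
    simp only [majorant]
    rw [← ENNReal.tsum_mul_left]
    refine ENNReal.tsum_le_tsum fun h => ?_
    calc _ ≤ (bilinConst l * wt2 l h ^ (-(1 / 2) : ℝ)) *
          (a (.inr h) * b (.inr ((0, n) - h))) := by gcongr; exact enorm_meanKernel_le hl n h
      _ = _ := by ring
  exact h_le.trans_lt
    (ENNReal.mul_lt_top (bilinConst_ne_top l).lt_top (majorant_lt_top l ha hb _))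

theorem tsum_fiber_lt_top {a b : Mode → ℝ≥0∞} (ha : l2Sq a < ∞) (hb : l2Sq b < ∞)
    (k : ℤ × ℤ) : ∑' n, a (.inl n) * b (.inr (k - (0, n))) < ∞ :=
  lt_of_le_of_lt le_add_self (majorant_lt_top (l := 0) ha hb (.inr k))

theorem summable_eddyKernel (hl : 0 < l) {z w : Mode → ℂ} (hz : l2Sq (fun i => ‖z i‖ₑ) < ∞)
    (hw : l2Sq (fun i => ‖w i‖ₑ) < ∞) (k : ℤ × ℤ) :
    Summable fun h => (eddyKernel l k h : ℂ) * (z (.inr h) * w (.inr (k - h))) := by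
  apply summable_of_enorm
  simp_rw [enorm_mul]
  exact tsum_eddyKernel_lt_top hl hz hw k

theorem summable_meanKernel (hl : 0 < l) {z w : Mode → ℂ} (hz : l2Sq (fun i => ‖z i‖ₑ) < ∞)
    (hw : l2Sq (fun i => ‖w i‖ₑ) < ∞) (n : ℤ) :
    Summable fun h => (meanKernel l n h : ℂ) * (z (.inr h) * w (.inr ((0, n) - h))) := by
  apply summable_of_enorm
  simp_rw [enorm_mul]
  exact tsum_meanKernel_lt_top hl hz hw n

theorem summable_fiber {z w : Mode → ℂ} (hz : l2Sq (fun i => ‖z i‖ₑ) < ∞)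
    (hw : l2Sq (fun i => ‖w i‖ₑ) < ∞) (k : ℤ × ℤ) :
    Summable fun n => z (.inl n) * w (.inr (k - (0, n))) := by
  apply summable_of_enorm
  simp_rw [enorm_mul]
  exact tsum_fiber_lt_top hz hw k

theorem bilin_sub_left (hl : 0 < l) {z z' w : Mode → ℂ} (hz : l2Sq (fun i => ‖z i‖ₑ) < ∞)
    (hz' : l2Sq (fun i => ‖z' i‖ₑ) < ∞) (hw : l2Sq (fun i => ‖w i‖ₑ) < ∞) (i : Mode) :
    bilin l (z - z') w i = bilin l z w i - bilin l z' w i := by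
  rcases i with n | k <;> simp only [bilin, Pi.sub_apply, sub_mul, mul_sub]
  · rw [(summable_meanKernel hl hz hw n).tsum_sub (summable_meanKernel hl hz' hw n)]
    ring
  · split_ifs
    · simp
    · rw [(summable_eddyKernel hl hz hw k).tsum_sub (summable_eddyKernel hl hz' hw k),
        (summable_fiber hz hw k).tsum_sub (summable_fiber hz' hw k)]
      ring

theorem bilin_sub_right (hl : 0 < l) {z w w' : Mode → ℂ} (hz : l2Sq (fun i => ‖z i‖ₑ) < ∞)
    (hw : l2Sq (fun i => ‖w i‖ₑ) < ∞) (hw' : l2Sq (fun i => ‖w' i‖ₑ) < ∞) (i : Mode) :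
    bilin l z (w - w') i = bilin l z w i - bilin l z w' i := by
  rcases i with n | k <;> simp only [bilin, Pi.sub_apply, mul_sub]
  · rw [(summable_meanKernel hl hz hw n).tsum_sub (summable_meanKernel hl hz hw' n)]
    ring
  · split_ifs
    · simp
    · rw [(summable_eddyKernel hl hz hw k).tsum_sub (summable_eddyKernel hl hz hw' k),
        (summable_fiber hz hw k).tsum_sub (summable_fiber hz hw' k)]
      ring

theorem tendsto_tsum_of_enorm_le {α β : Type*} {F : Filter α} {f : α → β → ℂ} {g : β → ℂ}
    {b : β → ℝ≥0∞} (hb : ∑' k, b k < ∞) (hf : ∀ k, Tendsto (f · k) F (𝓝 (g k)))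
    (hfb : ∀ a k, ‖f a k‖ₑ ≤ b k) : Tendsto (fun a => ∑' k, f a k) F (𝓝 (∑' k, g k)) := by
  refine tendsto_tsum_of_dominated_convergence (bound := fun k => (b k).toReal)
    (ENNReal.summable_toReal hb.ne) hf (Eventually.of_forall fun a k => ?_)
  simpa only [toReal_enorm] using
    ENNReal.toReal_mono (ENNReal.ne_top_of_tsum_ne_top hb.ne k) (hfb a k)

theorem tendsto_bilin (hl : 0 < l) {α : Type*} {F : Filter α} {z : α → Mode → ℂ} {w : Mode → ℂ}
    {Z : Mode → ℝ≥0∞} (hZ : l2Sq Z < ∞) (hz : ∀ i, Tendsto (z · i) F (𝓝 (w i)))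
    (hzZ : ∀ a i, ‖z a i‖ₑ ≤ Z i) (i : Mode) :
    Tendsto (fun a => bilin l (z a) (z a) i) F (𝓝 (bilin l w w i)) := by
  rcases i with n | k <;> simp only [bilin]
  · refine tendsto_const_nhds.mul (tendsto_tsum_of_enorm_le (tsum_meanKernel_lt_top hl hZ hZ n)
      (fun h => tendsto_const_nhds.mul ((hz _).mul (hz _))) fun a h => ?_)
    rw [enorm_mul, enorm_mul]
    gcongr <;> exact hzZ _ _
  · split_ifs
    · exact tendsto_const_nhds
    refine (tendsto_tsum_of_enorm_le (tsum_eddyKernel_lt_top hl hZ hZ k)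
      (fun h => tendsto_const_nhds.mul ((hz _).mul (hz _))) fun a h => ?_).sub
      (tendsto_const_nhds.mul (tendsto_tsum_of_enorm_le (tsum_fiber_lt_top hZ hZ k)
      (fun h => (hz _).mul (hz _)) fun a h => ?_))
    · rw [enorm_mul, enorm_mul]
      gcongr <;> exact hzZ _ _
    · rw [enorm_mul]
      gcongr <;> exact hzZ _ _

theorem continuous_bilin (hl : 0 < l) {z : ℝ → Mode → ℂ} {Z : Mode → ℝ≥0∞} (hZ : l2Sq Z < ∞)
    (hz : ∀ i, Continuous fun t => z t i) (hzZ : ∀ t i, ‖z t i‖ₑ ≤ Z i) (i : Mode) :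
    Continuous fun t => bilin l (z t) (z t) i :=
  continuous_iff_continuousAt.2 fun t =>
    tendsto_bilin hl hZ (fun j => (hz j).tendsto t) (fun s j => hzZ s j) i

theorem aestronglyMeasurable_tsum {α β : Type*} [MeasurableSpace α] {μ : Measure α} [Countable β]
    {f : β → α → ℂ} (hf : ∀ i, AEStronglyMeasurable (f i) μ)
    (hs : ∀ᵐ x ∂μ, Summable fun i => f i x) :
    AEStronglyMeasurable (fun x => ∑' i, f i x) μ := by
  refine aestronglyMeasurable_of_tendsto_ae (atTop : Filter (Finset β))
    (f := fun s x => ∑ i ∈ s, f i x) (fun s => ?_) ?_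
  · exact Finset.aestronglyMeasurable_fun_sum s fun i _ => hf i
  · filter_upwards [hs] with x hx using hx.hasSum

theorem aestronglyMeasurable_bilin (hl : 0 < l) {μ : Measure ℝ} {z : ℝ → Mode → ℂ}
    (hz : ∀ i, AEStronglyMeasurable (fun t => z t i) μ)
    (hb : ∀ᵐ t ∂μ, l2Sq (fun i => ‖z t i‖ₑ) < ∞) (i : Mode) :
    AEStronglyMeasurable (fun t => bilin l (z t) (z t) i) μ := by
  rcases i with n | k <;> simp only [bilin]
  · refine AEStronglyMeasurable.const_mul (aestronglyMeasurable_tsum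
      (fun h => ((hz _).mul (hz _)).const_mul _) ?_) _
    filter_upwards [hb] with t ht using summable_meanKernel hl ht ht n
  · split_ifs
    · exact aestronglyMeasurable_const
    refine AEStronglyMeasurable.sub (aestronglyMeasurable_tsum
      (fun h => ((hz _).mul (hz _)).const_mul _) ?_) (AEStronglyMeasurable.const_mul
      (aestronglyMeasurable_tsum (fun h => (hz _).mul (hz _)) ?_) _)
    · filter_upwards [hb] with t ht using summable_eddyKernel hl ht ht k
    · filter_upwards [hb] with t ht using summable_fiber ht ht k

end Bilinear

/-! ### The linear part and the Duhamel formula -/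

section Duhamel

/-- `|κ|²` of a mode. -/
def modeSq (l : ℝ) : Mode → ℝ := Sum.elim (fun n => freq l n ^ 2) (freqSq l)

/-- The symbol of the linear part. -/
def symbol (l ν C₁ : ℝ) : Mode → ℂ :=
  Sum.elim (fun n => ((-ν * freq l n ^ 2 : ℝ) : ℂ)) (symbol2 l ν C₁)

/-- The coefficients of a pair of functions. -/
def coeffs {l : ℝ} [Fact (0 < l)] (u : L2y l) (ζ : L2xy l) : Mode → ℂ :=
  Sum.elim (hat1 u) (hat2 ζ)

/-- The Duhamel formula for the coefficients. -/
def DuhamelModeAt (l ν C₁ : ℝ) (z₀ : Mode → ℂ) (z : ℝ → Mode → ℂ) (t : ℝ) : Prop :=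
  ∀ i, z t i = Complex.exp (t * symbol l ν C₁ i) * z₀ i +
    ∫ τ in (0 : ℝ)..t, Complex.exp ((t - τ : ℝ) * symbol l ν C₁ i) * bilin l (z τ) (z τ) i

variable {l : ℝ}

theorem modeSq_nonneg (i : Mode) : 0 ≤ modeSq l i := by
  rcases i with n | k
  · simp only [modeSq, Sum.elim_inl]; positivity
  · exact freqSq_nonneg l k

theorem wt_eq_ofReal (i : Mode) : wt l i = ENNReal.ofReal (1 + modeSq l i) := by
  rcases i with n | k <;> rfl

theorem one_le_wt (i : Mode) : 1 ≤ wt l i := by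
  rcases i with n | k
  · exact one_le_wt1 l n
  · exact one_le_wt2 l k

theorem wt_ne_zero (i : Mode) : wt l i ≠ 0 := (zero_lt_one.trans_le (one_le_wt i)).ne'

theorem wt_ne_top (i : Mode) : wt l i ≠ ∞ := by
  rw [wt_eq_ofReal]; exact ENNReal.ofReal_ne_top

theorem re_symbol (ν C₁ : ℝ) (i : Mode) : (symbol l ν C₁ i).re = -(ν * modeSq l i) := by
  rcases i with n | k
  · simp only [symbol, modeSq, Sum.elim_inl, Complex.ofReal_re]; ring
  · simp only [symbol, modeSq, Sum.elim_inr, symbol2, dx, invLap_eq]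
    simp

theorem duhamelAt_iff [Fact (0 < l)] {ν C₁ : ℝ} {u₀ : L2y l} {ζ₀ : L2xy l} {u : ℝ → L2y l}
    {ζ : ℝ → L2xy l} {t : ℝ} :
    DuhamelAt ν C₁ u₀ ζ₀ u ζ t ↔
      DuhamelModeAt l ν C₁ (coeffs u₀ ζ₀) (fun τ => coeffs (u τ) (ζ τ)) t := by
  have hl : 0 < l := Fact.out
  unfold DuhamelAt DuhamelModeAt
  rw [Sum.forall]
  have h_nonlinG : ∀ τ, nonlinG l (hat2 (ζ τ)) =
      fun n => bilin l (coeffs (u τ) (ζ τ)) (coeffs (u τ) (ζ τ)) (.inl n) :=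
    fun τ => funext (nonlinG_eq_bilin (hat1 (u τ)) _)
  simp only [h_nonlinG, coeffs, symbol, Sum.elim_inl, Sum.elim_inr, semigroup1, semigroup2,
    nonlinF_eq_bilin hl (tsum_enorm_sq_hat2_lt_top _), Complex.ofReal_mul]

theorem norm_exp_mul_symbol (ν C₁ t : ℝ) (i : Mode) :
    ‖Complex.exp (t * symbol l ν C₁ i)‖ = Real.exp (-(t * (ν * modeSq l i))) := by
  rw [Complex.norm_exp, Complex.re_ofReal_mul, re_symbol]
  congr 1; ring

theorem norm_duhamel_le {r μ b t : ℝ} {g E : ℝ → ℂ} (ht : 0 ≤ t) (hμ : 0 < μ + r) (hb : 0 ≤ b)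
    (hE : ∀ τ, ‖E τ‖ = Real.exp (-((t - τ) * r)))
    (hg : ∀ᵐ τ, τ ∈ Ioc 0 t → ‖g τ‖ ≤ b * Real.exp (μ * τ)) :
    ‖∫ τ in (0 : ℝ)..t, E τ * g τ‖ ≤ b * Real.exp (μ * t) / (μ + r) := by
  have h_norm : ‖∫ τ in (0 : ℝ)..t, E τ * g τ‖ ≤
      ∫ τ in (0 : ℝ)..t, b * Real.exp (-t * r) * Real.exp ((μ + r) * τ) := by
    apply intervalIntegral.norm_integral_le_of_norm_le ht
    · filter_upwards [hg] with τ hτ hmem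
      rw [norm_mul, hE]
      calc _ ≤ Real.exp (-((t - τ) * r)) * (b * Real.exp (μ * τ)) := by gcongr; exact hτ hmem
        _ = b * (Real.exp (-((t - τ) * r)) * Real.exp (μ * τ)) := by ring
        _ = b * (Real.exp (-t * r) * Real.exp ((μ + r) * τ)) := by
            rw [← Real.exp_add, ← Real.exp_add]; congr 2; ring
        _ = _ := by ring
    · apply Continuous.intervalIntegrable
      fun_prop
  refine h_norm.trans ?_
  rw [intervalIntegral.integral_const_mul, intervalIntegral.integral_comp_mul_left _ hμ.ne',
    integral_exp]
  simp only [mul_zero, Real.exp_zero, smul_eq_mul]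
  calc b * Real.exp (-t * r) * ((μ + r)⁻¹ * (Real.exp ((μ + r) * t) - 1))
      ≤ b * Real.exp (-t * r) * ((μ + r)⁻¹ * Real.exp ((μ + r) * t)) := by
        gcongr; linarith
    _ = b * (Real.exp (-t * r) * Real.exp ((μ + r) * t)) / (μ + r) := by ring
    _ = _ := by rw [← Real.exp_add]; congr 3; ring

end Duhamel

/-! ### Uniqueness -/

section DecayEstimate

variable {l : ℝ}

theorem sq_rpow (x : ℝ≥0∞) (a : ℝ) : (x ^ a) ^ 2 = x ^ (a * 2) :=
  (ENNReal.rpow_mul_natCast x a 2).symm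

theorem le_rpow_half_of_sq_le {x y : ℝ≥0∞} (h : x ^ 2 ≤ y) : x ≤ y ^ (1 / 2 : ℝ) := by
  rw [one_div, ENNReal.le_rpow_inv_iff two_pos]
  exact_mod_cast h

theorem norm_le_of_enorm_le_wt {x : ℂ} {c : ℝ≥0∞} (hc : c ≠ ∞) {i : Mode} {p : ℝ}
    (h : ‖x‖ₑ ≤ c * wt l i ^ p) : ‖x‖ ≤ c.toReal * (1 + modeSq l i) ^ p := by
  have h_pos : 0 < 1 + modeSq l i := by linarith [modeSq_nonneg (l := l) i]
  rw [wt_eq_ofReal, ENNReal.ofReal_rpow_of_pos h_pos] at h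
  have h_toReal := ENNReal.toReal_mono (ENNReal.mul_ne_top hc ENNReal.ofReal_ne_top) h
  rwa [ENNReal.toReal_mul, ENNReal.toReal_ofReal (by positivity), toReal_enorm] at h_toReal

theorem enorm_le_wt_of_norm_le {x : ℂ} {c : ℝ} (hc : 0 ≤ c) {i : Mode} {p : ℝ}
    (h : ‖x‖ ≤ c * (1 + modeSq l i) ^ p) : ‖x‖ₑ ≤ ENNReal.ofReal c * wt l i ^ p := by
  have h_pos : 0 < 1 + modeSq l i := by linarith [modeSq_nonneg (l := l) i]
  rw [wt_eq_ofReal, ENNReal.ofReal_rpow_of_pos h_pos, ← ENNReal.ofReal_mul hc, ← ofReal_norm]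
  exact ENNReal.ofReal_le_ofReal h

theorem majorant_const_mul_left (c : ℝ≥0∞) (a b : Mode → ℝ≥0∞) (i : Mode) :
    majorant l (fun j => c * a j) b i = c * majorant l a b i := by
  rcases i with n | k <;> simp only [majorant, mul_assoc, ENNReal.tsum_mul_left, mul_add]

theorem majorant_const_mul_right (c : ℝ≥0∞) (a b : Mode → ℝ≥0∞) (i : Mode) :
    majorant l a (fun j => c * b j) i = c * majorant l a b i := by
  rcases i with n | k <;>
    simp only [majorant, mul_left_comm _ c, ENNReal.tsum_mul_left, mul_add]

theorem sq_conv_decay_left_le (b : ℤ × ℤ → ℝ≥0∞) (k : ℤ × ℤ) :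
    (∑' h, wt2 l h ^ (-(3 / 8) : ℝ) * wt2 l h ^ (-(1 / 2) : ℝ) * b (k - h)) ^ 2 ≤
      2 * latticeSum2 l (7 / 4) * ∑' h, b h ^ 2 := by
  refine (sq_conv_le_weight_left l (fun h => wt2 l h ^ (-(3 / 8) : ℝ)) b k).trans ?_
  gcongr
  calc ∑' h, wt2 l h ^ (-1 : ℝ) * (wt2 l h ^ (-(3 / 8) : ℝ)) ^ 2
      = latticeSum2 l (7 / 4) := tsum_congr fun h => by
        rw [sq_rpow, ← wt2_rpow_add]; norm_num
    _ ≤ _ := le_mul_of_one_le_left' one_le_two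

theorem sq_conv_decay_right_le (a : ℤ × ℤ → ℝ≥0∞) (k : ℤ × ℤ) :
    (∑' h, a h * wt2 l h ^ (-(1 / 2) : ℝ) * wt2 l (k - h) ^ (-(3 / 8) : ℝ)) ^ 2 ≤
      2 * latticeSum2 l (7 / 4) * ∑' h, a h ^ 2 := by
  refine (sq_conv_le_weight_right l a (fun h => wt2 l h ^ (-(3 / 8) : ℝ)) k).trans ?_
  rw [mul_comm]
  gcongr
  simp_rw [sq_rpow]
  refine le_of_eq_of_le ?_ ((tsum_wt2_mul_wt2_sub_le l k (a := 1) (b := 3 / 4) zero_le_one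
    (by norm_num)).trans_eq ?_) <;> norm_num

theorem sq_fiber_decay_left_le (b : ℤ × ℤ → ℝ≥0∞) (k : ℤ × ℤ) :
    (∑' n, wt1 l n ^ (-(3 / 8) : ℝ) * b (k - (0, n))) ^ 2 ≤
      latticeSum1 l (3 / 4) * ∑' h, b h ^ 2 := by
  refine (sq_fiber_conv_le (fun n => wt1 l n ^ (-(3 / 8) : ℝ)) b k).trans ?_
  gcongr
  · refine (tsum_congr fun n => ?_).le
    rw [sq_rpow]; norm_num
  · exact tsum_fiber_le (fun h => b h ^ 2) k.1

theorem sq_fiber_decay_right_le (a : ℤ → ℝ≥0∞) (k : ℤ × ℤ) :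
    (∑' n, a n * wt2 l (k - (0, n)) ^ (-(3 / 8) : ℝ)) ^ 2 ≤
      latticeSum1 l (3 / 4) * ∑' n, a n ^ 2 := by
  refine (sq_fiber_conv_le a (fun h => wt2 l h ^ (-(3 / 8) : ℝ)) k).trans ?_
  rw [mul_comm]
  refine mul_le_mul_left (ENNReal.tsum_le_tsum fun n => ?_) _
  calc (wt2 l (k.1, n) ^ (-(3 / 8) : ℝ)) ^ 2 = wt2 l (k.1, n) ^ (-(3 / 4) : ℝ) := by
        rw [sq_rpow]; norm_num
    _ ≤ wt1 l n ^ (-(3 / 4) : ℝ) := rpow_neg_le_rpow_neg (by norm_num) (wt1_snd_le l (k.1, n))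

/-- The constant in the bounds of the majorant on decaying sequences. -/
def decayConst (l : ℝ) : ℝ≥0∞ := 2 * (2 * latticeSum2 l (7 / 4) + latticeSum1 l (3 / 4))

theorem decayConst_lt_top (hl : 0 < l) : decayConst l < ∞ :=
  ENNReal.mul_lt_top (by norm_num) (ENNReal.add_lt_top.2
    ⟨ENNReal.mul_lt_top (by norm_num) (latticeSum2_lt_top hl (by norm_num)),
      latticeSum1_lt_top hl (by norm_num)⟩)

theorem two_mul_latticeSum2_le_decayConst (l : ℝ) :
    2 * latticeSum2 l (7 / 4) ≤ decayConst l :=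
  le_self_add.trans (le_mul_of_one_le_left' one_le_two)

theorem sq_add_le_decayConst_mul {x y s : ℝ≥0∞} (hx : x ^ 2 ≤ 2 * latticeSum2 l (7 / 4) * s)
    (hy : y ^ 2 ≤ latticeSum1 l (3 / 4) * s) : (x + y) ^ 2 ≤ decayConst l * s :=
  calc (x + y) ^ 2
      ≤ 2 * (2 * latticeSum2 l (7 / 4) * s + latticeSum1 l (3 / 4) * s) :=
        (add_sq_le_two_mul x y).trans (by gcongr)
    _ = decayConst l * s := by rw [decayConst]; ring

theorem sq_majorant_decay_left_le (b : Mode → ℝ≥0∞) (i : Mode) :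
    majorant l (fun j => wt l j ^ (-(3 / 8) : ℝ)) b i ^ 2 ≤ decayConst l * l2Sq b := by
  rcases i with n | k
  · exact (sq_conv_decay_left_le (fun h => b (.inr h)) (0, n)).trans
      (mul_le_mul' (two_mul_latticeSum2_le_decayConst l) le_add_self)
  · exact sq_add_le_decayConst_mul
      ((sq_conv_decay_left_le (fun h => b (.inr h)) k).trans (mul_le_mul_right le_add_self _))
      ((sq_fiber_decay_left_le (fun h => b (.inr h)) k).trans (mul_le_mul_right le_add_self _))

theorem sq_majorant_decay_right_le (a : Mode → ℝ≥0∞) (i : Mode) :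
    majorant l a (fun j => wt l j ^ (-(3 / 8) : ℝ)) i ^ 2 ≤ decayConst l * l2Sq a := by
  rcases i with n | k
  · exact (sq_conv_decay_right_le (fun h => a (.inr h)) (0, n)).trans
      (mul_le_mul' (two_mul_latticeSum2_le_decayConst l) le_add_self)
  · exact sq_add_le_decayConst_mul
      ((sq_conv_decay_right_le (fun h => a (.inr h)) k).trans (mul_le_mul_right le_add_self _))
      ((sq_fiber_decay_right_le (fun n => a (.inl n)) k).trans (mul_le_mul_right le_self_add _))

end DecayEstimate

section Lipschitz

variable {l : ℝ}

/-- The constant in the bound of the nonlinearity on the `ℓ²` ball of squared radius `M`. -/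
def l2BilinConst (l : ℝ) (M : ℝ≥0∞) : ℝ≥0∞ := bilinConst l * (4 * (M * M)) ^ (1 / 2 : ℝ)

/-- The Lipschitz constant of the nonlinearity on the `ℓ²` ball of squared radius `M`, for the norm
`sup (1 + |κ|²)^(3/8) |z|`. -/
def lipschitzConst (l : ℝ) (M : ℝ≥0∞) : ℝ≥0∞ :=
  2 * bilinConst l * (decayConst l * M) ^ (1 / 2 : ℝ)

theorem l2BilinConst_ne_top (l : ℝ) {M : ℝ≥0∞} (hM : M ≠ ∞) : l2BilinConst l M ≠ ∞ :=
  ENNReal.mul_ne_top (bilinConst_ne_top l) (ENNReal.rpow_ne_top_of_nonneg (by norm_num)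
    (ENNReal.mul_ne_top (by norm_num) (ENNReal.mul_ne_top hM hM)))

theorem lipschitzConst_ne_top (hl : 0 < l) {M : ℝ≥0∞} (hM : M ≠ ∞) : lipschitzConst l M ≠ ∞ :=
  ENNReal.mul_ne_top (ENNReal.mul_ne_top (by norm_num) (bilinConst_ne_top l))
    (ENNReal.rpow_ne_top_of_nonneg (by norm_num)
      (ENNReal.mul_ne_top (decayConst_lt_top hl).ne hM))

theorem enorm_bilin_le_l2Sq (hl : 0 < l) (z w : Mode → ℂ) (i : Mode) :
    ‖bilin l z w i‖ₑ ≤ bilinConst l *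
      (4 * (l2Sq (fun j => ‖z j‖ₑ) * l2Sq (fun j => ‖w j‖ₑ))) ^ (1 / 2 : ℝ) *
      wt l i ^ (1 / 2 : ℝ) := by
  refine (enorm_bilin_le hl z w i).trans ?_
  rw [mul_right_comm]
  gcongr
  exact le_rpow_half_of_sq_le (sq_majorant_le l _ _ i)

theorem norm_bilin_le (hl : 0 < l) {M : ℝ≥0∞} (hM : M ≠ ∞) {z : Mode → ℂ}
    (hz : l2Sq (fun i => ‖z i‖ₑ) ≤ M) (i : Mode) :
    ‖bilin l z z i‖ ≤ (l2BilinConst l M).toReal * (1 + modeSq l i) ^ (1 / 2 : ℝ) :=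
  norm_le_of_enorm_le_wt (l2BilinConst_ne_top l hM)
    ((enorm_bilin_le_l2Sq hl z z i).trans (by unfold l2BilinConst; gcongr))

theorem majorant_le_of_le_decay_left {a b : Mode → ℝ≥0∞} {M c : ℝ≥0∞}
    (ha : ∀ i, a i ≤ c * wt l i ^ (-(3 / 8) : ℝ)) (hb : l2Sq b ≤ M) (i : Mode) :
    majorant l a b i ≤ c * (decayConst l * M) ^ (1 / 2 : ℝ) := by
  refine (majorant_mono l ha (fun _ => le_rfl) i).trans ?_
  rw [majorant_const_mul_left]
  gcongr
  exact le_rpow_half_of_sq_le ((sq_majorant_decay_left_le _ i).trans (by gcongr))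

theorem majorant_le_of_le_decay_right {a b : Mode → ℝ≥0∞} {M c : ℝ≥0∞} (ha : l2Sq a ≤ M)
    (hb : ∀ i, b i ≤ c * wt l i ^ (-(3 / 8) : ℝ)) (i : Mode) :
    majorant l a b i ≤ c * (decayConst l * M) ^ (1 / 2 : ℝ) := by
  refine (majorant_mono l (fun _ => le_rfl) hb i).trans ?_
  rw [majorant_const_mul_right]
  gcongr
  exact le_rpow_half_of_sq_le ((sq_majorant_decay_right_le _ i).trans (by gcongr))

theorem enorm_bilin_sub_bilin_le (hl : 0 < l) {z w : Mode → ℂ} {M c : ℝ≥0∞} (hM : M < ∞)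
    (hz : l2Sq (fun i => ‖z i‖ₑ) ≤ M) (hw : l2Sq (fun i => ‖w i‖ₑ) ≤ M)
    (hzw : ∀ i, ‖z i - w i‖ₑ ≤ c * wt l i ^ (-(3 / 8) : ℝ)) (i : Mode) :
    ‖bilin l z z i - bilin l w w i‖ₑ ≤ c * lipschitzConst l M * wt l i ^ (1 / 2 : ℝ) := by
  have hz_top := hz.trans_lt hM
  have hw_top := hw.trans_lt hM
  have h_split : bilin l z z i - bilin l w w i = bilin l (z - w) z i + bilin l w (z - w) i := by
    rw [bilin_sub_left hl hz_top hw_top hz_top, bilin_sub_right hl hw_top hz_top hw_top]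
    ring
  have h_left := majorant_le_of_le_decay_left hzw hz i
  have h_right := majorant_le_of_le_decay_right hw hzw i
  rw [h_split]
  calc ‖bilin l (z - w) z i + bilin l w (z - w) i‖ₑ
      ≤ bilinConst l * wt l i ^ (1 / 2 : ℝ) * (c * (decayConst l * M) ^ (1 / 2 : ℝ)) +
        bilinConst l * wt l i ^ (1 / 2 : ℝ) * (c * (decayConst l * M) ^ (1 / 2 : ℝ)) :=
        (enorm_add_le _ _).trans (add_le_add
          ((enorm_bilin_le hl _ _ i).trans (mul_le_mul_right h_left _))
          ((enorm_bilin_le hl _ _ i).trans (mul_le_mul_right h_right _)))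
    _ = _ := by rw [lipschitzConst]; ring

theorem norm_bilin_sub_bilin_le (hl : 0 < l) {z w : Mode → ℂ} {M : ℝ≥0∞} (hM : M < ∞) {c : ℝ}
    (hc : 0 ≤ c) (hz : l2Sq (fun i => ‖z i‖ₑ) ≤ M) (hw : l2Sq (fun i => ‖w i‖ₑ) ≤ M)
    (hzw : ∀ i, ‖z i - w i‖ ≤ c * (1 + modeSq l i) ^ (-(3 / 8) : ℝ)) (i : Mode) :
    ‖bilin l z z i - bilin l w w i‖ ≤
      c * (lipschitzConst l M).toReal * (1 + modeSq l i) ^ (1 / 2 : ℝ) := by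
  have h_norm := norm_le_of_enorm_le_wt
    (ENNReal.mul_ne_top ENNReal.ofReal_ne_top (lipschitzConst_ne_top hl hM.ne))
    (enorm_bilin_sub_bilin_le hl hM hz hw (fun j => enorm_le_wt_of_norm_le hc (hzw j)) i)
  rwa [ENNReal.toReal_mul, ENNReal.toReal_ofReal hc] at h_norm

end Lipschitz

theorem exists_mul_one_add_rpow_le {ν D p : ℝ} (hν : 0 < ν) (hD : 0 < D) (hp : 0 ≤ p)
    (hp' : p < 1) : ∃ μ : ℝ, 0 < μ ∧ ∀ x : ℝ, 0 ≤ x → D * (1 + x) ^ p ≤ μ + ν * x := by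
  have h_one_sub : 0 < 1 - p := sub_pos.2 hp'
  let A : ℝ := (D / ν) ^ (1 - p)⁻¹
  have : 0 < A := by positivity
  have h_const : 0 < D * A ^ p := by positivity
  refine ⟨D * A ^ p + ν, by positivity, fun x hx => ?_⟩
  rcases le_total (1 + x) A with h | h
  · have h_small : D * (1 + x) ^ p ≤ D * A ^ p := by gcongr
    nlinarith [mul_nonneg hν.le hx]
  · have h_ratio : D / ν ≤ (1 + x) ^ (1 - p) := by
      rwa [← Real.rpow_inv_le_iff_of_pos (by positivity) (by positivity) h_one_sub]
    have h_large : D * (1 + x) ^ p ≤ ν * (1 + x) :=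
      calc D * (1 + x) ^ p ≤ (ν * (1 + x) ^ (1 - p)) * (1 + x) ^ p := by
            gcongr
            rwa [div_le_iff₀' hν] at h_ratio
        _ = ν * (1 + x) := by
            rw [mul_assoc, ← Real.rpow_add (by linarith), sub_add_cancel, Real.rpow_one]
    linarith

/-- A solution, at almost every positive time, of the Duhamel formula with initial coefficients
`z₀`, whose squared `ℓ²` norm is bounded by `M`. -/
structure IsBoundedSolution (l ν C₁ : ℝ) (z₀ : Mode → ℂ) (M : ℝ≥0∞) (z : ℝ → Mode → ℂ) :
    Prop where
  aestronglyMeasurable (i : Mode) :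
    AEStronglyMeasurable (fun t => z t i) (volume.restrict (Ioi 0))
  l2Sq_le : ∀ᵐ t ∂(volume.restrict (Ioi 0)), l2Sq (fun i => ‖z t i‖ₑ) ≤ M
  duhamel : ∀ᵐ t ∂(volume.restrict (Ioi 0)), DuhamelModeAt l ν C₁ z₀ z t

namespace IsBoundedSolution

variable {l ν C₁ : ℝ} {z₀ : Mode → ℂ} {M : ℝ≥0∞} {z w : ℝ → Mode → ℂ}

theorem intervalIntegrable (hz : IsBoundedSolution l ν C₁ z₀ M z) (hl : 0 < l) (hν : 0 < ν)
    (hM : M < ∞) {t : ℝ} (ht : 0 ≤ t) (i : Mode) :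
    IntervalIntegrable
      (fun τ => Complex.exp ((t - τ : ℝ) * symbol l ν C₁ i) * bilin l (z τ) (z τ) i)
      volume 0 t := by
  rw [intervalIntegrable_iff_integrableOn_Ioc_of_le ht]
  have h_restrict : volume.restrict (Ioc (0 : ℝ) t) ≤ volume.restrict (Ioi (0 : ℝ)) :=
    Measure.restrict_mono Ioc_subset_Ioi_self le_rfl
  have h_meas : AEStronglyMeasurable (fun τ => bilin l (z τ) (z τ) i)
      (volume.restrict (Ioc 0 t)) :=
    (aestronglyMeasurable_bilin hl hz.aestronglyMeasurable
      (hz.l2Sq_le.mono fun τ h => h.trans_lt hM) i).mono_measure h_restrict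
  have h_cont : Continuous fun τ : ℝ => Complex.exp ((t - τ : ℝ) * symbol l ν C₁ i) := by fun_prop
  refine Integrable.of_bound (h_cont.aestronglyMeasurable.mul h_meas)
    ((l2BilinConst l M).toReal * (1 + modeSq l i) ^ (1 / 2 : ℝ)) ?_
  filter_upwards [h_restrict.absolutelyContinuous.ae_le hz.l2Sq_le,
    ae_restrict_mem measurableSet_Ioc] with τ hτ h_mem
  have h_exp : ‖Complex.exp ((t - τ : ℝ) * symbol l ν C₁ i)‖ ≤ 1 := by
    rw [norm_exp_mul_symbol, Real.exp_le_one_iff, neg_nonpos]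
    exact mul_nonneg (sub_nonneg.2 h_mem.2) (mul_nonneg hν.le (modeSq_nonneg i))
  rw [norm_mul]
  exact (mul_le_of_le_one_left (norm_nonneg _) h_exp).trans (norm_bilin_le hl hM.ne hτ i)

theorem norm_sub_le (hz : IsBoundedSolution l ν C₁ z₀ M z) (hw : IsBoundedSolution l ν C₁ z₀ M w)
    (hl : 0 < l) (hν : 0 < ν) (hM : M < ∞) {B D μ : ℝ} (hB : 0 ≤ B) (hD : 0 < D) (hμ : 0 < μ)
    (hμD : ∀ x, 0 ≤ x → D * (1 + x) ^ (7 / 8 : ℝ) ≤ μ + ν * x)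
    (h_bilin : ∀ᵐ τ ∂(volume.restrict (Ioi 0)), ∀ i,
      ‖bilin l (z τ) (z τ) i - bilin l (w τ) (w τ) i‖ ≤
        B * (1 + modeSq l i) ^ (1 / 2 : ℝ) * Real.exp (μ * τ)) :
    ∀ᵐ t ∂(volume.restrict (Ioi 0)), ∀ i,
      ‖z t i - w t i‖ ≤ B / D * Real.exp (μ * t) * (1 + modeSq l i) ^ (-(3 / 8) : ℝ) := by
  rw [ae_restrict_iff' measurableSet_Ioi] at h_bilin
  filter_upwards [hz.duhamel, hw.duhamel, ae_restrict_mem measurableSet_Ioi]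
    with t hzt hwt ht_pos i
  have ht : 0 ≤ t := (mem_Ioi.1 ht_pos).le
  have h_nonneg := modeSq_nonneg (l := l) i
  have h_denom : 0 < μ + ν * modeSq l i := by positivity
  rw [hzt i, hwt i, add_sub_add_left_eq_sub, ← intervalIntegral.integral_sub
    (hz.intervalIntegrable hl hν hM ht i) (hw.intervalIntegrable hl hν hM ht i)]
  simp_rw [← mul_sub]
  refine (norm_duhamel_le (b := B * (1 + modeSq l i) ^ (1 / 2 : ℝ)) ht h_denom (by positivity)
    (fun τ => norm_exp_mul_symbol ν C₁ (t - τ) i)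
    (by filter_upwards [h_bilin] with τ hτ h_mem using hτ h_mem.1 i)).trans ?_
  have h_pow : (1 + modeSq l i) ^ (1 / 2 : ℝ) =
      (1 + modeSq l i) ^ (-(3 / 8) : ℝ) * (1 + modeSq l i) ^ (7 / 8 : ℝ) := by
    rw [← Real.rpow_add (by linarith)]; norm_num
  rw [div_le_iff₀ h_denom, h_pow]
  calc B * ((1 + modeSq l i) ^ (-(3 / 8) : ℝ) * (1 + modeSq l i) ^ (7 / 8 : ℝ)) *
        Real.exp (μ * t)
      = B / D * Real.exp (μ * t) * (1 + modeSq l i) ^ (-(3 / 8) : ℝ) *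
        (D * (1 + modeSq l i) ^ (7 / 8 : ℝ)) := by field_simp
    _ ≤ _ := by gcongr; exact hμD _ h_nonneg

theorem norm_sub_le_half (hz : IsBoundedSolution l ν C₁ z₀ M z)
    (hw : IsBoundedSolution l ν C₁ z₀ M w) (hl : 0 < l) (hν : 0 < ν) (hM : M < ∞) {D β μ : ℝ}
    (hD : 0 < D) (h_lip : (lipschitzConst l M).toReal ≤ D) (hβ : 0 ≤ β) (hμ : 0 < μ)
    (hμD : ∀ x, 0 ≤ x → 2 * D * (1 + x) ^ (7 / 8 : ℝ) ≤ μ + ν * x)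
    (h : ∀ᵐ t ∂(volume.restrict (Ioi 0)), ∀ i,
      ‖z t i - w t i‖ ≤ β * Real.exp (μ * t) * (1 + modeSq l i) ^ (-(3 / 8) : ℝ)) :
    ∀ᵐ t ∂(volume.restrict (Ioi 0)), ∀ i,
      ‖z t i - w t i‖ ≤ β / 2 * Real.exp (μ * t) * (1 + modeSq l i) ^ (-(3 / 8) : ℝ) := by
  have h_half : β / 2 = β * D / (2 * D) := by field_simp
  rw [h_half]
  apply norm_sub_le hz hw hl hν hM (by positivity) (by positivity) hμ hμD
  filter_upwards [h, hz.l2Sq_le, hw.l2Sq_le] with τ hτ hzτ hwτ i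
  have h_nonneg := modeSq_nonneg (l := l) i
  calc ‖bilin l (z τ) (z τ) i - bilin l (w τ) (w τ) i‖
      ≤ β * Real.exp (μ * τ) * (lipschitzConst l M).toReal * (1 + modeSq l i) ^ (1 / 2 : ℝ) :=
        norm_bilin_sub_bilin_le hl hM (by positivity) hzτ hwτ hτ i
    _ ≤ β * Real.exp (μ * τ) * D * (1 + modeSq l i) ^ (1 / 2 : ℝ) := by gcongr
    _ = _ := by ring

theorem norm_sub_le_of_l2Sq_le (hz : IsBoundedSolution l ν C₁ z₀ M z)
    (hw : IsBoundedSolution l ν C₁ z₀ M w) (hl : 0 < l) (hν : 0 < ν) (hM : M < ∞) {D μ : ℝ}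
    (hD : 0 < D) (hμ : 0 < μ) (hμD : ∀ x, 0 ≤ x → D * (1 + x) ^ (7 / 8 : ℝ) ≤ μ + ν * x) :
    ∀ᵐ t ∂(volume.restrict (Ioi 0)), ∀ i, ‖z t i - w t i‖ ≤
      2 * (l2BilinConst l M).toReal / D * Real.exp (μ * t) *
        (1 + modeSq l i) ^ (-(3 / 8) : ℝ) := by
  apply norm_sub_le hz hw hl hν hM (by positivity) hD hμ hμD
  filter_upwards [hz.l2Sq_le, hw.l2Sq_le, ae_restrict_mem measurableSet_Ioi] with τ hzτ hwτ hτ i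
  have h_nonneg := modeSq_nonneg (l := l) i
  have h_exp : 1 ≤ Real.exp (μ * τ) := Real.one_le_exp (mul_nonneg hμ.le (mem_Ioi.1 hτ).le)
  calc _ ≤ 2 * (l2BilinConst l M).toReal * (1 + modeSq l i) ^ (1 / 2 : ℝ) * 1 := by
        refine (_root_.norm_sub_le _ _).trans ?_
        linarith [norm_bilin_le hl hM.ne hzτ i, norm_bilin_le hl hM.ne hwτ i]
    _ ≤ _ := by gcongr

/- With `μ` so large that `μ + ν |κ|²` beats twice the Lipschitz constant, the Duhamel formula
halves the distance `sup e^(-μt) (1 + |κ|²)^(3/8) |z - w|`. -/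
theorem ae_eq (hz : IsBoundedSolution l ν C₁ z₀ M z) (hw : IsBoundedSolution l ν C₁ z₀ M w)
    (hl : 0 < l) (hν : 0 < ν) (hM : M < ∞) : ∀ᵐ t ∂(volume.restrict (Ioi 0)), z t = w t := by
  let D : ℝ := (lipschitzConst l M).toReal + 1
  have hD : 0 < D := by positivity
  obtain ⟨μ, hμ, hμD⟩ := exists_mul_one_add_rpow_le hν (D := 2 * D) (p := 7 / 8) (by positivity)
    (by norm_num) (by norm_num)
  let β₀ : ℝ := 2 * (l2BilinConst l M).toReal / (2 * D)
  have h_iterate : ∀ n : ℕ, ∀ᵐ t ∂(volume.restrict (Ioi 0)), ∀ i,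
      ‖z t i - w t i‖ ≤ β₀ / 2 ^ n * Real.exp (μ * t) * (1 + modeSq l i) ^ (-(3 / 8) : ℝ) := by
    intro n
    induction n with
    | zero =>
      simpa only [pow_zero, div_one] using
        norm_sub_le_of_l2Sq_le hz hw hl hν hM (by positivity) hμ hμD
    | succ n ih =>
      simpa only [div_div, ← pow_succ] using
        norm_sub_le_half hz hw hl hν hM hD (le_add_of_nonneg_right zero_le_one)
          (by positivity) hμ hμD ih
  filter_upwards [ae_all_iff.2 h_iterate] with t ht
  funext i
  rw [← sub_eq_zero, ← norm_le_zero_iff]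
  have h_pow : Tendsto (fun n : ℕ => β₀ / 2 ^ n) atTop (𝓝 0) :=
    tendsto_const_nhds.div_atTop (tendsto_pow_atTop_atTop_of_one_lt (by norm_num))
  have h_lim : Tendsto (fun n : ℕ => β₀ / 2 ^ n * Real.exp (μ * t) *
      (1 + modeSq l i) ^ (-(3 / 8) : ℝ)) atTop (𝓝 0) := by
    simpa only [zero_mul] using (h_pow.mul_const (Real.exp (μ * t))).mul_const
      ((1 + modeSq l i) ^ (-(3 / 8) : ℝ))
  exact ge_of_tendsto' h_lim fun n => ht n i

end IsBoundedSolution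

/-! ### Gain of regularity -/

section Smoothing

variable {l : ℝ}

/-- The square of the `H^r` norm of a sequence of coefficients. -/
def sobolevSq (l r : ℝ) (a : Mode → ℝ≥0∞) : ℝ≥0∞ :=
  (∑' n, wt1 l n ^ r * a (.inl n) ^ 2) + ∑' k, wt2 l k ^ r * a (.inr k) ^ 2

/-- The square of an anisotropic norm which is weaker than the `ℓ²` norm: its weight decays in the
zonal direction only. -/
def zonalWeakSq (l : ℝ) (f : ℤ × ℤ → ℝ≥0∞) : ℝ≥0∞ :=
  ∑' m : ℤ × ℤ, wt1 l m.1 ^ (-(1 / 8) : ℝ) * f m ^ 2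

/-- The part of the sum of squares of `f` which the majorant with second factor `f` sees at the
mode `k`. -/
def localSq (l : ℝ) (f : ℤ × ℤ → ℝ≥0∞) (k : ℤ × ℤ) : ℝ≥0∞ :=
  (∑' h, wt2 l h ^ (-1 : ℝ) * f (k - h) ^ 2) + ∑' n, f (k.1, n) ^ 2

/-- The constant in the bound of the weighted sum of `localSq`. -/
def localSqConst (l : ℝ) : ℝ≥0∞ := 4 * latticeSum2 l (13 / 8) + latticeSum1 l (3 / 4)

theorem localSqConst_lt_top (hl : 0 < l) : localSqConst l < ∞ :=
  ENNReal.add_lt_top.2 ⟨ENNReal.mul_lt_top (by norm_num) (latticeSum2_lt_top hl (by norm_num)),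
    latticeSum1_lt_top hl (by norm_num)⟩

theorem tsum_localSq_le (f : ℤ × ℤ → ℝ≥0∞) :
    ∑' k, wt2 l k ^ (-(7 / 8) : ℝ) * localSq l f k ≤ localSqConst l * zonalWeakSq l f := by
  have h_conv := tsum_wt2_mul_convolution_le l (fun m => f m ^ 2) (a := 1 / 8) (p := 3 / 4)
    (q := 7 / 8) (by norm_num) (by norm_num) (by norm_num) (by norm_num)
  have h_fiber := tsum_wt2_mul_fiber_le l (fun m => f m ^ 2) (a := 1 / 8) (b := 3 / 4)
    (by norm_num) (by norm_num)
  rw [show (1 / 8 + 3 / 4 : ℝ) = 7 / 8 by norm_num] at h_conv h_fiber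
  rw [show (1 / 8 + 7 / 8 : ℝ) = 1 by norm_num,
    show (3 / 4 + 7 / 8 : ℝ) = 13 / 8 by norm_num] at h_conv
  simp only [localSq, mul_add]
  rw [ENNReal.tsum_add, localSqConst, add_mul]
  exact add_le_add h_conv h_fiber

theorem sq_majorant_inr_le (a b : Mode → ℝ≥0∞) (k : ℤ × ℤ) :
    majorant l a b (.inr k) ^ 2 ≤ 2 * (l2Sq a * localSq l (fun h => b (.inr h)) k) := by
  simp only [majorant]
  refine (add_sq_le_two_mul _ _).trans ?_
  rw [localSq, mul_add (l2Sq a)]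
  gcongr
  · refine (sq_conv_le_weight_right l (fun h => a (.inr h)) (fun h => b (.inr h)) k).trans ?_
    gcongr
    exact le_add_self
  · refine (sq_fiber_conv_le (fun n => a (.inl n)) (fun h => b (.inr h)) k).trans ?_
    gcongr
    exact le_self_add

theorem sq_majorant_inl_le (a b : Mode → ℝ≥0∞) (n : ℤ) :
    majorant l a b (.inl n) ^ 2 ≤ (∑' k, a (.inr k) ^ 2) * ∑' k, b (.inr k) ^ 2 := by
  simp only [majorant]
  refine (sq_conv_le_weight_right l (fun h => a (.inr h)) (fun h => b (.inr h)) (0, n)).trans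
    (mul_le_mul' le_rfl ?_)
  calc ∑' h, wt2 l h ^ (-1 : ℝ) * b (.inr ((0, n) - h)) ^ 2
      ≤ ∑' h, b (.inr ((0, n) - h)) ^ 2 := by
        refine ENNReal.tsum_le_tsum fun h => mul_le_of_le_one_left' ?_
        exact ENNReal.rpow_le_one_of_one_le_of_neg (one_le_wt2 l h) (by norm_num)
    _ = ∑' h, b (.inr h) ^ 2 := tsum_sub_left (fun h => b (.inr h) ^ 2) (0, n)

theorem zonalWeakSq_le (f : ℤ × ℤ → ℝ≥0∞) : zonalWeakSq l f ≤ ∑' k, f k ^ 2 :=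
  ENNReal.tsum_le_tsum fun m => mul_le_of_le_one_left' <|
    ENNReal.rpow_le_one_of_one_le_of_neg (one_le_wt1 l m.1) (by norm_num)

theorem tsum_inl_majorant_le (a b : Mode → ℝ≥0∞) :
    ∑' n, wt1 l n ^ (-(7 / 8) : ℝ) * majorant l a b (.inl n) ^ 2 ≤
      latticeSum1 l (7 / 8) * (l2Sq a * l2Sq b) := by
  rw [latticeSum1, ← ENNReal.tsum_mul_right]
  gcongr with n
  refine (sq_majorant_inl_le a b n).trans ?_
  gcongr <;> exact le_add_self

theorem tsum_inr_majorant_le (a b : Mode → ℝ≥0∞) :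
    ∑' k, wt2 l k ^ (-(7 / 8) : ℝ) * majorant l a b (.inr k) ^ 2 ≤
      2 * localSqConst l * (l2Sq a * l2Sq b) := by
  have h_local : ∑' k, wt2 l k ^ (-(7 / 8) : ℝ) * localSq l (fun h => b (.inr h)) k ≤
      localSqConst l * l2Sq b := by
    refine (tsum_localSq_le _).trans ?_
    gcongr
    exact (zonalWeakSq_le _).trans le_add_self
  calc ∑' k, wt2 l k ^ (-(7 / 8) : ℝ) * majorant l a b (.inr k) ^ 2
      ≤ ∑' k, wt2 l k ^ (-(7 / 8) : ℝ) *
          (2 * (l2Sq a * localSq l (fun h => b (.inr h)) k)) := by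
        gcongr with k
        exact sq_majorant_inr_le a b k
    _ = 2 * l2Sq a * ∑' k, wt2 l k ^ (-(7 / 8) : ℝ) * localSq l (fun h => b (.inr h)) k := by
        rw [← ENNReal.tsum_mul_left]
        exact tsum_congr fun k => by ring
    _ ≤ 2 * l2Sq a * (localSqConst l * l2Sq b) := by gcongr
    _ = 2 * localSqConst l * (l2Sq a * l2Sq b) := by ring

theorem sobolevSq_zero (a : Mode → ℝ≥0∞) : sobolevSq l 0 a = l2Sq a := by
  simp [sobolevSq, l2Sq]

theorem sobolevSq_mono {a b : Mode → ℝ≥0∞} {r r' : ℝ} (hr : r ≤ r') (h : ∀ i, a i ≤ b i) :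
    sobolevSq l r a ≤ sobolevSq l r' b := by
  unfold sobolevSq
  gcongr with n k
  · exact one_le_wt1 l n
  · exact h _
  · exact one_le_wt2 l k
  · exact h _

theorem tsum_mul_add_sq_le {ι : Type*} (c x y : ι → ℝ≥0∞) :
    ∑' n, c n * (x n + y n) ^ 2 ≤ 2 * (∑' n, c n * x n ^ 2 + ∑' n, c n * y n ^ 2) := by
  rw [← ENNReal.tsum_add, ← ENNReal.tsum_mul_left]
  refine ENNReal.tsum_le_tsum fun n => ?_
  calc c n * (x n + y n) ^ 2 ≤ c n * (2 * (x n ^ 2 + y n ^ 2)) := by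
        gcongr
        exact add_sq_le_two_mul _ _
    _ = 2 * (c n * x n ^ 2 + c n * y n ^ 2) := by ring

theorem sobolevSq_add_le (a b : Mode → ℝ≥0∞) (r : ℝ) :
    sobolevSq l r (fun i => a i + b i) ≤ 2 * (sobolevSq l r a + sobolevSq l r b) := by
  unfold sobolevSq
  refine (add_le_add (tsum_mul_add_sq_le _ _ _) (tsum_mul_add_sq_le _ _ _)).trans_eq ?_
  ring

theorem sobolevSq_const_mul (c : ℝ≥0∞) (a : Mode → ℝ≥0∞) (r : ℝ) :
    sobolevSq l r (fun i => c * a i) = c ^ 2 * sobolevSq l r a := by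
  unfold sobolevSq
  simp_rw [mul_pow, mul_left_comm _ (c ^ 2), ENNReal.tsum_mul_left, mul_add]

theorem sobolevSq_wt_rpow_mul (a : Mode → ℝ≥0∞) (p r : ℝ) :
    sobolevSq l r (fun i => wt l i ^ p * a i) = sobolevSq l (r + p * 2) a := by
  simp only [sobolevSq, wt, Sum.elim_inl, Sum.elim_inr, mul_pow, sq_rpow, wt1_rpow_add,
    wt2_rpow_add, mul_assoc]

/-- The constant in the bound of the majorant in a negative Sobolev norm. -/
def smoothingConst (l : ℝ) : ℝ≥0∞ := latticeSum1 l (7 / 8) + 2 * localSqConst l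

theorem smoothingConst_lt_top (hl : 0 < l) : smoothingConst l < ∞ :=
  ENNReal.add_lt_top.2 ⟨latticeSum1_lt_top hl (by norm_num),
    ENNReal.mul_lt_top (by norm_num) (localSqConst_lt_top hl)⟩

theorem sobolevSq_majorant_le (a b : Mode → ℝ≥0∞) :
    sobolevSq l (-(7 / 8)) (majorant l a b) ≤ smoothingConst l * (l2Sq a * l2Sq b) := by
  rw [smoothingConst, add_mul]
  exact add_le_add (tsum_inl_majorant_le a b) (tsum_inr_majorant_le a b)

theorem wt2_rpow_mul_conv_le (a b : ℤ × ℤ → ℝ≥0∞) {r : ℝ} (hr : 0 ≤ r) (k : ℤ × ℤ) :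
    wt2 l k ^ r * (∑' h, a h * wt2 l h ^ (-(1 / 2) : ℝ) * b (k - h)) ≤
      4 ^ r * ((∑' h, wt2 l h ^ r * a h * wt2 l h ^ (-(1 / 2) : ℝ) * b (k - h)) +
        ∑' h, a h * wt2 l h ^ (-(1 / 2) : ℝ) * (wt2 l (k - h) ^ r * b (k - h))) := by
  rw [← ENNReal.tsum_add, ← ENNReal.tsum_mul_left, ← ENNReal.tsum_mul_left]
  refine ENNReal.tsum_le_tsum fun h => ?_
  calc wt2 l k ^ r * (a h * wt2 l h ^ (-(1 / 2) : ℝ) * b (k - h))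
      ≤ (4 ^ r * (wt2 l h ^ r + wt2 l (k - h) ^ r)) *
          (a h * wt2 l h ^ (-(1 / 2) : ℝ) * b (k - h)) := by
        gcongr
        exact wt2_rpow_le l k h hr
    _ = _ := by ring

theorem wt2_rpow_mul_fiber_le (a : ℤ → ℝ≥0∞) (b : ℤ × ℤ → ℝ≥0∞) {r : ℝ} (hr : 0 ≤ r)
    (k : ℤ × ℤ) :
    wt2 l k ^ r * ∑' n, a n * b (k - (0, n)) ≤
      4 ^ r * ((∑' n, wt1 l n ^ r * a n * b (k - (0, n))) +
        ∑' n, a n * (wt2 l (k - (0, n)) ^ r * b (k - (0, n)))) := by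
  rw [← ENNReal.tsum_add, ← ENNReal.tsum_mul_left, ← ENNReal.tsum_mul_left]
  refine ENNReal.tsum_le_tsum fun n => ?_
  calc wt2 l k ^ r * (a n * b (k - (0, n)))
      ≤ (4 ^ r * (wt2 l (0, n) ^ r + wt2 l (k - (0, n)) ^ r)) * (a n * b (k - (0, n))) := by
        gcongr
        exact wt2_rpow_le l k (0, n) hr
    _ = _ := by rw [wt2_zonal]; ring

theorem wt_rpow_mul_majorant_le (a b : Mode → ℝ≥0∞) {r : ℝ} (hr : 0 ≤ r) (i : Mode) :
    wt l i ^ r * majorant l a b i ≤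
      4 ^ r * (majorant l (fun j => wt l j ^ r * a j) b i +
        majorant l a (fun j => wt l j ^ r * b j) i) := by
  rcases i with n | k
  · simp only [majorant, wt, Sum.elim_inl, Sum.elim_inr]
    rw [← wt2_zonal]
    exact wt2_rpow_mul_conv_le (fun h => a (.inr h)) (fun h => b (.inr h)) hr (0, n)
  · simp only [majorant, wt, Sum.elim_inl, Sum.elim_inr]
    rw [mul_add]
    refine (add_le_add (wt2_rpow_mul_conv_le (fun h => a (.inr h)) (fun h => b (.inr h)) hr k)
      (wt2_rpow_mul_fiber_le (fun n => a (.inl n)) (fun h => b (.inr h)) hr k)).trans_eq ?_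
    ring

theorem sobolevSq_majorant_lt_top (hl : 0 < l) {a : Mode → ℝ≥0∞} {r : ℝ} (hr : 0 ≤ r)
    (ha : sobolevSq l r a < ∞) :
    sobolevSq l (r + 1 / 8) (fun i => wt l i ^ (-(1 / 2) : ℝ) * majorant l a a i) < ∞ := by
  let b : Mode → ℝ≥0∞ := fun j => wt l j ^ (r / 2) * a j
  have ha_l2 : l2Sq a < ∞ := by
    rw [← sobolevSq_zero (l := l)]
    exact (sobolevSq_mono hr fun _ => le_rfl).trans_lt ha
  have hb_l2 : l2Sq b < ∞ := by
    rwa [← sobolevSq_zero (l := l), sobolevSq_wt_rpow_mul, zero_add, div_mul_cancel₀ r two_ne_zero]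
  have h_shift : sobolevSq l (r + 1 / 8) (fun i => wt l i ^ (-(1 / 2) : ℝ) * majorant l a a i) =
      sobolevSq l (-(7 / 8)) (fun i => wt l i ^ (r / 2) * majorant l a a i) := by
    rw [sobolevSq_wt_rpow_mul, sobolevSq_wt_rpow_mul]
    ring_nf
  have h_smooth : ∀ {x y : Mode → ℝ≥0∞}, l2Sq x < ∞ → l2Sq y < ∞ →
      sobolevSq l (-(7 / 8)) (majorant l x y) < ∞ := fun hx hy =>
    (sobolevSq_majorant_le _ _).trans_lt
      (ENNReal.mul_lt_top (smoothingConst_lt_top hl) (ENNReal.mul_lt_top hx hy))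
  rw [h_shift]
  calc sobolevSq l (-(7 / 8)) (fun i => wt l i ^ (r / 2) * majorant l a a i)
      ≤ sobolevSq l (-(7 / 8)) fun i => 4 ^ (r / 2) * (majorant l b a i + majorant l a b i) :=
        sobolevSq_mono le_rfl fun i => wt_rpow_mul_majorant_le a a (by positivity) i
    _ ≤ (4 ^ (r / 2)) ^ 2 * (2 * (sobolevSq l (-(7 / 8)) (majorant l b a) +
          sobolevSq l (-(7 / 8)) (majorant l a b))) := by
        rw [sobolevSq_const_mul]
        gcongr
        exact sobolevSq_add_le _ _ _
    _ < ∞ := by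
        refine ENNReal.mul_lt_top (ENNReal.pow_lt_top ?_) (ENNReal.mul_lt_top (by norm_num)
          (ENNReal.add_lt_top.2 ⟨h_smooth hb_l2 ha_l2, h_smooth ha_l2 hb_l2⟩))
        exact ENNReal.rpow_lt_top_of_nonneg (by positivity) (by norm_num)

theorem sobolevSq_lt_top_of_le (hl : 0 < l) {A Z : Mode → ℝ≥0∞} {C : ℝ≥0∞} (hC : C < ∞) {s : ℝ}
    (hs : 0 ≤ s) (hA : sobolevSq l s A < ∞) (hZ : l2Sq Z < ∞)
    (h : ∀ i, Z i ≤ A i + C * (wt l i ^ (-(1 / 2) : ℝ) * majorant l Z Z i)) :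
    sobolevSq l s Z < ∞ := by
  have h_gain : ∀ {r : ℝ}, 0 ≤ r → sobolevSq l r Z < ∞ → ∀ {r' : ℝ}, r' ≤ s → r' ≤ r + 1 / 8 →
      sobolevSq l r' Z < ∞ := by
    intro r hr hr_lt r' hr's hr'r
    have h_data : sobolevSq l r' A < ∞ := (sobolevSq_mono hr's fun _ => le_rfl).trans_lt hA
    have h_majorant :
        sobolevSq l r' (fun i => wt l i ^ (-(1 / 2) : ℝ) * majorant l Z Z i) < ∞ :=
      (sobolevSq_mono hr'r fun _ => le_rfl).trans_lt (sobolevSq_majorant_lt_top hl hr hr_lt)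
    refine ((sobolevSq_mono le_rfl h).trans (sobolevSq_add_le _ _ _)).trans_lt ?_
    rw [sobolevSq_const_mul]
    exact ENNReal.mul_lt_top (by norm_num) (ENNReal.add_lt_top.2
      ⟨h_data, ENNReal.mul_lt_top (ENNReal.pow_lt_top hC) h_majorant⟩)
  have h_bootstrap : ∀ j : ℕ, sobolevSq l (min s (j / 8)) Z < ∞ := by
    intro j
    induction j with
    | zero => simpa [hs, sobolevSq_zero] using hZ
    | succ j ih =>
      refine h_gain (le_min hs (by positivity)) ih (min_le_left _ _) ?_
      rw [← min_add_add_right]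
      exact min_le_min (by linarith) (by push_cast; linarith)
  obtain ⟨j, hj⟩ := exists_nat_ge (8 * s)
  rw [← min_eq_left (show s ≤ j / 8 by linarith)]
  exact h_bootstrap j

end Smoothing

/-! ### A time-independent majorant -/

section UniformMajorant

variable {l : ℝ}

/-- The right-hand side of the integrated inequality when the squares of the majorants are bounded
by `B`. -/
def integratedBound (l : ℝ) (A : Mode → ℝ≥0∞) (C : ℝ≥0∞) (B : Mode → ℝ≥0∞) (i : Mode) : ℝ≥0∞ :=
  A i + C * (wt l i ^ (-(1 / 2) : ℝ) * B i ^ (1 / 2 : ℝ))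

theorem tsum_mul_sq_integratedBound_lt_top {ι : Type*} {c : ι → ℝ≥0∞} {f : ι → Mode}
    {A B : Mode → ℝ≥0∞} {C : ℝ≥0∞} (hC : C < ∞) (hA : ∑' j, c j * A (f j) ^ 2 < ∞)
    (hB : ∑' j, c j * (wt l (f j) ^ (-1 : ℝ) * B (f j)) < ∞) :
    ∑' j, c j * integratedBound l A C B (f j) ^ 2 < ∞ := by
  have h_sq : ∀ j, c j * (C * (wt l (f j) ^ (-(1 / 2) : ℝ) * B (f j) ^ (1 / 2 : ℝ))) ^ 2 =
      C ^ 2 * (c j * (wt l (f j) ^ (-1 : ℝ) * B (f j))) := fun j => by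
    rw [mul_pow, mul_pow, sq_rpow, sq_rpow]
    norm_num
    ring
  refine (tsum_mul_add_sq_le _ _ _).trans_lt
    (ENNReal.mul_lt_top (by norm_num) (ENNReal.add_lt_top.2 ⟨hA, ?_⟩))
  simp_rw [h_sq, ENNReal.tsum_mul_left]
  exact ENNReal.mul_lt_top (ENNReal.pow_lt_top hC) hB

/-- A bound of the energy `∑ |u|² + ∑ |ζ|²` in terms of a bound `M` of the enstrophy `∑ |ζ|²`. -/
def energyBound (l : ℝ) (A : Mode → ℝ≥0∞) (C M : ℝ≥0∞) : ℝ≥0∞ :=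
  ∑' n, integratedBound l A C (fun _ => M * M) (.inl n) ^ 2 + M

/-- The bound of the eddy modes which the energy bound gives. It need not be square summable, only
its `zonalWeakSq` is finite. -/
def weakEddyBound (l : ℝ) (A : Mode → ℝ≥0∞) (C M : ℝ≥0∞) (k : ℤ × ℤ) : ℝ≥0∞ :=
  integratedBound l A C (fun _ => 4 * (energyBound l A C M * energyBound l A C M)) (.inr k)

/-- The square summable majorant, obtained by inserting `weakEddyBound` into the integrated
inequality once more. -/
def uniformMajorant (l : ℝ) (A : Mode → ℝ≥0∞) (C M : ℝ≥0∞) : Mode → ℝ≥0∞ :=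
  integratedBound l A C (Sum.elim (fun _ => M * M)
    fun k => 2 * (energyBound l A C M * localSq l (weakEddyBound l A C M) k))

theorem tsum_zonal_mul_wt2_lt_top (hl : 0 < l) :
    ∑' m : ℤ × ℤ, wt1 l m.1 ^ (-(1 / 8) : ℝ) * wt2 l m ^ (-1 : ℝ) < ∞ := by
  have h_split : ∀ m : ℤ × ℤ, wt1 l m.1 ^ (-(1 / 8) : ℝ) * wt2 l m ^ (-1 : ℝ) ≤
      wt1 l m.1 ^ (-(9 / 16) : ℝ) * wt1 l m.2 ^ (-(9 / 16) : ℝ) := fun m => by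
    have h_prod := wt2_rpow_neg_le l m (a := 7 / 16) (b := 9 / 16) (by norm_num) (by norm_num)
    calc wt1 l m.1 ^ (-(1 / 8) : ℝ) * wt2 l m ^ (-1 : ℝ)
        ≤ wt1 l m.1 ^ (-(1 / 8) : ℝ) *
            (wt1 l m.1 ^ (-(7 / 16) : ℝ) * wt1 l m.2 ^ (-(9 / 16) : ℝ)) := by
          gcongr
          rwa [show (7 / 16 + 9 / 16 : ℝ) = 1 by norm_num] at h_prod
      _ = wt1 l m.1 ^ (-(9 / 16) : ℝ) * wt1 l m.2 ^ (-(9 / 16) : ℝ) := by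
          rw [← mul_assoc, ← wt1_rpow_add]
          norm_num
  refine (ENNReal.tsum_le_tsum h_split).trans_lt ?_
  rw [tsum_prod_mul (fun n => wt1 l n ^ (-(9 / 16) : ℝ)) fun n => wt1 l n ^ (-(9 / 16) : ℝ)]
  have h_sum := latticeSum1_lt_top hl (p := 9 / 16) (by norm_num)
  exact ENNReal.mul_lt_top h_sum h_sum

variable {A : Mode → ℝ≥0∞} {C M : ℝ≥0∞}

theorem tsum_sq_integratedBound_inl_lt_top (hl : 0 < l) (hA : l2Sq A < ∞) (hC : C < ∞)
    (hM : M < ∞) : ∑' n, integratedBound l A C (fun _ => M * M) (.inl n) ^ 2 < ∞ := by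
  have h := tsum_mul_sq_integratedBound_lt_top (l := l) (c := 1) (f := Sum.inl) (A := A)
    (B := fun _ => M * M) hC (by simpa using le_self_add.trans_lt hA) ?_
  · simpa using h
  · simp only [Pi.one_apply, one_mul, ENNReal.tsum_mul_right]
    exact ENNReal.mul_lt_top (latticeSum1_lt_top hl one_half_lt_one) (ENNReal.mul_lt_top hM hM)

theorem energyBound_lt_top (hl : 0 < l) (hA : l2Sq A < ∞) (hC : C < ∞) (hM : M < ∞) :
    energyBound l A C M < ∞ :=
  ENNReal.add_lt_top.2 ⟨tsum_sq_integratedBound_inl_lt_top hl hA hC hM, hM⟩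

theorem zonalWeakSq_weakEddyBound_lt_top (hl : 0 < l) (hA : l2Sq A < ∞) (hC : C < ∞)
    (hM : M < ∞) : zonalWeakSq l (weakEddyBound l A C M) < ∞ := by
  have hN := energyBound_lt_top hl hA hC hM
  refine tsum_mul_sq_integratedBound_lt_top (f := Sum.inr) hC
    ((zonalWeakSq_le fun k => A (.inr k)).trans_lt (le_add_self.trans_lt hA)) ?_
  simp_rw [← mul_assoc, ENNReal.tsum_mul_right]
  exact ENNReal.mul_lt_top (ENNReal.mul_lt_top (ENNReal.mul_lt_top
    (tsum_zonal_mul_wt2_lt_top hl) (by norm_num)) hN) hN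

theorem l2Sq_uniformMajorant_lt_top (hl : 0 < l) (hA : l2Sq A < ∞) (hC : C < ∞) (hM : M < ∞) :
    l2Sq (uniformMajorant l A C M) < ∞ := by
  have hN := energyBound_lt_top hl hA hC hM
  have h_eddy : ∑' k, uniformMajorant l A C M (.inr k) ^ 2 < ∞ := by
    have h := tsum_mul_sq_integratedBound_lt_top (l := l) (c := 1) (f := Sum.inr) (A := A)
      (B := Sum.elim (fun _ => M * M)
        fun k => 2 * (energyBound l A C M * localSq l (weakEddyBound l A C M) k))
      hC (by simpa using le_add_self.trans_lt hA) ?_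
    · simpa [uniformMajorant] using h
    have h_local := (tsum_localSq_le (l := l) (weakEddyBound l A C M)).trans_lt
      (ENNReal.mul_lt_top (localSqConst_lt_top hl)
        (zonalWeakSq_weakEddyBound_lt_top hl hA hC hM))
    refine lt_of_le_of_lt ?_ (ENNReal.mul_lt_top
      (ENNReal.mul_lt_top (by norm_num : (2 : ℝ≥0∞) < ∞) hN) h_local)
    rw [← ENNReal.tsum_mul_left]
    refine ENNReal.tsum_le_tsum fun k => ?_
    calc _ = 2 * energyBound l A C M *
          (wt2 l k ^ (-1 : ℝ) * localSq l (weakEddyBound l A C M) k) := by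
          simp only [Pi.one_apply, wt, Sum.elim_inr]; ring
      _ ≤ 2 * energyBound l A C M *
          (wt2 l k ^ (-(7 / 8) : ℝ) * localSq l (weakEddyBound l A C M) k) := by
          gcongr 2 * _ * (?_ * _)
          exact ENNReal.rpow_le_rpow_of_exponent_le (one_le_wt2 l k) (by norm_num)
  exact ENNReal.add_lt_top.2 ⟨tsum_sq_integratedBound_inl_lt_top hl hA hC hM, h_eddy⟩

/-- The integrated inequality with data `A`, for a family of sequences indexed by time. -/
def IntegratedInequality (l : ℝ) (A : Mode → ℝ≥0∞) (C : ℝ≥0∞) {T : Type*}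
    (a : T → Mode → ℝ≥0∞) : Prop :=
  ∀ i b, (∀ τ, majorant l (a τ) (a τ) i ≤ b) → ∀ t, a t i ≤ A i + C * (wt l i ^ (-(1 / 2) : ℝ) * b)

namespace IntegratedInequality

variable {T : Type*} {a : T → Mode → ℝ≥0∞}

theorem le_integratedBound (h : IntegratedInequality l A C a) {B : Mode → ℝ≥0∞} {i : Mode}
    (hB : ∀ τ, majorant l (a τ) (a τ) i ^ 2 ≤ B i) (t : T) : a t i ≤ integratedBound l A C B i :=
  h i _ (fun τ => le_rpow_half_of_sq_le (hB τ)) t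

theorem inl_le (h : IntegratedInequality l A C a) (hM : ∀ t, ∑' k, a t (.inr k) ^ 2 ≤ M) (t : T)
    (n : ℤ) : a t (.inl n) ≤ integratedBound l A C (fun _ => M * M) (.inl n) :=
  h.le_integratedBound (fun τ => (sq_majorant_inl_le _ _ n).trans (mul_le_mul' (hM τ) (hM τ))) t

theorem l2Sq_le (h : IntegratedInequality l A C a) (hM : ∀ t, ∑' k, a t (.inr k) ^ 2 ≤ M) (t : T) :
    l2Sq (a t) ≤ energyBound l A C M := by
  refine add_le_add (ENNReal.tsum_le_tsum fun n => ?_) (hM t)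
  gcongr
  exact h.inl_le hM t n

theorem inr_le_weakEddyBound (h : IntegratedInequality l A C a)
    (hM : ∀ t, ∑' k, a t (.inr k) ^ 2 ≤ M) (t : T) (k : ℤ × ℤ) :
    a t (.inr k) ≤ weakEddyBound l A C M k := by
  refine h.le_integratedBound (fun τ => (sq_majorant_le l _ _ _).trans ?_) t
  gcongr <;> exact h.l2Sq_le hM τ

theorem le_uniformMajorant (ha : IntegratedInequality l A C a)
    (hM : ∀ t, ∑' k, a t (.inr k) ^ 2 ≤ M) (t : T) (i : Mode) :
    a t i ≤ uniformMajorant l A C M i := by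
  rcases i with n | k
  · exact ha.inl_le hM t n
  · refine ha.le_integratedBound (fun τ => (sq_majorant_inr_le _ _ k).trans ?_) t
    simp only [Sum.elim_inr, localSq]
    gcongr <;> first | exact ha.l2Sq_le hM τ | exact ha.inr_le_weakEddyBound hM τ _

end IntegratedInequality

end UniformMajorant

/-! ### The integrated inequality -/

section Integrated

variable {l : ℝ}

theorem bilin_eq_zero_or_gap (hl : 0 < l) (i : Mode) :
    (∀ z w, bilin l z w i = 0) ∨ 1 + modeSq l i ≤ gapConst l * modeSq l i := by
  rcases i with n | k
  · by_cases hn : n = 0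
    · left; intro z w; simp [bilin, hn, freq_zero]
    · right; exact one_add_freq_sq_le hl hn
  · by_cases hk : k.1 = 0
    · left; intro z w; simp [bilin, hk]
    · right; exact one_add_freqSq_le hl fun h => hk (by simp [h])

/-- The constant in the integrated inequality. -/
def duhamelConst (l ν : ℝ) : ℝ≥0∞ := bilinConst l * ENNReal.ofReal (gapConst l / ν)

theorem duhamelConst_lt_top (l ν : ℝ) : duhamelConst l ν < ∞ :=
  ENNReal.mul_lt_top (bilinConst_ne_top l).lt_top ENNReal.ofReal_lt_top

theorem duhamelConst_ne_zero (l : ℝ) {ν : ℝ} (hν : 0 < ν) : duhamelConst l ν ≠ 0 := by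
  have h_gap : 0 < gapConst l := zero_lt_one.trans_le (one_le_gapConst l)
  exact mul_ne_zero (zero_lt_one.trans_le (one_le_bilinConst l)).ne'
    (ENNReal.ofReal_pos.2 (div_pos h_gap hν)).ne'

theorem norm_exp_mul_symbol_le_one {ν C₁ t : ℝ} (hν : 0 < ν) (ht : 0 ≤ t) (i : Mode) :
    ‖Complex.exp (t * symbol l ν C₁ i)‖ ≤ 1 := by
  rw [norm_exp_mul_symbol, Real.exp_le_one_iff, neg_nonpos]
  exact mul_nonneg ht (mul_nonneg hν.le (modeSq_nonneg i))

theorem one_add_rpow_half_div_le {ν g m : ℝ} (hν : 0 < ν) (hm : 0 < m) (h_gap : 1 + m ≤ g * m) :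
    (1 + m) ^ (1 / 2 : ℝ) / (ν * m) ≤ g / ν * (1 + m) ^ (-(1 / 2) : ℝ) := by
  have h_split : (1 + m) ^ (1 / 2 : ℝ) = (1 + m) ^ (-(1 / 2) : ℝ) * (1 + m) := by
    rw [← Real.rpow_add_one (by positivity)]
    norm_num
  rw [h_split, div_le_iff₀ (by positivity)]
  calc (1 + m) ^ (-(1 / 2) : ℝ) * (1 + m) ≤ (1 + m) ^ (-(1 / 2) : ℝ) * (g * m) := by gcongr
    _ = g / ν * (1 + m) ^ (-(1 / 2) : ℝ) * (ν * m) := by field_simp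

/- The time integral of the semigroup gains a full power of the weight, of which `bilin` loses
half. -/
theorem enorm_integral_exp_mul_bilin_le (hl : 0 < l) {ν C₁ : ℝ} (hν : 0 < ν) {z : ℝ → Mode → ℂ}
    {t : ℝ} (ht : 0 ≤ t) {i : Mode} {b : ℝ≥0∞}
    (hb : ∀ τ ∈ Ioc 0 t, majorant l (fun j => ‖z τ j‖ₑ) (fun j => ‖z τ j‖ₑ) i ≤ b) :
    ‖∫ τ in (0 : ℝ)..t, Complex.exp ((t - τ : ℝ) * symbol l ν C₁ i) * bilin l (z τ) (z τ) i‖ₑ ≤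
      duhamelConst l ν * (wt l i ^ (-(1 / 2) : ℝ) * b) := by
  rcases bilin_eq_zero_or_gap hl i with h_zero | h_gap
  · simp [h_zero]
  rcases eq_or_ne b ∞ with rfl | hb_top
  · rw [ENNReal.mul_top, ENNReal.mul_top (duhamelConst_ne_zero l hν)]
    · exact le_top
    · simp [ENNReal.rpow_eq_zero_iff, wt_ne_zero, wt_ne_top]
  have hg := one_le_gapConst l
  have h_const : bilinConst l * b ≠ ∞ := ENNReal.mul_ne_top (bilinConst_ne_top l) hb_top
  have hm : 0 < modeSq l i := by
    refine (modeSq_nonneg i).lt_of_ne fun h => ?_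
    rw [← h] at h_gap
    linarith
  have h_integrand : ∀ τ ∈ Ioc 0 t,
      ‖bilin l (z τ) (z τ) i‖ ≤ (bilinConst l * b).toReal * (1 + modeSq l i) ^ (1 / 2 : ℝ) := by
    refine fun τ hτ => norm_le_of_enorm_le_wt h_const ((enorm_bilin_le hl _ _ i).trans ?_)
    rw [mul_right_comm]
    gcongr
    exact hb τ hτ
  have h_norm : ‖∫ τ in (0 : ℝ)..t,
      Complex.exp ((t - τ : ℝ) * symbol l ν C₁ i) * bilin l (z τ) (z τ) i‖ ≤
      (bilinConst l * b).toReal * (gapConst l / ν) * (1 + modeSq l i) ^ (-(1 / 2) : ℝ) := by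
    refine (norm_duhamel_le (r := ν * modeSq l i) (μ := 0)
      (b := (bilinConst l * b).toReal * (1 + modeSq l i) ^ (1 / 2 : ℝ))
      ht (by positivity) (by positivity) (fun τ => norm_exp_mul_symbol ν C₁ (t - τ) i)
      (Eventually.of_forall fun τ hτ => ?_)).trans ?_
    · rw [zero_mul, Real.exp_zero, mul_one]
      exact h_integrand τ hτ
    rw [zero_mul, Real.exp_zero, mul_one, zero_add, mul_div_assoc, mul_assoc]
    gcongr
    exact one_add_rpow_half_div_le hν hm h_gap
  refine (enorm_le_wt_of_norm_le (by positivity) h_norm).trans_eq ?_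
  rw [ENNReal.ofReal_mul ENNReal.toReal_nonneg, ENNReal.ofReal_toReal h_const, duhamelConst]
  ring

theorem enorm_duhamel_le (hl : 0 < l) {ν C₁ : ℝ} (hν : 0 < ν) {c : ℂ} {z : ℝ → Mode → ℂ}
    {t : ℝ} (ht : 0 ≤ t) {i : Mode} {b : ℝ≥0∞}
    (hb : ∀ τ ∈ Ioc 0 t, majorant l (fun j => ‖z τ j‖ₑ) (fun j => ‖z τ j‖ₑ) i ≤ b) :
    ‖Complex.exp (t * symbol l ν C₁ i) * c +
      ∫ τ in (0 : ℝ)..t, Complex.exp ((t - τ : ℝ) * symbol l ν C₁ i) * bilin l (z τ) (z τ) i‖ₑ ≤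
    ‖c‖ₑ + duhamelConst l ν * (wt l i ^ (-(1 / 2) : ℝ) * b) := by
  refine (enorm_add_le _ _).trans
    (add_le_add ?_ (enorm_integral_exp_mul_bilin_le hl hν ht hb))
  rw [enorm_mul]
  refine mul_le_of_le_one_left' ?_
  rw [← ofReal_norm, ENNReal.ofReal_le_one]
  exact norm_exp_mul_symbol_le_one hν ht i

end Integrated

/-! ### Passage to the limit in approximations -/

section Limit

theorem cauchySeq_of_equicontinuous_of_dense {X E : Type*} [TopologicalSpace X]
    [PseudoMetricSpace E] {F : ℕ → X → E} (hF : Equicontinuous F) {D : Set X} (hD : Dense D)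
    (h : ∀ x ∈ D, CauchySeq fun n => F n x) (x : X) : CauchySeq fun n => F n x := by
  refine Metric.cauchySeq_iff.2 fun ε hε => ?_
  have h_near := Metric.equicontinuousAt_iff_right.1 (hF x) (ε / 3) (by positivity)
  obtain ⟨y, hyD, hxy⟩ := hD.inter_nhds_nonempty h_near
  obtain ⟨N, hN⟩ := Metric.cauchySeq_iff.1 (h y hyD) (ε / 3) (by positivity)
  refine ⟨N, fun m hm n hn => ?_⟩
  have h_tri := dist_triangle4 (F m x) (F m y) (F n y) (F n x)
  have h_xy : ∀ n, dist (F n x) (F n y) < ε / 3 := hxy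
  linarith [h_xy m, hN m hm n hn, dist_comm (F n y) (F n x), h_xy n]

theorem exists_subseq_tendsto {ι : Type*} [Countable ι] {Z : ι → ℝ} {L : ι → ℝ≥0}
    {z : ℕ → ℝ → ι → ℂ} (hz : ∀ N t i, ‖z N t i‖ ≤ Z i)
    (hL : ∀ N i, LipschitzWith (L i) fun t => z N t i) :
    ∃ φ : ℕ → ℕ, StrictMono φ ∧ ∃ w : ℝ → ι → ℂ,
      ∀ t i, Tendsto (fun N => z (φ N) t i) atTop (𝓝 (w t i)) := by
  have h_compact : IsCompact (Set.pi univ fun p : ι × ℚ => Metric.closedBall (0 : ℂ) (Z p.1)) :=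
    isCompact_univ_pi fun p => isCompact_closedBall 0 (Z p.1)
  obtain ⟨a, -, φ, hφ, ha⟩ := h_compact.tendsto_subseq (x := fun N p => z N p.2 p.1)
    (fun N p _ => by simpa using hz N p.2 p.1)
  rw [tendsto_pi_nhds] at ha
  have h_cauchy : ∀ t i, CauchySeq fun N => z (φ N) t i := fun t i => by
    refine cauchySeq_of_equicontinuous_of_dense (F := fun N t => z (φ N) t i)
      (LipschitzWith.uniformEquicontinuous _ (L i) fun N => hL (φ N) i).equicontinuous
      Rat.denseRange_cast ?_ t
    rintro _ ⟨q, rfl⟩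
    exact (ha (i, q)).cauchySeq
  choose w hw using fun t i => cauchySeq_tendsto_of_complete (h_cauchy t i)
  exact ⟨φ, hφ, w, hw⟩

theorem lt_top_of_l2Sq_lt_top {Z : Mode → ℝ≥0∞} (hZ : l2Sq Z < ∞) (i : Mode) : Z i < ∞ := by
  have h_le : Z i ^ 2 ≤ l2Sq Z := by
    rcases i with n | k
    · exact (ENNReal.le_tsum (f := fun n => Z (.inl n) ^ 2) n).trans le_self_add
    · exact (ENNReal.le_tsum (f := fun k => Z (.inr k) ^ 2) k).trans le_add_self
  exact (ENNReal.pow_lt_top_iff.1 (h_le.trans_lt hZ)).resolve_right two_ne_zero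

variable {l : ℝ}

theorem tendsto_integral_exp_mul_bilin (hl : 0 < l) {ν C₁ : ℝ} (hν : 0 < ν) {Z : Mode → ℝ≥0∞}
    (hZ : l2Sq Z < ∞) {z : ℕ → ℝ → Mode → ℂ} {w : ℝ → Mode → ℂ}
    (hz_cont : ∀ N i, Continuous fun t => z N t i) (hz : ∀ N t i, ‖z N t i‖ₑ ≤ Z i)
    (hw : ∀ t i, Tendsto (fun N => z N t i) atTop (𝓝 (w t i))) {t : ℝ} (ht : 0 ≤ t) (i : Mode) :
    Tendsto (fun N => ∫ τ in (0 : ℝ)..t,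
        Complex.exp ((t - τ : ℝ) * symbol l ν C₁ i) * bilin l (z N τ) (z N τ) i) atTop
      (𝓝 (∫ τ in (0 : ℝ)..t,
        Complex.exp ((t - τ : ℝ) * symbol l ν C₁ i) * bilin l (w τ) (w τ) i)) := by
  have h_exp : Continuous fun τ : ℝ => Complex.exp ((t - τ : ℝ) * symbol l ν C₁ i) := by fun_prop
  refine intervalIntegral.tendsto_integral_filter_of_dominated_convergence
    (fun _ => (l2BilinConst l (l2Sq Z)).toReal * (1 + modeSq l i) ^ (1 / 2 : ℝ))
    (Eventually.of_forall fun N => ?_) (Eventually.of_forall fun N => ?_)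
    intervalIntegrable_const (Eventually.of_forall fun τ _ => ?_)
  · exact (h_exp.mul (continuous_bilin hl hZ (hz_cont N) (hz N) i)).aestronglyMeasurable
  · refine Eventually.of_forall fun τ hτ => ?_
    rw [uIoc_of_le ht] at hτ
    rw [norm_mul]
    exact (mul_le_of_le_one_left (norm_nonneg _)
      (norm_exp_mul_symbol_le_one hν (sub_nonneg.2 hτ.2) i)).trans
      (norm_bilin_le hl hZ.ne (l2Sq_mono (hz N τ)) i)
  · exact tendsto_const_nhds.mul (tendsto_bilin hl hZ (hw τ) (fun N => hz N τ) i)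

theorem exists_duhamel_of_approx (hl : 0 < l) {ν C₁ : ℝ} (hν : 0 < ν) {z₀ : Mode → ℂ}
    {Z : Mode → ℝ≥0∞} (hZ : l2Sq Z < ∞) {z : ℕ → ℝ → Mode → ℂ} {L : Mode → ℝ≥0}
    (hz : ∀ N t i, ‖z N t i‖ₑ ≤ Z i) (hL : ∀ N i, LipschitzWith (L i) fun t => z N t i)
    (h_duhamel : ∀ i t, 0 ≤ t → ∀ᶠ N in atTop,
      z N t i = Complex.exp (t * symbol l ν C₁ i) * z₀ i +
        ∫ τ in (0 : ℝ)..t,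
          Complex.exp ((t - τ : ℝ) * symbol l ν C₁ i) * bilin l (z N τ) (z N τ) i) :
    ∃ φ : ℕ → ℕ, StrictMono φ ∧ ∃ w : ℝ → Mode → ℂ,
      (∀ t i, Tendsto (fun N => z (φ N) t i) atTop (𝓝 (w t i))) ∧
      (∀ i, Continuous fun t => w t i) ∧ (∀ t i, ‖w t i‖ₑ ≤ Z i) ∧
      ∀ t, 0 ≤ t → DuhamelModeAt l ν C₁ z₀ w t := by
  have hz_norm : ∀ N t i, ‖z N t i‖ ≤ (Z i).toReal := fun N t i => by
    simpa using ENNReal.toReal_mono (lt_top_of_l2Sq_lt_top hZ i).ne (hz N t i)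
  obtain ⟨φ, hφ, w, hw⟩ := exists_subseq_tendsto hz_norm hL
  have hw_cont : ∀ i, Continuous fun t => w t i := fun i =>
    (tendsto_pi_nhds.2 fun t => hw t i).continuous_of_equicontinuous
      (LipschitzWith.uniformEquicontinuous _ (L i) fun N => hL (φ N) i).equicontinuous
  have hw_le : ∀ t i, ‖w t i‖ₑ ≤ Z i := fun t i =>
    le_of_tendsto' ((continuous_enorm.tendsto _).comp (hw t i)) fun N => hz (φ N) t i
  refine ⟨φ, hφ, w, hw, hw_cont, hw_le, fun t ht i => ?_⟩
  have h_integral := tendsto_integral_exp_mul_bilin (C₁ := C₁) hl hν hZ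
    (fun N i => (hL (φ N) i).continuous) (fun N => hz (φ N)) hw ht i
  refine tendsto_nhds_unique (hw t i) ((h_integral.const_add _).congr' ?_)
  filter_upwards [hφ.tendsto_atTop.eventually (h_duhamel i t ht)] with N hN
  exact hN.symm

end Limit

/-! ### Cancellations for trigonometric polynomials -/

section Enstrophy

variable {l : ℝ}

/-- The frequencies of the mean flow kept in the truncation. -/
def box1 (N : ℕ) : Finset ℤ := Finset.Icc (-N : ℤ) N

/-- The frequencies of the eddies kept in the truncation. -/
def box2 (N : ℕ) : Finset (ℤ × ℤ) := box1 N ×ˢ box1 N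

theorem neg_mem_box1 {N : ℕ} {n : ℤ} : -n ∈ box1 N ↔ n ∈ box1 N := by
  simp only [box1, Finset.mem_Icc]; omega

theorem neg_mem_box2 {N : ℕ} {k : ℤ × ℤ} : -k ∈ box2 N ↔ k ∈ box2 N := by
  simp only [box2, Finset.mem_product, Prod.fst_neg, Prod.snd_neg, neg_mem_box1]

/-- Sequences supported in the truncation. -/
def SupportedInBox (N : ℕ) (z : Mode → ℂ) : Prop :=
  (∀ n ∉ box1 N, z (.inl n) = 0) ∧ ∀ k ∉ box2 N, z (.inr k) = 0

/-- The transport term before the zonal correction. -/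
def transport (l : ℝ) (N : ℕ) (z : Mode → ℂ) (k : ℤ × ℤ) : ℂ :=
  ∑ h ∈ box2 N, (eddyKernel l k h : ℂ) * (z (.inr h) * z (.inr (k - h))) -
    Complex.I * freq l k.1 * ∑ n ∈ box1 N, z (.inl n) * z (.inr (k - (0, n)))

theorem bilin_inr_eq {N : ℕ} {z : Mode → ℂ} (hz : SupportedInBox N z) (k : ℤ × ℤ) :
    bilin l z z (.inr k) = if k.1 = 0 then 0 else transport l N z k := by
  simp only [bilin, transport]
  rw [tsum_eq_sum (s := box2 N), tsum_eq_sum (s := box1 N)]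
  · intro n hn; rw [hz.1 n hn, zero_mul]
  · intro h hh; rw [hz.2 h hh, zero_mul, mul_zero]

theorem bilin_inl_eq {N : ℕ} {z : Mode → ℂ} (hz : SupportedInBox N z) (n : ℤ) :
    bilin l z z (.inl n) = -(Complex.I * freq l n) *
      ∑ h ∈ box2 N, (meanKernel l n h : ℂ) * (z (.inr h) * z (.inr ((0, n) - h))) := by
  simp only [bilin]
  rw [tsum_eq_sum (s := box2 N)]
  intro h hh; rw [hz.2 h hh, zero_mul, mul_zero]

theorem tsum_eq_zero_of_antisymm {f : ℤ × ℤ → ℂ} (h : ℤ × ℤ) (hf : ∀ k, f (h - k) = -f k) :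
    ∑' k, f k = 0 := by
  have h_neg := (Equiv.subLeft h).tsum_eq f
  simp only [Equiv.subLeft_apply, hf, tsum_neg] at h_neg
  exact self_eq_neg.1 h_neg.symm

-- The substitution `k ↦ h - k` exchanges the two factors of `z` and changes the sign of `c`.
theorem sum_mul_sub_mul_neg_eq_zero {N : ℕ} {z : Mode → ℂ} (hz : SupportedInBox N z)
    {h : ℤ × ℤ} {c : ℤ × ℤ → ℝ} (hc : ∀ k, c (h - k) = -c k) :
    ∑ k ∈ box2 N, (c k : ℂ) * (z (.inr (k - h)) * z (.inr (-k))) = 0 := by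
  rw [← tsum_eq_sum (L := SummationFilter.unconditional _) fun k hk => by
    rw [hz.2 (-k) (by rwa [neg_mem_box2]), mul_zero, mul_zero]]
  refine tsum_eq_zero_of_antisymm h fun k => ?_
  rw [sub_sub_cancel_left, neg_sub, hc, Complex.ofReal_neg]
  ring

theorem sum_eddyKernel_mul_eq_zero {N : ℕ} {z : Mode → ℂ} (hz : SupportedInBox N z) (h : ℤ × ℤ) :
    ∑ k ∈ box2 N, (eddyKernel l k h : ℂ) * (z (.inr (k - h)) * z (.inr (-k))) = 0 :=
  sum_mul_sub_mul_neg_eq_zero hz fun k => by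
    simp only [eddyKernel, Prod.fst_sub, Prod.snd_sub, freq_sub]; ring

theorem sum_freq_mul_eq_zero {N : ℕ} {z : Mode → ℂ} (hz : SupportedInBox N z) (n : ℤ) :
    ∑ k ∈ box2 N, (freq l k.1 : ℂ) * (z (.inr (k - (0, n))) * z (.inr (-k))) = 0 :=
  sum_mul_sub_mul_neg_eq_zero (c := fun k => freq l k.1) hz fun k => by simp [freq_neg]

theorem sum_conj_mul_transport_eq_zero {N : ℕ} {z : Mode → ℂ} (hz : SupportedInBox N z)
    (hherm : ∀ k, z (.inr (-k)) = conj (z (.inr k))) :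
    ∑ k ∈ box2 N, conj (z (.inr k)) * transport l N z k = 0 := by
  simp only [transport, mul_sub, Finset.sum_sub_distrib, ← hherm]
  have h_eddy : ∑ k ∈ box2 N, z (.inr (-k)) *
      ∑ h ∈ box2 N, (eddyKernel l k h : ℂ) * (z (.inr h) * z (.inr (k - h))) = 0 := by
    simp_rw [Finset.mul_sum]
    rw [Finset.sum_comm]
    refine Finset.sum_eq_zero fun h _ => ?_
    calc _ = z (.inr h) *
          ∑ k ∈ box2 N, (eddyKernel l k h : ℂ) * (z (.inr (k - h)) * z (.inr (-k))) := by
          rw [Finset.mul_sum]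
          exact Finset.sum_congr rfl fun k _ => by ring
      _ = 0 := by rw [sum_eddyKernel_mul_eq_zero hz, mul_zero]
  have h_mean : ∑ k ∈ box2 N, z (.inr (-k)) * (Complex.I * freq l k.1 *
      ∑ n ∈ box1 N, z (.inl n) * z (.inr (k - (0, n)))) = 0 := by
    simp_rw [Finset.mul_sum]
    rw [Finset.sum_comm]
    refine Finset.sum_eq_zero fun n _ => ?_
    calc _ = Complex.I * z (.inl n) *
          ∑ k ∈ box2 N, (freq l k.1 : ℂ) * (z (.inr (k - (0, n))) * z (.inr (-k))) := by
          rw [Finset.mul_sum]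
          exact Finset.sum_congr rfl fun k _ => by ring
      _ = 0 := by rw [sum_freq_mul_eq_zero hz, mul_zero]
  rw [h_eddy, h_mean, sub_zero]

/-- Enstrophy of the zonal part. -/
def zonalEnstrophy (N : ℕ) (z : Mode → ℂ) : ℝ :=
  ∑ k ∈ box2 N, if k.1 = 0 then ‖z (.inr k)‖ ^ 2 else 0

/-- Enstrophy of the eddies. -/
def eddyEnstrophy (N : ℕ) (z : Mode → ℂ) : ℝ :=
  ∑ k ∈ box2 N, if k.1 = 0 then 0 else ‖z (.inr k)‖ ^ 2

/-- Dissipation of the zonal part. -/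
def zonalGrad (l : ℝ) (N : ℕ) (z : Mode → ℂ) : ℝ :=
  ∑ k ∈ box2 N, if k.1 = 0 then freq l k.2 ^ 2 * ‖z (.inr k)‖ ^ 2 else 0

theorem tsum_zonal_eq (g : ℤ × ℤ → ℝ≥0∞) :
    ∑' n, g (0, n) = ∑' k : ℤ × ℤ, if k.1 = 0 then g k else 0 := by
  have hinj : Function.Injective (fun n : ℤ => ((0 : ℤ), n)) := Prod.mk_right_injective 0
  rw [← hinj.tsum_eq]
  · simp
  · intro k hk
    refine ⟨k.2, Prod.ext ?_ rfl⟩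
    by_contra hne
    exact hk (if_neg (Ne.symm hne))

theorem tsum_sq_zonal_sub_le (η : ℤ × ℤ → ℝ≥0∞) :
    ∑' h, wt2 l h ^ (-1 : ℝ) * ∑' n, η ((0, n) - h) ^ 2 ≤ latticeSum1 l 1 * ∑' k, η k ^ 2 := by
  have h_shift (h : ℤ × ℤ) : ∑' n, η ((0, n) - h) ^ 2 = ∑' n, η (-h.1, n) ^ 2 := by
    rw [← (Equiv.subRight h.2).tsum_eq (fun n => η (-h.1, n) ^ 2)]
    refine tsum_congr fun n => ?_
    congr 2
    ext <;> simp
  have h_neg := (Equiv.neg ℤ).tsum_eq (fun j => ∑' n, η (j, n) ^ 2)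
  simp only [Equiv.neg_apply] at h_neg
  calc _ ≤ ∑' h : ℤ × ℤ, (∑' n, η (-h.1, n) ^ 2) * wt1 l h.2 ^ (-1 : ℝ) := by
        refine ENNReal.tsum_le_tsum fun h => ?_
        rw [h_shift, mul_comm]
        exact mul_le_mul' le_rfl (rpow_neg_le_rpow_neg zero_le_one (wt1_snd_le l h))
    _ = _ := by
        rw [tsum_prod_mul (fun j => ∑' n, η (-j, n) ^ 2) (fun n => wt1 l n ^ (-1 : ℝ)), h_neg,
          ← ENNReal.tsum_prod (f := fun j n => η (j, n) ^ 2), latticeSum1, mul_comm]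

theorem sq_tsum_zonal_mul_conv_le (a : ℤ → ℝ≥0∞) (η : ℤ × ℤ → ℝ≥0∞) :
    (∑' n, a n * ∑' h, η h * wt2 l h ^ (-(1 / 2) : ℝ) * η ((0, n) - h)) ^ 2 ≤
      (∑' n, a n ^ 2) * (latticeSum1 l 1 * (∑' k, η k ^ 2) ^ 2) := by
  refine (sq_tsum_mul_le _ _).trans (mul_le_mul' le_rfl ?_)
  calc ∑' n, (∑' h, η h * wt2 l h ^ (-(1 / 2) : ℝ) * η ((0, n) - h)) ^ 2
      ≤ ∑' n, (∑' k, η k ^ 2) * ∑' h, wt2 l h ^ (-1 : ℝ) * η ((0, n) - h) ^ 2 :=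
        ENNReal.tsum_le_tsum fun n => sq_conv_le_weight_right l η η (0, n)
    _ = (∑' k, η k ^ 2) * ∑' h, wt2 l h ^ (-1 : ℝ) * ∑' n, η ((0, n) - h) ^ 2 := by
        rw [ENNReal.tsum_mul_left, ENNReal.tsum_comm]
        simp_rw [ENNReal.tsum_mul_left]
    _ ≤ (∑' k, η k ^ 2) * (latticeSum1 l 1 * ∑' k, η k ^ 2) :=
        mul_le_mul' le_rfl (tsum_sq_zonal_sub_le η)
    _ = _ := by ring

theorem tsum_ofReal_eq_ofReal_sum {s : Finset (ℤ × ℤ)} {f : ℤ × ℤ → ℝ} (hf : ∀ k, 0 ≤ f k)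
    (hs : ∀ k ∉ s, f k = 0) : ∑' k, ENNReal.ofReal (f k) = ENNReal.ofReal (∑ k ∈ s, f k) := by
  rw [tsum_eq_sum (s := s) fun k hk => by rw [hs k hk, ENNReal.ofReal_zero],
    ENNReal.ofReal_sum_of_nonneg fun k _ => hf k]

/-- The constant in the enstrophy estimate. -/
def enstrophyConst (l : ℝ) : ℝ := gapConst l * (latticeSum1 l 1).toReal ^ (1 / 2 : ℝ)

theorem zonalGrad_nonneg (N : ℕ) (z : Mode → ℂ) : 0 ≤ zonalGrad l N z :=
  Finset.sum_nonneg fun k _ => by split_ifs <;> positivity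

theorem eddyEnstrophy_nonneg (N : ℕ) (z : Mode → ℂ) : 0 ≤ eddyEnstrophy N z :=
  Finset.sum_nonneg fun k _ => by split_ifs <;> positivity

theorem zonalEnstrophy_nonneg (N : ℕ) (z : Mode → ℂ) : 0 ≤ zonalEnstrophy N z :=
  Finset.sum_nonneg fun k _ => by split_ifs <;> positivity

theorem enorm_freq_div_freqSq_le (hl : 0 < l) {h : ℤ × ℤ} (hh : h ≠ 0) :
    ‖((freq l h.1 / freqSq l h : ℝ) : ℂ)‖ₑ ≤
      ENNReal.ofReal (gapConst l) * wt2 l h ^ (-(1 / 2) : ℝ) := by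
  have hg := one_le_gapConst l
  have hp := freqSq_pos hl hh
  have h_gap := one_add_freqSq_le hl hh
  have h_fst : freq l h.1 ^ 2 ≤ freqSq l h := le_add_of_nonneg_right (sq_nonneg _)
  have h_zero : wt2 l 0 = 1 := by simp [wt2, freqSq_zero]
  have h_bound := enorm_ofReal_le_wt2 (l := l) (x := freq l h.1 / freqSq l h) (c := gapConst l)
    (by positivity) (k := 0) (h := h)
  rw [h_zero, ENNReal.one_rpow, mul_one] at h_bound
  refine h_bound ?_
  rw [freqSq_zero, div_pow, div_mul_eq_mul_div, div_le_iff₀ (by positivity)]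
  calc freq l h.1 ^ 2 * (1 + freqSq l h) ≤ freqSq l h * (gapConst l * freqSq l h) := by gcongr
    _ = gapConst l * freqSq l h ^ 2 := by ring
    _ ≤ gapConst l ^ 2 * freqSq l h ^ 2 := by gcongr; exact le_self_pow₀ hg (by norm_num)
    _ = _ := by ring

theorem enorm_eddyKernel_zonal_le (hl : 0 < l) (n : ℤ) (h : ℤ × ℤ) :
    ‖(eddyKernel l (0, n) h : ℂ)‖ₑ ≤ ‖freq l n‖ₑ * (if h.1 = 0 then 0 else
      ENNReal.ofReal (gapConst l) * wt2 l h ^ (-(1 / 2) : ℝ)) := by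
  have h_kernel : (eddyKernel l (0, n) h : ℂ) =
      -(freq l n : ℂ) * ((freq l h.1 / freqSq l h : ℝ) : ℂ) := by
    simp only [eddyKernel, freq_zero]; push_cast; ring
  have h_freq : ‖(freq l n : ℂ)‖ₑ = ‖freq l n‖ₑ := by
    rw [← ofReal_norm, ← ofReal_norm, Complex.norm_real]
  rw [h_kernel, enorm_mul, enorm_neg, h_freq]
  gcongr
  split_ifs with h_zonal
  · simp [h_zonal, freq_zero]
  · exact enorm_freq_div_freqSq_le hl fun h_zero => h_zonal (by simp [h_zero])

/-- The moduli of the Fourier coefficients of the `y`-derivative of the zonal part. -/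
def zonalGradSeq (l : ℝ) (z : Mode → ℂ) (n : ℤ) : ℝ≥0∞ := ‖z (.inr (0, n))‖ₑ * ‖freq l n‖ₑ

/-- The moduli of the Fourier coefficients of the eddies, extended by zero to the zonal modes. -/
def eddySeq (z : Mode → ℂ) (k : ℤ × ℤ) : ℝ≥0∞ := if k.1 = 0 then 0 else ‖z (.inr k)‖ₑ

theorem tsum_sq_zonalGradSeq {N : ℕ} {z : Mode → ℂ} (hz : SupportedInBox N z) :
    ∑' n, zonalGradSeq l z n ^ 2 = ENNReal.ofReal (zonalGrad l N z) := by
  rw [zonalGrad, ← tsum_ofReal_eq_ofReal_sum]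
  · calc ∑' n, zonalGradSeq l z n ^ 2 = ∑' n, (fun k : ℤ × ℤ =>
          ENNReal.ofReal (freq l k.2 ^ 2 * ‖z (.inr k)‖ ^ 2)) (0, n) := by
          refine tsum_congr fun n => ?_
          rw [zonalGradSeq, ← ofReal_norm, ← ofReal_norm, ← ENNReal.ofReal_mul (norm_nonneg _),
            ← ENNReal.ofReal_pow (by positivity), mul_pow, Real.norm_eq_abs, sq_abs, mul_comm]
      _ = _ := by
          rw [tsum_zonal_eq fun k : ℤ × ℤ =>
            ENNReal.ofReal (freq l k.2 ^ 2 * ‖z (.inr k)‖ ^ 2)]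
          refine tsum_congr fun k => ?_
          split_ifs <;> simp
  · intro k; split_ifs <;> positivity
  · intro k hk; rw [hz.2 k hk]; simp

theorem tsum_sq_eddySeq {N : ℕ} {z : Mode → ℂ} (hz : SupportedInBox N z) :
    ∑' k, eddySeq z k ^ 2 = ENNReal.ofReal (eddyEnstrophy N z) := by
  rw [eddyEnstrophy, ← tsum_ofReal_eq_ofReal_sum]
  · refine tsum_congr fun k => ?_
    rw [eddySeq]
    split_ifs
    · simp
    · rw [← ofReal_norm, ENNReal.ofReal_pow (norm_nonneg _)]
  · intro k; split_ifs <;> positivity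
  · intro k hk; rw [hz.2 k hk]; simp

theorem enorm_transport_zonal_le (hl : 0 < l) (N : ℕ) (z : Mode → ℂ) (n : ℤ) :
    ‖transport l N z (0, n)‖ₑ ≤ ENNReal.ofReal (gapConst l) * ‖freq l n‖ₑ *
      ∑' h, eddySeq z h * wt2 l h ^ (-(1 / 2) : ℝ) * eddySeq z ((0, n) - h) := by
  simp only [transport, freq_zero, Complex.ofReal_zero, mul_zero, zero_mul, sub_zero]
  calc _ ≤ ∑ h ∈ box2 N, ‖(eddyKernel l (0, n) h : ℂ) * (z (.inr h) * z (.inr ((0, n) - h)))‖ₑ :=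
        enorm_sum_le _ _
    _ ≤ ∑ h ∈ box2 N, ENNReal.ofReal (gapConst l) * ‖freq l n‖ₑ *
        (eddySeq z h * wt2 l h ^ (-(1 / 2) : ℝ) * eddySeq z ((0, n) - h)) := by
        refine Finset.sum_le_sum fun h _ => ?_
        rw [enorm_mul, enorm_mul]
        refine (mul_le_mul' (enorm_eddyKernel_zonal_le hl n h) le_rfl).trans ?_
        by_cases h_zonal : h.1 = 0
        · simp [h_zonal]
        · have h_sub : ((0, n) - h).1 ≠ 0 := by simpa using h_zonal
          simp only [eddySeq, if_neg h_zonal, if_neg h_sub]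
          exact le_of_eq (by ring)
    _ ≤ _ := by
        rw [← Finset.mul_sum]
        gcongr
        exact ENNReal.sum_le_tsum _

theorem sum_conj_mul_bilin_eq_neg_zonal {N : ℕ} {z : Mode → ℂ} (hz : SupportedInBox N z)
    (hherm : ∀ k, z (.inr (-k)) = conj (z (.inr k))) :
    ∑ k ∈ box2 N, conj (z (.inr k)) * bilin l z z (.inr k) =
      -∑ k ∈ box2 N, if k.1 = 0 then conj (z (.inr k)) * transport l N z k else 0 := by
  rw [eq_neg_iff_add_eq_zero, ← Finset.sum_add_distrib]
  refine Eq.trans ?_ (sum_conj_mul_transport_eq_zero (l := l) hz hherm)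
  refine Finset.sum_congr rfl fun k _ => ?_
  rw [bilin_inr_eq hz]
  split_ifs <;> simp

theorem enorm_sum_conj_mul_bilin_le (hl : 0 < l) {N : ℕ} {z : Mode → ℂ}
    (hz : SupportedInBox N z) (hherm : ∀ k, z (.inr (-k)) = conj (z (.inr k))) :
    ‖∑ k ∈ box2 N, conj (z (.inr k)) * bilin l z z (.inr k)‖ₑ ≤ ENNReal.ofReal (gapConst l) *
      ∑' n, zonalGradSeq l z n *
        ∑' h, eddySeq z h * wt2 l h ^ (-(1 / 2) : ℝ) * eddySeq z ((0, n) - h) := by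
  rw [sum_conj_mul_bilin_eq_neg_zonal hz hherm, enorm_neg]
  calc _ ≤ ∑ k ∈ box2 N,
        ‖if k.1 = 0 then conj (z (.inr k)) * transport l N z k else 0‖ₑ := enorm_sum_le _ _
    _ ≤ ∑' k : ℤ × ℤ, if k.1 = 0 then ‖conj (z (.inr k)) * transport l N z k‖ₑ else 0 := by
        refine (ENNReal.sum_le_tsum _).trans (le_of_eq (tsum_congr fun k => ?_))
        split_ifs <;> simp
    _ = ∑' n, ‖conj (z (.inr (0, n))) * transport l N z (0, n)‖ₑ :=
        (tsum_zonal_eq fun k => ‖conj (z (.inr k)) * transport l N z k‖ₑ).symm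
    _ ≤ ∑' n, ENNReal.ofReal (gapConst l) * (zonalGradSeq l z n *
        ∑' h, eddySeq z h * wt2 l h ^ (-(1 / 2) : ℝ) * eddySeq z ((0, n) - h)) := by
        refine ENNReal.tsum_le_tsum fun n => ?_
        rw [enorm_mul, RCLike.enorm_conj]
        refine (mul_le_mul' le_rfl (enorm_transport_zonal_le hl N z n)).trans (le_of_eq ?_)
        rw [zonalGradSeq]
        ring
    _ = _ := ENNReal.tsum_mul_left

theorem norm_sum_conj_mul_bilin_le (hl : 0 < l) {N : ℕ} {z : Mode → ℂ}
    (hz : SupportedInBox N z) (hherm : ∀ k, z (.inr (-k)) = conj (z (.inr k))) :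
    ‖∑ k ∈ box2 N, conj (z (.inr k)) * bilin l z z (.inr k)‖ ≤
      enstrophyConst l * Real.sqrt (zonalGrad l N z) * eddyEnstrophy N z := by
  have h_sum := (latticeSum1_lt_top hl (p := 1) (by norm_num)).ne
  have hg := one_le_gapConst l
  have h_eddy := eddyEnstrophy_nonneg N z
  have h_root : ((latticeSum1 l 1).toReal ^ (1 / 2 : ℝ)) ^ 2 = (latticeSum1 l 1).toReal := by
    rw [← Real.rpow_natCast, ← Real.rpow_mul ENNReal.toReal_nonneg]; norm_num
  have h_nonneg : 0 ≤ enstrophyConst l * Real.sqrt (zonalGrad l N z) * eddyEnstrophy N z := by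
    unfold enstrophyConst
    positivity
  refine le_of_sq_le_sq ?_ h_nonneg
  rw [← ENNReal.ofReal_le_ofReal_iff (by positivity), ENNReal.ofReal_pow (norm_nonneg _),
    ofReal_norm]
  calc _ ≤ (ENNReal.ofReal (gapConst l) * ∑' n, zonalGradSeq l z n *
        ∑' h, eddySeq z h * wt2 l h ^ (-(1 / 2) : ℝ) * eddySeq z ((0, n) - h)) ^ 2 := by
        gcongr
        exact enorm_sum_conj_mul_bilin_le hl hz hherm
    _ ≤ ENNReal.ofReal (gapConst l) ^ 2 * ((∑' n, zonalGradSeq l z n ^ 2) *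
        (latticeSum1 l 1 * (∑' k, eddySeq z k ^ 2) ^ 2)) := by
        rw [mul_pow]
        gcongr
        exact sq_tsum_zonal_mul_conv_le _ _
    _ = _ := by
        rw [tsum_sq_zonalGradSeq hz, tsum_sq_eddySeq hz, ← ENNReal.ofReal_toReal h_sum,
          ← ENNReal.ofReal_pow (by positivity), ← ENNReal.ofReal_pow h_eddy,
          ← ENNReal.ofReal_mul ENNReal.toReal_nonneg,
          ← ENNReal.ofReal_mul (zonalGrad_nonneg _ _), ← ENNReal.ofReal_mul (by positivity),
          enstrophyConst, mul_pow, mul_pow, mul_pow, h_root, Real.sq_sqrt (zonalGrad_nonneg _ _)]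
        congr 1
        ring

-- Transport conserves the enstrophy; subtracting its zonal average is the only source of eddy
-- enstrophy, which is why a zonal factor can be extracted.
theorem abs_sum_re_conj_mul_bilin_le (hl : 0 < l) {N : ℕ} {z : Mode → ℂ} (hz : SupportedInBox N z)
    (hherm : ∀ k, z (.inr (-k)) = conj (z (.inr k))) :
    |∑ k ∈ box2 N, (conj (z (.inr k)) * bilin l z z (.inr k)).re| ≤
      enstrophyConst l * Real.sqrt (zonalGrad l N z) * eddyEnstrophy N z := by
  rw [← Complex.re_sum]
  exact (Complex.abs_re_le_norm _).trans (norm_sum_conj_mul_bilin_le hl hz hherm)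

end Enstrophy

/-! ### Ordinary differential equations with a cutoff -/

section CutoffODE

variable {ι : Type*} [Fintype ι]

/-- A smooth cutoff which is one where the energy is at most `R`. -/
def cutoff (R : ℝ) (y : ι → ℂ) : ℝ := Real.smoothTransition (R + 1 - ∑ i, ‖y i‖ ^ 2)

theorem cutoff_nonneg (R : ℝ) (y : ι → ℂ) : 0 ≤ cutoff R y := Real.smoothTransition.nonneg _

theorem cutoff_le_one (R : ℝ) (y : ι → ℂ) : cutoff R y ≤ 1 := Real.smoothTransition.le_one _

theorem cutoff_eq_one {R : ℝ} {y : ι → ℂ} (h : ∑ i, ‖y i‖ ^ 2 ≤ R) : cutoff R y = 1 :=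
  Real.smoothTransition.one_of_one_le (by linarith)

theorem contDiff_cutoff (R : ℝ) : ContDiff ℝ 1 (cutoff R : (ι → ℂ) → ℝ) := by
  refine Real.smoothTransition.contDiff.comp (contDiff_const.sub (ContDiff.sum fun i _ => ?_))
  exact (contDiff_apply ℝ ℂ i).norm_sq ℝ

theorem hasCompactSupport_cutoff_smul (R : ℝ) (f : (ι → ℂ) → (ι → ℂ)) :
    HasCompactSupport fun y => cutoff R y • f y := by
  refine HasCompactSupport.intro (isCompact_closedBall (0 : ι → ℂ) (Real.sqrt (R + 1)))
    fun y hy => ?_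
  suffices h : cutoff R y = 0 by rw [h, zero_smul]
  apply Real.smoothTransition.zero_of_nonpos
  by_contra! h_pos
  refine hy ?_
  rw [mem_closedBall_zero_iff, pi_norm_le_iff_of_nonneg (Real.sqrt_nonneg _)]
  refine fun i => Real.le_sqrt_of_sq_le ?_
  have h_term : ‖y i‖ ^ 2 ≤ ∑ i, ‖y i‖ ^ 2 :=
    Finset.single_le_sum (f := fun i => ‖y i‖ ^ 2) (fun i _ => by positivity) (Finset.mem_univ i)
  linarith

theorem exists_hasDerivWithinAt_of_lipschitz {E : Type*} [NormedAddCommGroup E] [NormedSpace ℝ E]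
    [CompleteSpace E] {g : E → E} {K : ℝ≥0} (hK : LipschitzWith K g) {B : ℝ}
    (hB : ∀ y, ‖g y‖ ≤ B) {T : ℝ} (hT : 0 ≤ T) (x₀ : E) :
    ∃ x : ℝ → E, x 0 = x₀ ∧ ∀ t ∈ Icc 0 T, HasDerivWithinAt x (g (x t)) (Icc 0 T) t := by
  let L : ℝ≥0 := ⟨B, (norm_nonneg _).trans (hB 0)⟩
  have h_picard : IsPicardLindelof (fun _ => g) (⟨0, ⟨le_rfl, hT⟩⟩ : Icc (0 : ℝ) T) x₀
      (L * ⟨T, hT⟩) 0 L K :=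
    IsPicardLindelof.of_time_independent (fun x _ => hB x) hK.lipschitzOnWith (by
      simp only [sub_zero, sub_self, max_eq_left hT, NNReal.coe_zero]
      exact le_rfl)
  exact h_picard.exists_eq_forall_mem_Icc_hasDerivWithinAt₀

theorem apply_eq_of_hasDerivWithinAt_of_equivariant {E : Type*} [NormedAddCommGroup E]
    [NormedSpace ℝ E] {g : E → E} {K : ℝ≥0} (hK : LipschitzWith K g) {x : ℝ → E} {T : ℝ}
    (hx : ∀ t ∈ Icc 0 T, HasDerivWithinAt x (g (x t)) (Icc 0 T) t) {σ : E →L[ℝ] E}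
    (hσ : ∀ y, g (σ y) = σ (g y)) (h_zero : σ (x 0) = x 0) :
    ∀ t ∈ Icc 0 T, σ (x t) = x t := by
  have h_cont : ContinuousOn x (Icc 0 T) := fun t ht => (hx t ht).continuousWithinAt
  have h_right : ∀ t ∈ Ico 0 T, HasDerivWithinAt x (g (x t)) (Ici t) t := fun t ht =>
    (hx t (Ico_subset_Icc_self ht)).mono_of_mem_nhdsWithin (Icc_mem_nhdsGE_of_mem ht)
  refine ODE_solution_unique (v := fun _ => g) (K := K) (fun _ => hK)
    (σ.continuous.comp_continuousOn h_cont) (fun t ht => ?_) h_cont h_right h_zero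
  simp only [hσ]
  exact σ.hasFDerivAt.comp_hasDerivWithinAt t (h_right t ht)

theorem exists_cutoff_solution {f : (ι → ℂ) → (ι → ℂ)} (hf : ContDiff ℝ 1 f) (R : ℝ) {T : ℝ}
    (hT : 0 ≤ T) (x₀ : ι → ℂ) :
    ∃ x : ℝ → ι → ℂ, x 0 = x₀ ∧
      (∀ t ∈ Icc 0 T, HasDerivWithinAt x (cutoff R (x t) • f (x t)) (Icc 0 T) t) ∧
      ∀ σ : (ι → ℂ) →L[ℝ] (ι → ℂ), (∀ y, ∑ i, ‖σ y i‖ ^ 2 = ∑ i, ‖y i‖ ^ 2) →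
        (∀ y, f (σ y) = σ (f y)) → σ x₀ = x₀ → ∀ t ∈ Icc 0 T, σ (x t) = x t := by
  have h_smooth : ContDiff ℝ 1 fun y => cutoff R y • f y := (contDiff_cutoff R).smul hf
  have h_supp := hasCompactSupport_cutoff_smul R f
  obtain ⟨K, hK⟩ := ContDiff.lipschitzWith_of_hasCompactSupport h_supp h_smooth one_ne_zero
  obtain ⟨B, hB⟩ := h_supp.exists_bound_of_continuous h_smooth.continuous
  obtain ⟨x, rfl, hx⟩ := exists_hasDerivWithinAt_of_lipschitz hK hB hT x₀
  exact ⟨x, rfl, hx, fun σ h_isom h_equiv h_zero =>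
    apply_eq_of_hasDerivWithinAt_of_equivariant hK hx
      (fun y => by simp only [cutoff, h_isom, h_equiv, map_smul]) h_zero⟩

end CutoffODE

/-! ### Reflection symmetry -/

section Reflection

variable {l : ℝ}

/-- The opposite frequency. -/
def negMode : Mode → Mode := Sum.map Neg.neg Neg.neg

/-- Complex conjugation in physical space. -/
def reflect (z : Mode → ℂ) : Mode → ℂ := fun i => conj (z (negMode i))

theorem negMode_negMode (i : Mode) : negMode (negMode i) = i := by
  rcases i with n | k <;> simp [negMode]

theorem apply_inl_neg_of_reflect_eq {z : Mode → ℂ} (hz : reflect z = z) (n : ℤ) :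
    z (.inl (-n)) = conj (z (.inl n)) := by
  rw [← congrFun hz (.inl (-n)), reflect, negMode, Sum.map_inl, neg_neg]

theorem apply_inr_neg_of_reflect_eq {z : Mode → ℂ} (hz : reflect z = z) (k : ℤ × ℤ) :
    z (.inr (-k)) = conj (z (.inr k)) := by
  rw [← congrFun hz (.inr (-k)), reflect, negMode, Sum.map_inr, neg_neg]

theorem symbol_negMode (ν C₁ : ℝ) (i : Mode) :
    symbol l ν C₁ (negMode i) = conj (symbol l ν C₁ i) := by
  rcases i with n | k
  · simp [symbol, negMode, freq_neg]
  · simp only [symbol, negMode, Sum.map_inr, Sum.elim_inr, symbol2, dx, invLap_eq]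
    simp [freqSq, freq_neg, sub_eq_add_neg]

theorem eddyKernel_neg_neg (k h : ℤ × ℤ) : eddyKernel l (-k) (-h) = eddyKernel l k h := by
  simp [eddyKernel, freqSq, freq_neg]

theorem meanKernel_neg_neg (n : ℤ) (h : ℤ × ℤ) : meanKernel l (-n) (-h) = meanKernel l n h := by
  simp only [meanKernel, freqSq, Prod.fst_neg, Prod.snd_neg, Prod.fst_sub, Prod.snd_sub, freq_neg,
    freq_sub, freq_zero]
  ring

theorem zero_prod_neg (n : ℤ) : ((0, -n) : ℤ × ℤ) = -(0, n) := by simp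

theorem bilin_reflect_inl (z : Mode → ℂ) (n : ℤ) :
    bilin l (reflect z) (reflect z) (.inl n) = conj (bilin l z z (.inl (-n))) := by
  simp only [bilin, reflect, negMode, Sum.map_inr, map_mul, map_neg, Complex.conj_tsum,
    Complex.conj_I, Complex.conj_ofReal, freq_neg]
  rw [← (Equiv.neg (ℤ × ℤ)).tsum_eq (fun h => (meanKernel l (-n) h : ℂ) *
    (conj (z (.inr h)) * conj (z (.inr ((0, -n) - h)))))]
  congr 1
  · push_cast; ring
  · refine tsum_congr fun h => ?_
    rw [Equiv.neg_apply, meanKernel_neg_neg, zero_prod_neg, neg_sub_neg, neg_sub]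

theorem bilin_reflect_inr (z : Mode → ℂ) (k : ℤ × ℤ) :
    bilin l (reflect z) (reflect z) (.inr k) = conj (bilin l z z (.inr (-k))) := by
  simp only [bilin, reflect, negMode, Sum.map_inl, Sum.map_inr, Prod.fst_neg, neg_eq_zero]
  split_ifs
  · simp
  simp only [map_sub, map_mul, Complex.conj_tsum, Complex.conj_I, Complex.conj_ofReal, freq_neg]
  rw [← (Equiv.neg (ℤ × ℤ)).tsum_eq (fun h => (eddyKernel l (-k) h : ℂ) *
    (conj (z (.inr h)) * conj (z (.inr (-k - h))))),
    ← (Equiv.neg ℤ).tsum_eq (fun n => conj (z (.inl n)) * conj (z (.inr (-k - (0, n)))))]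
  congr 1
  · refine tsum_congr fun h => ?_
    rw [Equiv.neg_apply, eddyKernel_neg_neg, neg_sub_neg, neg_sub]
  · congr 1
    · push_cast; ring
    · refine tsum_congr fun n => ?_
      rw [Equiv.neg_apply, zero_prod_neg, neg_sub_neg, neg_sub]

theorem bilin_reflect (z : Mode → ℂ) (i : Mode) :
    bilin l (reflect z) (reflect z) i = conj (bilin l z z (negMode i)) := by
  rcases i with n | k
  · exact bilin_reflect_inl z n
  · exact bilin_reflect_inr z k

end Reflection

/-! ### The Duhamel formula of an ordinary differential equation -/

section DuhamelODE

theorem duhamel_of_hasDerivWithinAt {T : ℝ} {y g : ℝ → ℂ} {a : ℂ}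
    (hg : ContinuousOn g (Icc 0 T))
    (hy : ∀ t ∈ Icc 0 T, HasDerivWithinAt y (a * y t + g t) (Icc 0 T) t) {t : ℝ}
    (ht : t ∈ Icc 0 T) :
    y t = Complex.exp (t * a) * y 0 +
      ∫ τ in (0 : ℝ)..t, Complex.exp ((t - τ : ℝ) * a) * g τ := by
  have h_exp (τ : ℝ) : HasDerivAt (fun τ : ℝ => Complex.exp ((t - τ : ℝ) * a))
      (-(a * Complex.exp ((t - τ : ℝ) * a))) τ := by
    have h_lin : HasDerivAt (fun τ : ℝ => ((t - τ : ℝ) : ℂ) * a) (-a) τ := by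
      simpa using ((hasDerivAt_id τ).const_sub t).ofReal_comp.mul_const a
    exact h_lin.cexp.congr_deriv (by ring)
  have h_exp_cont : Continuous fun τ : ℝ => Complex.exp ((t - τ : ℝ) * a) := by fun_prop
  have hsub : Icc 0 t ⊆ Icc 0 T := Icc_subset_Icc le_rfl ht.2
  have hyc : ContinuousOn y (Icc 0 T) := fun s hs => (hy s hs).continuousWithinAt
  have hftc := intervalIntegral.integral_eq_sub_of_hasDerivAt_of_le ht.1
    (f := fun τ => Complex.exp ((t - τ : ℝ) * a) * y τ)
    (f' := fun τ => Complex.exp ((t - τ : ℝ) * a) * g τ)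
    (h_exp_cont.continuousOn.mul (hyc.mono hsub)) (fun τ hτ => ?_)
    ((h_exp_cont.continuousOn.mul (hg.mono hsub)).intervalIntegrable_of_Icc ht.1)
  · rw [hftc]
    simp
  · have h_deriv := (hy τ ⟨hτ.1.le, hτ.2.le.trans ht.2⟩).hasDerivAt
      (Icc_mem_nhds hτ.1 (hτ.2.trans_le ht.2))
    exact ((h_exp τ).mul h_deriv).congr_deriv (by ring)

end DuhamelODE

/-! ### Differential inequalities -/

section DifferentialInequality

theorem antitoneOn_Icc_of_hasDerivWithinAt {T : ℝ} {f f' : ℝ → ℝ}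
    (hf : ∀ t ∈ Icc 0 T, HasDerivWithinAt f (f' t) (Icc 0 T) t) (hf' : ∀ t ∈ Icc 0 T, f' t ≤ 0) :
    AntitoneOn f (Icc 0 T) :=
  antitoneOn_of_hasDerivWithinAt_nonpos (convex_Icc 0 T)
    (fun t ht => (hf t ht).continuousWithinAt)
    (fun t ht => (hf t (interior_subset ht)).mono interior_subset)
    fun t ht => hf' t (interior_subset ht)

/-- The rate at which `exp (g * E₁)` absorbs the production of `E₂`: the least `g` for which the
quadratic `ν * c + ν * g * x ^ 2 - C * x` is nonnegative. -/
def absorptionRate (ν c C : ℝ) : ℝ := C ^ 2 / (4 * ν ^ 2 * c)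

theorem absorptionRate_nonneg {ν c : ℝ} (hc : 0 ≤ c) (C : ℝ) : 0 ≤ absorptionRate ν c C := by
  unfold absorptionRate
  positivity

theorem quadratic_absorptionRate_nonneg {ν c : ℝ} (hν : 0 < ν) (hc : 0 < c) (C x : ℝ) :
    0 ≤ ν * c + ν * absorptionRate ν c C * x ^ 2 - C * x := by
  have h_sq : ν * c + ν * absorptionRate ν c C * x ^ 2 - C * x =
      ν * c * (1 - C * x / (2 * ν * c)) ^ 2 := by
    rw [absorptionRate]
    field_simp
    ring
  rw [h_sq]
  positivity

-- The function `E₂ * exp (g * E₁)` is nonincreasing.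
theorem add_le_of_enstrophy_inequalities {T ν c C : ℝ} (hν : 0 < ν) (hc : 0 < c)
    {E₁ E₂ E₁' E₂' G θ : ℝ → ℝ}
    (h₁ : ∀ t ∈ Icc 0 T, HasDerivWithinAt E₁ (E₁' t) (Icc 0 T) t)
    (h₂ : ∀ t ∈ Icc 0 T, HasDerivWithinAt E₂ (E₂' t) (Icc 0 T) t)
    (hE₁ : ∀ t, 0 ≤ E₁ t) (hE₂ : ∀ t, 0 ≤ E₂ t) (hG : ∀ t, 0 ≤ G t) (hθ : ∀ t, 0 ≤ θ t)
    (h₁' : ∀ t ∈ Icc 0 T, E₁' t ≤ θ t * (-(2 * ν * G t)))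
    (h₂' : ∀ t ∈ Icc 0 T, E₂' t ≤ θ t * (-(2 * ν * c * E₂ t) + 2 * (C * √(G t) * E₂ t)))
    {t : ℝ} (ht : t ∈ Icc 0 T) :
    E₁ t + E₂ t ≤ E₁ 0 + E₂ 0 * Real.exp (absorptionRate ν c C * E₁ 0) := by
  set g := absorptionRate ν c C with hg
  have hg_nonneg : 0 ≤ g := absorptionRate_nonneg hc.le C
  have h_zero : (0 : ℝ) ∈ Icc 0 T := ⟨le_rfl, ht.1.trans ht.2⟩
  have h_anti₁ : AntitoneOn E₁ (Icc 0 T) := antitoneOn_Icc_of_hasDerivWithinAt h₁ fun t ht =>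
    (h₁' t ht).trans (mul_nonpos_of_nonneg_of_nonpos (hθ t)
      (neg_nonpos.2 (mul_nonneg (by positivity) (hG t))))
  have h_anti₂ : AntitoneOn (fun t => E₂ t * Real.exp (g * E₁ t)) (Icc 0 T) := by
    refine antitoneOn_Icc_of_hasDerivWithinAt
      (fun t ht => (h₂ t ht).mul ((h₁ t ht).const_mul g).exp) fun t ht => ?_
    have h_factor : E₂' t * Real.exp (g * E₁ t) + E₂ t * (Real.exp (g * E₁ t) * (g * E₁' t)) =
        Real.exp (g * E₁ t) * (E₂' t + E₂ t * g * E₁' t) := by ring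
    refine h_factor.trans_le (mul_nonpos_of_nonneg_of_nonpos (Real.exp_pos _).le ?_)
    have h_quad := quadratic_absorptionRate_nonneg hν hc C √(G t)
    rw [Real.sq_sqrt (hG t), ← hg] at h_quad
    calc E₂' t + E₂ t * g * E₁' t
        ≤ θ t * (-(2 * ν * c * E₂ t) + 2 * (C * √(G t) * E₂ t)) +
          E₂ t * g * (θ t * (-(2 * ν * G t))) :=
          add_le_add (h₂' t ht)
            (mul_le_mul_of_nonneg_left (h₁' t ht) (mul_nonneg (hE₂ t) hg_nonneg))
      _ = -(2 * (θ t * E₂ t) * (ν * c + ν * g * G t - C * √(G t))) := by ring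
      _ ≤ 0 := neg_nonpos.2
          (mul_nonneg (mul_nonneg zero_le_two (mul_nonneg (hθ t) (hE₂ t))) h_quad)
  calc E₁ t + E₂ t ≤ E₁ t + E₂ t * Real.exp (g * E₁ t) :=
        add_le_add_right (le_mul_of_one_le_right (hE₂ t)
          (Real.one_le_exp (mul_nonneg hg_nonneg (hE₁ t)))) _
    _ ≤ _ := add_le_add (h_anti₁ h_zero ht ht.1) (h_anti₂ h_zero ht ht.1)

theorem le_exp_of_deriv_le_add {T K : ℝ} {U U' : ℝ → ℝ}
    (h : ∀ t ∈ Icc 0 T, HasDerivWithinAt U (U' t) (Icc 0 T) t)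
    (h' : ∀ t ∈ Icc 0 T, U' t ≤ U t + K) (hUK : 0 ≤ U 0 + K) {t : ℝ} (ht : t ∈ Icc 0 T) :
    U t + K ≤ (U 0 + K) * Real.exp T := by
  have h_zero : (0 : ℝ) ∈ Icc 0 T := ⟨le_rfl, ht.1.trans ht.2⟩
  have h_anti : AntitoneOn (fun t => (U t + K) * Real.exp (-t)) (Icc 0 T) := by
    refine antitoneOn_Icc_of_hasDerivWithinAt
      (fun t ht => ((h t ht).add_const K).mul (hasDerivWithinAt_id t _).neg.exp) fun t ht => ?_
    have h_factor : U' t * Real.exp (-t) + (U t + K) * (Real.exp (-t) * -1) =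
        Real.exp (-t) * (U' t - (U t + K)) := by ring
    exact h_factor.trans_le (mul_nonpos_of_nonneg_of_nonpos (Real.exp_pos _).le
      (sub_nonpos.2 (h' t ht)))
  have h_le := h_anti h_zero ht ht.1
  simp only [neg_zero, Real.exp_zero, mul_one] at h_le
  calc U t + K = (U t + K) * Real.exp (-t) * Real.exp t := by
        rw [mul_assoc, ← Real.exp_add, neg_add_cancel, Real.exp_zero, mul_one]
    _ ≤ (U 0 + K) * Real.exp t := mul_le_mul_of_nonneg_right h_le (Real.exp_pos _).le
    _ ≤ (U 0 + K) * Real.exp T := mul_le_mul_of_nonneg_left (Real.exp_le_exp.2 ht.2) hUK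

end DifferentialInequality

/-! ### Galerkin approximations -/

section Galerkin

variable {l : ℝ}

/-- The modes kept in the truncation. -/
def truncModes (N : ℕ) : Finset Mode := (box1 N).disjSum (box2 N)

theorem inl_mem_truncModes {N : ℕ} {n : ℤ} : .inl n ∈ truncModes N ↔ n ∈ box1 N :=
  Finset.inl_mem_disjSum

theorem inr_mem_truncModes {N : ℕ} {k : ℤ × ℤ} : .inr k ∈ truncModes N ↔ k ∈ box2 N :=
  Finset.inr_mem_disjSum

theorem negMode_mem_truncModes {N : ℕ} {i : Mode} :
    negMode i ∈ truncModes N ↔ i ∈ truncModes N := by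
  rcases i with n | k
  · exact (inl_mem_truncModes.trans neg_mem_box1).trans inl_mem_truncModes.symm
  · exact (inr_mem_truncModes.trans neg_mem_box2).trans inr_mem_truncModes.symm

/-- The sequence of all modes that vanishes outside the truncation. -/
def extendByZero {N : ℕ} (y : truncModes N → ℂ) : Mode → ℂ :=
  fun i => if h : i ∈ truncModes N then y ⟨i, h⟩ else 0

theorem extendByZero_of_mem {N : ℕ} (y : truncModes N → ℂ) {i : Mode} (h : i ∈ truncModes N) :
    extendByZero y i = y ⟨i, h⟩ := dif_pos h

theorem extendByZero_of_notMem {N : ℕ} (y : truncModes N → ℂ) {i : Mode} (h : i ∉ truncModes N) :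
    extendByZero y i = 0 := dif_neg h

theorem supportedInBox_extendByZero {N : ℕ} (y : truncModes N → ℂ) :
    SupportedInBox N (extendByZero y) :=
  ⟨fun _ hn => extendByZero_of_notMem y fun h => hn (inl_mem_truncModes.1 h),
    fun _ hk => extendByZero_of_notMem y fun h => hk (inr_mem_truncModes.1 h)⟩

theorem contDiff_extendByZero {N : ℕ} (i : Mode) :
    ContDiff ℝ 1 fun y : truncModes N → ℂ => extendByZero y i := by
  by_cases h : i ∈ truncModes N
  · simp only [extendByZero_of_mem _ h]
    exact contDiff_apply ℝ ℂ _
  · simp only [extendByZero_of_notMem _ h]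
    exact contDiff_const

/-- The vector field of the Galerkin approximation. -/
def galerkinField (l ν C₁ : ℝ) (N : ℕ) (y : truncModes N → ℂ) : truncModes N → ℂ :=
  fun i => symbol l ν C₁ i * y i + bilin l (extendByZero y) (extendByZero y) i

theorem contDiff_galerkinField (ν C₁ : ℝ) (N : ℕ) : ContDiff ℝ 1 (galerkinField l ν C₁ N) := by
  refine contDiff_pi.2 fun i => (contDiff_const.mul (contDiff_apply ℝ ℂ i)).add ?_
  rcases i with ⟨n | k, hi⟩
  · simp only [bilin_inl_eq (supportedInBox_extendByZero _)]
    exact contDiff_const.mul (ContDiff.sum fun h _ =>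
      contDiff_const.mul ((contDiff_extendByZero _).mul (contDiff_extendByZero _)))
  · simp only [bilin_inr_eq (supportedInBox_extendByZero _), transport]
    split_ifs
    · exact contDiff_const
    · exact (ContDiff.sum fun h _ =>
        contDiff_const.mul ((contDiff_extendByZero _).mul (contDiff_extendByZero _))).sub
        (contDiff_const.mul (ContDiff.sum fun n _ =>
          (contDiff_extendByZero _).mul (contDiff_extendByZero _)))

/-- Complex conjugation in physical space, for the truncated coefficients. -/
def reflectTrunc (N : ℕ) : (truncModes N → ℂ) →L[ℝ] (truncModes N → ℂ) :=
  ContinuousLinearMap.pi fun i => Complex.conjCLE.toContinuousLinearMap.comp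
    (ContinuousLinearMap.proj (⟨negMode i, negMode_mem_truncModes.2 i.2⟩ : truncModes N))

theorem reflectTrunc_apply {N : ℕ} (y : truncModes N → ℂ) (i : truncModes N) :
    reflectTrunc N y i = conj (y ⟨negMode i, negMode_mem_truncModes.2 i.2⟩) := rfl

theorem extendByZero_reflectTrunc {N : ℕ} (y : truncModes N → ℂ) :
    extendByZero (reflectTrunc N y) = reflect (extendByZero y) := by
  funext i
  by_cases h : i ∈ truncModes N
  · rw [extendByZero_of_mem _ h, reflect, extendByZero_of_mem _ (negMode_mem_truncModes.2 h),
      reflectTrunc_apply]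
  · rw [extendByZero_of_notMem _ h, reflect,
      extendByZero_of_notMem _ (negMode_mem_truncModes.not.2 h), map_zero]

theorem sum_reflectTrunc_norm_sq {N : ℕ} (y : truncModes N → ℂ) :
    ∑ i, ‖reflectTrunc N y i‖ ^ 2 = ∑ i, ‖y i‖ ^ 2 := by
  let neg (i : truncModes N) : truncModes N := ⟨negMode i, negMode_mem_truncModes.2 i.2⟩
  have h_neg : Function.Involutive neg := fun i => Subtype.ext (negMode_negMode _)
  rw [← Equiv.sum_comp h_neg.toPerm fun i => ‖y i‖ ^ 2]
  exact Finset.sum_congr rfl fun i _ => by rw [reflectTrunc_apply, RCLike.norm_conj]; rfl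

theorem galerkinField_reflectTrunc (ν C₁ : ℝ) {N : ℕ} (y : truncModes N → ℂ) :
    galerkinField l ν C₁ N (reflectTrunc N y) = reflectTrunc N (galerkinField l ν C₁ N y) := by
  funext i
  rw [reflectTrunc_apply, galerkinField, galerkinField, extendByZero_reflectTrunc, bilin_reflect,
    reflectTrunc_apply, map_add, map_mul, ← symbol_negMode, negMode_negMode]

theorem zonalEnstrophy_add_eddyEnstrophy (N : ℕ) (z : Mode → ℂ) :
    zonalEnstrophy N z + eddyEnstrophy N z = ∑ k ∈ box2 N, ‖z (.inr k)‖ ^ 2 := by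
  rw [zonalEnstrophy, eddyEnstrophy, ← Finset.sum_add_distrib]
  exact Finset.sum_congr rfl fun k _ => by split_ifs <;> simp

/-- Kinetic energy of the mean flow. -/
def meanEnergy (N : ℕ) (z : Mode → ℂ) : ℝ := ∑ n ∈ box1 N, ‖z (.inl n)‖ ^ 2

theorem meanEnergy_nonneg (N : ℕ) (z : Mode → ℂ) : 0 ≤ meanEnergy N z :=
  Finset.sum_nonneg fun _ _ => by positivity

theorem sum_truncModes_norm_sq (N : ℕ) (z : Mode → ℂ) :
    ∑ i ∈ truncModes N, ‖z i‖ ^ 2 = meanEnergy N z + (zonalEnstrophy N z + eddyEnstrophy N z) := by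
  rw [truncModes, Finset.sum_disjSum, zonalEnstrophy_add_eddyEnstrophy, meanEnergy]

theorem sum_norm_sq_eq_energy {N : ℕ} (y : truncModes N → ℂ) :
    ∑ i, ‖y i‖ ^ 2 = meanEnergy N (extendByZero y) +
      (zonalEnstrophy N (extendByZero y) + eddyEnstrophy N (extendByZero y)) := by
  rw [← sum_truncModes_norm_sq N (extendByZero y)]
  refine Eq.trans ?_ (Finset.sum_coe_sort (truncModes N) fun i => ‖extendByZero y i‖ ^ 2)
  exact Finset.sum_congr rfl fun i _ => by rw [extendByZero_of_mem y i.2]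

theorem hasDerivWithinAt_norm_sq {s : Set ℝ} {t : ℝ} {y : ℝ → ℂ} {dy : ℂ}
    (h : HasDerivWithinAt y dy s t) :
    HasDerivWithinAt (fun t => ‖y t‖ ^ 2) (2 * (conj (y t) * dy).re) s t := by
  have h_sq := h.norm_sq
  rwa [Complex.inner, mul_comm dy] at h_sq

theorem hasDerivWithinAt_norm_sq_extendByZero {ν C₁ : ℝ} {N : ℕ} {s : Set ℝ} {t θ : ℝ}
    {x : ℝ → truncModes N → ℂ}
    (h : HasDerivWithinAt x (θ • galerkinField l ν C₁ N (x t)) s t) (i : Mode) :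
    HasDerivWithinAt (fun t => ‖extendByZero (x t) i‖ ^ 2)
      (θ * (-(2 * ν * (modeSq l i * ‖extendByZero (x t) i‖ ^ 2)) +
        2 * (conj (extendByZero (x t) i) *
          bilin l (extendByZero (x t)) (extendByZero (x t)) i).re)) s t := by
  by_cases hi : i ∈ truncModes N
  · simp only [extendByZero_of_mem _ hi]
    refine (hasDerivWithinAt_norm_sq (hasDerivWithinAt_pi.1 h ⟨i, hi⟩)).congr_deriv ?_
    generalize hy : x t ⟨i, hi⟩ = y
    simp only [Pi.smul_apply, galerkinField, hy]
    have h_balance (b : ℂ) : conj y * (θ • (symbol l ν C₁ i * y + b)) =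
        θ • (((‖y‖ ^ 2 : ℝ) : ℂ) * symbol l ν C₁ i + conj y * b) := by
      rw [Complex.ofReal_pow, ← Complex.conj_mul', Complex.real_smul, Complex.real_smul]
      ring
    rw [h_balance, Complex.smul_re, Complex.add_re, Complex.re_ofReal_mul, re_symbol, smul_eq_mul]
    ring
  · simp only [extendByZero_of_notMem _ hi]
    simpa using hasDerivWithinAt_const t s (0 : ℝ)

variable {ν C₁ : ℝ} {N : ℕ} {s : Set ℝ} {t θ : ℝ} {x : ℝ → truncModes N → ℂ}

theorem hasDerivWithinAt_zonalEnstrophy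
    (h : HasDerivWithinAt x (θ • galerkinField l ν C₁ N (x t)) s t) :
    HasDerivWithinAt (fun t => zonalEnstrophy N (extendByZero (x t)))
      (θ * (-(2 * ν * zonalGrad l N (extendByZero (x t))))) s t := by
  have h_mode : ∀ k ∈ box2 N, HasDerivWithinAt
      (fun t => if k.1 = 0 then ‖extendByZero (x t) (.inr k)‖ ^ 2 else 0)
      (θ * (-(2 * ν * if k.1 = 0 then freq l k.2 ^ 2 * ‖extendByZero (x t) (.inr k)‖ ^ 2 else 0)))
      s t := by
    intro k _
    split_ifs with hk
    · refine (hasDerivWithinAt_norm_sq_extendByZero h (.inr k)).congr_deriv ?_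
      simp [bilin, hk, modeSq, freqSq, freq_zero]
    · simpa using hasDerivWithinAt_const t s (0 : ℝ)
  refine (HasDerivWithinAt.fun_sum h_mode).congr_deriv ?_
  rw [zonalGrad, ← Finset.mul_sum, Finset.sum_neg_distrib, ← Finset.mul_sum]

theorem hasDerivWithinAt_eddyEnstrophy
    (h : HasDerivWithinAt x (θ • galerkinField l ν C₁ N (x t)) s t) :
    HasDerivWithinAt (fun t => eddyEnstrophy N (extendByZero (x t)))
      (θ * (-(2 * ν * ∑ k ∈ box2 N, if k.1 = 0 then 0 else
          freqSq l k * ‖extendByZero (x t) (.inr k)‖ ^ 2) +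
        2 * ∑ k ∈ box2 N, (conj (extendByZero (x t) (.inr k)) *
          bilin l (extendByZero (x t)) (extendByZero (x t)) (.inr k)).re)) s t := by
  have h_mode : ∀ k ∈ box2 N, HasDerivWithinAt
      (fun t => if k.1 = 0 then 0 else ‖extendByZero (x t) (.inr k)‖ ^ 2)
      (θ * (-(2 * ν * if k.1 = 0 then 0 else freqSq l k * ‖extendByZero (x t) (.inr k)‖ ^ 2) +
        2 * (conj (extendByZero (x t) (.inr k)) *
          bilin l (extendByZero (x t)) (extendByZero (x t)) (.inr k)).re)) s t := by
    intro k _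
    split_ifs with hk
    · simpa [bilin, hk] using hasDerivWithinAt_const t s (0 : ℝ)
    · exact hasDerivWithinAt_norm_sq_extendByZero h (.inr k)
  refine (HasDerivWithinAt.fun_sum h_mode).congr_deriv ?_
  rw [← Finset.mul_sum, Finset.sum_add_distrib, Finset.sum_neg_distrib, ← Finset.mul_sum,
    ← Finset.mul_sum]

theorem eddyEnstrophy_le_dissipation (hl : 0 < l) (z : Mode → ℂ) :
    (gapConst l)⁻¹ * eddyEnstrophy N z ≤
      ∑ k ∈ box2 N, if k.1 = 0 then 0 else freqSq l k * ‖z (.inr k)‖ ^ 2 := by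
  have hg : 0 < gapConst l := zero_lt_one.trans_le (one_le_gapConst l)
  rw [eddyEnstrophy, Finset.mul_sum]
  refine Finset.sum_le_sum fun k _ => ?_
  split_ifs with hk
  · simp
  · have h_gap : (gapConst l)⁻¹ ≤ freqSq l k := by
      rw [inv_le_iff_one_le_mul₀' hg]
      exact (le_add_of_nonneg_right (freqSq_nonneg l k)).trans
        (one_add_freqSq_le hl fun h => hk (by rw [h]; rfl))
    exact mul_le_mul_of_nonneg_right h_gap (by positivity)

theorem norm_bilin_inl_le {z : Mode → ℂ} (hz : SupportedInBox N z) {B : ℝ}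
    (hB : ∀ k, ‖z (.inr k)‖ ^ 2 ≤ B) (n : ℤ) :
    ‖bilin l z z (.inl n)‖ ≤ |freq l n| * ∑ h ∈ box2 N, |meanKernel l n h| * B := by
  rw [bilin_inl_eq hz, norm_mul, norm_neg, norm_mul, Complex.norm_I, one_mul, Complex.norm_real,
    Real.norm_eq_abs]
  refine mul_le_mul_of_nonneg_left ((norm_sum_le _ _).trans (Finset.sum_le_sum fun h _ => ?_))
    (abs_nonneg _)
  rw [norm_mul, Complex.norm_real, Real.norm_eq_abs, norm_mul]
  refine mul_le_mul_of_nonneg_left ?_ (abs_nonneg _)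
  nlinarith [hB h, hB ((0, n) - h), sq_nonneg (‖z (.inr h)‖ - ‖z (.inr ((0, n) - h))‖)]

/-- A bound for the squared `ℓ²` norm of the forcing of the mean flow by truncated eddies whose
squared coefficients are at most `B`. -/
def meanGrowth (l : ℝ) (N : ℕ) (B : ℝ) : ℝ :=
  ∑ n ∈ box1 N, (|freq l n| * ∑ h ∈ box2 N, |meanKernel l n h| * B) ^ 2

theorem meanGrowth_nonneg (B : ℝ) : 0 ≤ meanGrowth l N B :=
  Finset.sum_nonneg fun _ _ => sq_nonneg _

theorem exists_hasDerivWithinAt_meanEnergy (hν : 0 < ν) (hθ₀ : 0 ≤ θ) (hθ₁ : θ ≤ 1)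
    (h : HasDerivWithinAt x (θ • galerkinField l ν C₁ N (x t)) s t) {B : ℝ}
    (hB : ∀ k, ‖extendByZero (x t) (.inr k)‖ ^ 2 ≤ B) :
    ∃ U' ≤ meanEnergy N (extendByZero (x t)) + meanGrowth l N B,
      HasDerivWithinAt (fun t => meanEnergy N (extendByZero (x t))) U' s t := by
  refine ⟨_, ?_,
    HasDerivWithinAt.fun_sum fun n _ => hasDerivWithinAt_norm_sq_extendByZero h (.inl n)⟩
  rw [meanEnergy, meanGrowth, ← Finset.sum_add_distrib]
  refine Finset.sum_le_sum fun n _ => ?_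
  set z := extendByZero (x t)
  have h_re : (conj (z (.inl n)) * bilin l z z (.inl n)).re ≤
      ‖z (.inl n)‖ * ‖bilin l z z (.inl n)‖ :=
    (Complex.re_le_norm _).trans_eq (by rw [norm_mul, RCLike.norm_conj])
  have h_dissip : 0 ≤ ν * (modeSq l (.inl n) * ‖z (.inl n)‖ ^ 2) :=
    mul_nonneg hν.le (mul_nonneg (modeSq_nonneg _) (by positivity))
  have h_forcing : ‖bilin l z z (.inl n)‖ ^ 2 ≤
      (|freq l n| * ∑ h ∈ box2 N, |meanKernel l n h| * B) ^ 2 :=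
    pow_le_pow_left₀ (norm_nonneg _)
      (norm_bilin_inl_le (supportedInBox_extendByZero (x t)) hB n) 2
  have h_young : -(2 * ν * (modeSq l (.inl n) * ‖z (.inl n)‖ ^ 2)) +
      2 * (conj (z (.inl n)) * bilin l z z (.inl n)).re ≤
      ‖z (.inl n)‖ ^ 2 + ‖bilin l z z (.inl n)‖ ^ 2 := by
    linarith [two_mul_le_add_sq ‖z (.inl n)‖ ‖bilin l z z (.inl n)‖]
  calc _ ≤ θ * (‖z (.inl n)‖ ^ 2 + ‖bilin l z z (.inl n)‖ ^ 2) :=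
        mul_le_mul_of_nonneg_left h_young hθ₀
    _ ≤ ‖z (.inl n)‖ ^ 2 + ‖bilin l z z (.inl n)‖ ^ 2 :=
        mul_le_of_le_one_left (by positivity) hθ₁
    _ ≤ _ := by gcongr

theorem norm_sq_le_enstrophy {z : Mode → ℂ} (hz : SupportedInBox N z) (k : ℤ × ℤ) :
    ‖z (.inr k)‖ ^ 2 ≤ zonalEnstrophy N z + eddyEnstrophy N z := by
  rw [zonalEnstrophy_add_eddyEnstrophy]
  by_cases hk : k ∈ box2 N
  · exact Finset.single_le_sum (f := fun k => ‖z (.inr k)‖ ^ 2) (fun _ _ => by positivity) hk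
  · rw [hz.2 k hk, norm_zero, zero_pow two_ne_zero]
    exact Finset.sum_nonneg fun _ _ => by positivity

/-- The bound for the enstrophy of solutions whose initial enstrophy is at most `m`. -/
def enstrophyBound (l ν m : ℝ) : ℝ :=
  m + m * Real.exp (absorptionRate ν (gapConst l)⁻¹ (enstrophyConst l) * m)

section CutoffSolution

variable {T : ℝ} {θ : ℝ → ℝ}

theorem zonalEnstrophy_add_eddyEnstrophy_le_enstrophyBound
    (hx : ∀ t ∈ Icc 0 T, HasDerivWithinAt x (θ t • galerkinField l ν C₁ N (x t)) (Icc 0 T) t)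
    (hl : 0 < l) (hν : 0 < ν) (hθ : ∀ t, 0 ≤ θ t)
    (hrefl : ∀ t ∈ Icc 0 T, reflect (extendByZero (x t)) = extendByZero (x t)) {m : ℝ}
    (hm : zonalEnstrophy N (extendByZero (x 0)) + eddyEnstrophy N (extendByZero (x 0)) ≤ m)
    (ht : t ∈ Icc 0 T) :
    zonalEnstrophy N (extendByZero (x t)) + eddyEnstrophy N (extendByZero (x t)) ≤
      enstrophyBound l ν m := by
  have hg : 0 < (gapConst l)⁻¹ := inv_pos.2 (zero_lt_one.trans_le (one_le_gapConst l))
  have h_rate := absorptionRate_nonneg (ν := ν) hg.le (enstrophyConst l)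
  have h_zonal : 0 ≤ zonalEnstrophy N (extendByZero (x 0)) := zonalEnstrophy_nonneg _ _
  have h_eddy : 0 ≤ eddyEnstrophy N (extendByZero (x 0)) := eddyEnstrophy_nonneg _ _
  have h_zonal_le : zonalEnstrophy N (extendByZero (x 0)) ≤ m := by linarith
  have h_eddy_le : eddyEnstrophy N (extendByZero (x 0)) ≤ m := by linarith
  refine (add_le_of_enstrophy_inequalities (C := enstrophyConst l) hν hg
    (fun t ht => hasDerivWithinAt_zonalEnstrophy (hx t ht))
    (fun t ht => hasDerivWithinAt_eddyEnstrophy (hx t ht))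
    (fun t => zonalEnstrophy_nonneg _ _) (fun t => eddyEnstrophy_nonneg _ _)
    (fun t => zonalGrad_nonneg (l := l) N (extendByZero (x t))) hθ
    (fun _ _ => le_rfl) (fun t ht => ?_) ht).trans ?_
  · refine mul_le_mul_of_nonneg_left (add_le_add (neg_le_neg ?_) ?_) (hθ t)
    · rw [mul_assoc (2 * ν)]
      exact mul_le_mul_of_nonneg_left (eddyEnstrophy_le_dissipation hl _) (by positivity)
    · exact mul_le_mul_of_nonneg_left ((le_abs_self _).trans (abs_sum_re_conj_mul_bilin_le hl
        (supportedInBox_extendByZero _) (apply_inr_neg_of_reflect_eq (hrefl t ht)))) zero_le_two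
  · unfold enstrophyBound
    have h_m : 0 ≤ m := h_zonal.trans h_zonal_le
    gcongr

theorem meanEnergy_le_exp
    (hx : ∀ t ∈ Icc 0 T, HasDerivWithinAt x (θ t • galerkinField l ν C₁ N (x t)) (Icc 0 T) t)
    (hν : 0 < ν) (hθ₀ : ∀ t, 0 ≤ θ t) (hθ₁ : ∀ t, θ t ≤ 1) {B : ℝ}
    (hB : ∀ t ∈ Icc 0 T, ∀ k, ‖extendByZero (x t) (.inr k)‖ ^ 2 ≤ B) (ht : t ∈ Icc 0 T) :
    meanEnergy N (extendByZero (x t)) ≤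
      (meanEnergy N (extendByZero (x 0)) + meanGrowth l N B) * Real.exp T := by
  have h_deriv := fun t ht =>
    exists_hasDerivWithinAt_meanEnergy hν (hθ₀ t) (hθ₁ t) (hx t ht) (hB t ht)
  choose! U' hU' hU using h_deriv
  have h_growth : 0 ≤ meanGrowth l N B := meanGrowth_nonneg B
  exact (le_add_of_nonneg_right h_growth).trans
    (le_exp_of_deriv_le_add hU hU' (add_nonneg (meanEnergy_nonneg _ _) h_growth) ht)

end CutoffSolution

/-- The coefficients kept in the truncation. -/
def restrictTrunc (N : ℕ) (z : Mode → ℂ) : truncModes N → ℂ := fun i => z i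

theorem reflectTrunc_restrictTrunc {z : Mode → ℂ} (hz : reflect z = z) :
    reflectTrunc N (restrictTrunc N z) = restrictTrunc N z :=
  funext fun i => congrFun hz i

theorem zonalEnstrophy_add_eddyEnstrophy_restrictTrunc (z : Mode → ℂ) :
    zonalEnstrophy N (extendByZero (restrictTrunc N z)) +
      eddyEnstrophy N (extendByZero (restrictTrunc N z)) = ∑ k ∈ box2 N, ‖z (.inr k)‖ ^ 2 := by
  rw [zonalEnstrophy_add_eddyEnstrophy]
  refine Finset.sum_congr rfl fun k hk => ?_
  rw [extendByZero_of_mem _ (inr_mem_truncModes.2 hk), restrictTrunc]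

-- The level of the cutoff lies above the a priori bounds, so the cutoff is never active.
theorem exists_galerkin (hl : 0 < l) (hν : 0 < ν) (C₁ : ℝ) {z₀ : Mode → ℂ}
    (hz₀ : reflect z₀ = z₀) (N : ℕ) {m : ℝ}
    (hm : ∑ k ∈ box2 N, ‖z₀ (.inr k)‖ ^ 2 ≤ m) {T : ℝ} (hT : 0 ≤ T) :
    ∃ x : ℝ → truncModes N → ℂ, x 0 = restrictTrunc N z₀ ∧
      (∀ t ∈ Icc 0 T, HasDerivWithinAt x (galerkinField l ν C₁ N (x t)) (Icc 0 T) t) ∧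
      (∀ t ∈ Icc 0 T, reflect (extendByZero (x t)) = extendByZero (x t)) ∧
      ∀ t ∈ Icc 0 T, ∑ k ∈ box2 N, ‖extendByZero (x t) (.inr k)‖ ^ 2 ≤ enstrophyBound l ν m := by
  let B := enstrophyBound l ν m
  let R := (meanEnergy N (extendByZero (restrictTrunc N z₀)) + meanGrowth l N B) * Real.exp T + B
  obtain ⟨x, h_zero, hx, h_symm⟩ :=
    exists_cutoff_solution (contDiff_galerkinField (l := l) ν C₁ N) R hT (restrictTrunc N z₀)
  have h_refl : ∀ t ∈ Icc 0 T, reflect (extendByZero (x t)) = extendByZero (x t) := fun t ht => by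
    rw [← extendByZero_reflectTrunc, h_symm (reflectTrunc N) sum_reflectTrunc_norm_sq
      (galerkinField_reflectTrunc ν C₁) (reflectTrunc_restrictTrunc hz₀) t ht]
  have h_enstrophy : ∀ t ∈ Icc 0 T,
      zonalEnstrophy N (extendByZero (x t)) + eddyEnstrophy N (extendByZero (x t)) ≤ B :=
    fun t ht => zonalEnstrophy_add_eddyEnstrophy_le_enstrophyBound hx hl hν
      (fun t => cutoff_nonneg R (x t)) h_refl
      (by rwa [h_zero, zonalEnstrophy_add_eddyEnstrophy_restrictTrunc]) ht
  have h_inactive : ∀ t ∈ Icc 0 T, cutoff R (x t) = 1 := fun t ht => by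
    refine cutoff_eq_one ?_
    rw [sum_norm_sq_eq_energy]
    refine add_le_add ?_ (h_enstrophy t ht)
    rw [← h_zero]
    exact meanEnergy_le_exp hx hν (fun t => cutoff_nonneg R (x t)) (fun t => cutoff_le_one R (x t))
      (fun t ht k => (norm_sq_le_enstrophy (supportedInBox_extendByZero _) k).trans
        (h_enstrophy t ht)) ht
  exact ⟨x, h_zero, fun t ht => by simpa only [h_inactive t ht, one_smul] using hx t ht, h_refl,
    fun t ht => (zonalEnstrophy_add_eddyEnstrophy _ _).symm.trans_le (h_enstrophy t ht)⟩

end Galerkin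

/-! ### Existence of solutions on the Fourier side -/

section Existence

variable {l : ℝ}

theorem ofReal_sum_norm_sq {ι : Type*} (s : Finset ι) (f : ι → ℂ) :
    ENNReal.ofReal (∑ k ∈ s, ‖f k‖ ^ 2) = ∑ k ∈ s, ‖f k‖ₑ ^ 2 := by
  rw [ENNReal.ofReal_sum_of_nonneg fun _ _ => by positivity]
  exact Finset.sum_congr rfl fun k _ => by rw [ENNReal.ofReal_pow (norm_nonneg _), ofReal_norm]

theorem sum_norm_sq_le_toReal_tsum {ι : Type*} {f : ι → ℂ} (hf : ∑' k, ‖f k‖ₑ ^ 2 < ∞)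
    (s : Finset ι) : ∑ k ∈ s, ‖f k‖ ^ 2 ≤ (∑' k, ‖f k‖ₑ ^ 2).toReal := by
  rw [← ENNReal.ofReal_le_iff_le_toReal hf.ne, ofReal_sum_norm_sq]
  exact ENNReal.sum_le_tsum s

theorem tsum_enorm_sq_inr_eq_ofReal {N : ℕ} {z : Mode → ℂ} (hz : SupportedInBox N z) :
    ∑' k, ‖z (.inr k)‖ₑ ^ 2 = ENNReal.ofReal (∑ k ∈ box2 N, ‖z (.inr k)‖ ^ 2) := by
  rw [ofReal_sum_norm_sq]
  exact tsum_eq_sum fun k hk => by simp [hz.2 k hk]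

theorem eventually_mem_truncModes (i : Mode) : ∀ᶠ N in atTop, i ∈ truncModes N := by
  rcases i with n | ⟨m, n⟩
  · filter_upwards [eventually_ge_atTop n.natAbs] with N hN
    rw [inl_mem_truncModes, box1, Finset.mem_Icc]
    omega
  · filter_upwards [eventually_ge_atTop m.natAbs, eventually_ge_atTop n.natAbs] with N hm hn
    rw [inr_mem_truncModes, box2, Finset.mem_product, box1, Finset.mem_Icc, Finset.mem_Icc]
    omega

theorem reflect_eq_of_tendsto {z : ℕ → Mode → ℂ} {w : Mode → ℂ}
    (hw : ∀ i, Tendsto (fun N => z N i) atTop (𝓝 (w i))) (hz : ∀ N, reflect (z N) = z N) :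
    reflect w = w := by
  funext i
  refine tendsto_nhds_unique ?_ (hw i)
  exact ((Complex.continuous_conj.tendsto _).comp (hw (negMode i))).congr fun N =>
    congrFun (hz N) i

section GalerkinSolution

variable {ν C₁ T : ℝ} {N : ℕ} {x : ℝ → truncModes N → ℂ}

theorem duhamel_extendByZero
    (hx : ∀ t ∈ Icc 0 T, HasDerivWithinAt x (galerkinField l ν C₁ N (x t)) (Icc 0 T) t)
    {z₀ : Mode → ℂ} (h_zero : x 0 = restrictTrunc N z₀) {i : Mode} (hi : i ∈ truncModes N)
    {t : ℝ} (ht : t ∈ Icc 0 T) :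
    extendByZero (x t) i = Complex.exp (t * symbol l ν C₁ i) * z₀ i +
      ∫ τ in (0 : ℝ)..t, Complex.exp ((t - τ : ℝ) * symbol l ν C₁ i) *
        bilin l (extendByZero (x τ)) (extendByZero (x τ)) i := by
  have hx_cont : ContinuousOn x (Icc 0 T) := fun t ht => (hx t ht).continuousWithinAt
  have h_mode : ContinuousOn (fun t => x t ⟨i, hi⟩) (Icc 0 T) :=
    (continuous_apply _).comp_continuousOn hx_cont
  have h_field : ContinuousOn (fun t => galerkinField l ν C₁ N (x t) ⟨i, hi⟩) (Icc 0 T) :=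
    ((continuous_apply _).comp (contDiff_galerkinField ν C₁ N).continuous).comp_continuousOn
      hx_cont
  have h_bilin :
      ContinuousOn (fun t => bilin l (extendByZero (x t)) (extendByZero (x t)) i) (Icc 0 T) :=
    (h_field.sub (continuousOn_const.mul h_mode)).congr fun t _ => (add_sub_cancel_left _ _).symm
  rw [extendByZero_of_mem _ hi, duhamel_of_hasDerivWithinAt (y := fun t => x t ⟨i, hi⟩) h_bilin
    (fun t ht => hasDerivWithinAt_pi.1 (hx t ht) ⟨i, hi⟩) ht, h_zero, restrictTrunc]

theorem lipschitzOnWith_extendByZero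
    (hx : ∀ t ∈ Icc 0 T, HasDerivWithinAt x (galerkinField l ν C₁ N (x t)) (Icc 0 T) t)
    {i : Mode} {c : ℝ≥0}
    (hc : ∀ t ∈ Icc 0 T, ‖symbol l ν C₁ i * extendByZero (x t) i +
      bilin l (extendByZero (x t)) (extendByZero (x t)) i‖₊ ≤ c) :
    LipschitzOnWith c (fun t => extendByZero (x t) i) (Icc 0 T) := by
  by_cases hi : i ∈ truncModes N
  · simp only [extendByZero_of_mem _ hi] at hc ⊢
    exact (convex_Icc 0 T).lipschitzOnWith_of_nnnorm_hasDerivWithin_le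
      (fun t ht => hasDerivWithinAt_pi.1 (hx t ht) ⟨i, hi⟩) hc
  · simp only [extendByZero_of_notMem _ hi]
    exact (LipschitzWith.const' _).lipschitzOnWith.weaken zero_le

end GalerkinSolution

/-- `z` is a Galerkin approximation of order `N` with enstrophy at most `M`. It is an approximate
solution on `[0, N]` only, and is continued to all times without taking new values, so that bounds
hold for every time. -/
structure IsGalerkinTrajectory (l ν C₁ : ℝ) (z₀ : Mode → ℂ) (M : ℝ≥0∞) (N : ℕ)
    (z : ℝ → Mode → ℂ) : Prop where
  reflect_eq (t : ℝ) : reflect (z t) = z t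
  tsum_inr_le (t : ℝ) : ∑' k, ‖z t (.inr k)‖ₑ ^ 2 ≤ M
  eq_zero (t : ℝ) {i : Mode} (hi : i ∉ truncModes N) : z t i = 0
  exists_mem_Icc (t : ℝ) : ∃ τ ∈ Icc (0 : ℝ) N, z t = z τ
  duhamel {t : ℝ} (ht : t ∈ Icc (0 : ℝ) N) {i : Mode} (hi : i ∈ truncModes N) :
    z t i = Complex.exp (t * symbol l ν C₁ i) * z₀ i +
      ∫ τ in (0 : ℝ)..t, Complex.exp ((t - τ : ℝ) * symbol l ν C₁ i) * bilin l (z τ) (z τ) i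
  lipschitzWith {i : Mode} {c : ℝ≥0}
    (hc : ∀ t, ‖symbol l ν C₁ i * z t i + bilin l (z t) (z t) i‖₊ ≤ c) :
    LipschitzWith c fun t => z t i

theorem exists_isGalerkinTrajectory (hl : 0 < l) {ν : ℝ} (hν : 0 < ν) (C₁ : ℝ) {z₀ : Mode → ℂ}
    (hz₀ : reflect z₀ = z₀) (N : ℕ) {m : ℝ} (hm : ∑ k ∈ box2 N, ‖z₀ (.inr k)‖ ^ 2 ≤ m) :
    ∃ z, IsGalerkinTrajectory l ν C₁ z₀ (ENNReal.ofReal (enstrophyBound l ν m)) N z := by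
  have hN : (0 : ℝ) ≤ N := N.cast_nonneg
  obtain ⟨x, h_zero, hx, h_reflect, h_enstrophy⟩ := exists_galerkin hl hν C₁ hz₀ N hm hN
  let clamp (t : ℝ) : ℝ := projIcc 0 (N : ℝ) hN t
  have h_mem (t : ℝ) : clamp t ∈ Icc (0 : ℝ) N := (projIcc 0 (N : ℝ) hN t).2
  have h_clamp {t : ℝ} (ht : t ∈ Icc (0 : ℝ) N) : clamp t = t := by
    simp only [clamp, projIcc_of_mem hN ht]
  refine ⟨fun t => extendByZero (x (clamp t)), fun t => h_reflect _ (h_mem t), fun t => ?_,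
    fun t _ hi => extendByZero_of_notMem _ hi,
    fun t => ⟨clamp t, h_mem t, by rw [h_clamp (h_mem t)]⟩, fun {t} ht {i} hi => ?_,
    fun {i c} hc => ?_⟩
  · rw [tsum_enorm_sq_inr_eq_ofReal (supportedInBox_extendByZero _)]
    exact ENNReal.ofReal_le_ofReal (h_enstrophy _ (h_mem t))
  · simp only [h_clamp ht]
    rw [duhamel_extendByZero hx h_zero hi ht]
    refine congrArg (Complex.exp (t * symbol l ν C₁ i) * z₀ i + ·) ?_
    refine intervalIntegral.integral_congr fun τ hτ => ?_
    rw [uIcc_of_le ht.1] at hτ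
    simp only [h_clamp ⟨hτ.1, hτ.2.trans ht.2⟩]
  · have h_lip := lipschitzOnWith_extendByZero hx (c := c) fun t ht => by
      simpa only [h_clamp ht] using hc t
    exact mul_one c ▸ h_lip.to_restrict.comp (LipschitzWith.projIcc hN)

/-- A Lipschitz constant in time for the mode `i` of Galerkin approximations dominated by `Z`. -/
def timeLipschitzConst (l ν C₁ : ℝ) (Z : Mode → ℝ≥0∞) (i : Mode) : ℝ≥0 :=
  ‖symbol l ν C₁ i‖₊ * (Z i).toNNReal +
    ((l2BilinConst l (l2Sq Z)).toReal * (1 + modeSq l i) ^ (1 / 2 : ℝ)).toNNReal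

namespace IsGalerkinTrajectory

variable {ν C₁ : ℝ} {z₀ : Mode → ℂ} {M : ℝ≥0∞} {N : ℕ} {z : ℝ → Mode → ℂ}

theorem integratedInequality (h : IsGalerkinTrajectory l ν C₁ z₀ M N z) (hl : 0 < l)
    (hν : 0 < ν) :
    IntegratedInequality l (fun i => ‖z₀ i‖ₑ) (duhamelConst l ν) fun t i => ‖z t i‖ₑ := by
  intro i b hb t
  by_cases hi : i ∈ truncModes N
  · obtain ⟨r, hr, h_eq⟩ := h.exists_mem_Icc t
    simp only [h_eq, h.duhamel hr hi]
    exact enorm_duhamel_le hl hν hr.1 fun τ _ => hb τ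
  · simp only [h.eq_zero t hi, enorm_zero, zero_le]

theorem enorm_le_uniformMajorant (h : IsGalerkinTrajectory l ν C₁ z₀ M N z) (hl : 0 < l)
    (hν : 0 < ν) (t : ℝ) (i : Mode) :
    ‖z t i‖ₑ ≤ uniformMajorant l (fun i => ‖z₀ i‖ₑ) (duhamelConst l ν) M i :=
  (h.integratedInequality hl hν).le_uniformMajorant h.tsum_inr_le t i

theorem lipschitzWith_of_enorm_le (h : IsGalerkinTrajectory l ν C₁ z₀ M N z) (hl : 0 < l)
    {Z : Mode → ℝ≥0∞} (hZ : l2Sq Z < ∞) (hzZ : ∀ t i, ‖z t i‖ₑ ≤ Z i) (i : Mode) :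
    LipschitzWith (timeLipschitzConst l ν C₁ Z i) fun t => z t i := by
  refine h.lipschitzWith fun t => (nnnorm_add_le _ _).trans (add_le_add ?_ ?_)
  · rw [nnnorm_mul]
    gcongr
    exact ENNReal.le_toNNReal_of_coe_le (hzZ t i) (lt_top_of_l2Sq_lt_top hZ i).ne
  · exact NNReal.le_toNNReal_of_coe_le (norm_bilin_le hl hZ.ne (l2Sq_mono (hzZ t)) i)

end IsGalerkinTrajectory

theorem exists_duhamel_solution (hl : 0 < l) {ν : ℝ} (hν : 0 < ν) (C₁ : ℝ) {z₀ : Mode → ℂ}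
    (h_reflect : reflect z₀ = z₀) (hz₀ : l2Sq (fun i => ‖z₀ i‖ₑ) < ∞) :
    ∃ (w : ℝ → Mode → ℂ) (Z : Mode → ℝ≥0∞), l2Sq Z < ∞ ∧ (∀ i, Continuous fun t => w t i) ∧
      (∀ t i, ‖w t i‖ₑ ≤ Z i) ∧ (∀ t, reflect (w t) = w t) ∧
      ∀ t, 0 ≤ t → DuhamelModeAt l ν C₁ z₀ w t := by
  have h_enstrophy : ∑' k, ‖z₀ (.inr k)‖ₑ ^ 2 < ∞ := lt_of_le_of_lt le_add_self hz₀
  choose z hz using fun N : ℕ => exists_isGalerkinTrajectory hl hν C₁ h_reflect N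
    (sum_norm_sq_le_toReal_tsum h_enstrophy (box2 N))
  have hZ := l2Sq_uniformMajorant_lt_top hl hz₀ (duhamelConst_lt_top l ν)
    (M := ENNReal.ofReal (enstrophyBound l ν (∑' k, ‖z₀ (.inr k)‖ₑ ^ 2).toReal))
    ENNReal.ofReal_lt_top
  have hzZ (N : ℕ) := (hz N).enorm_le_uniformMajorant hl hν
  obtain ⟨φ, _, w, hw, hw_cont, hwZ, hw_duhamel⟩ := exists_duhamel_of_approx hl hν hZ hzZ
    (fun N => (hz N).lipschitzWith_of_enorm_le hl hZ (hzZ N)) (z₀ := z₀) fun i t ht => by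
      filter_upwards [eventually_mem_truncModes i, eventually_ge_atTop ⌈t⌉₊] with N hi hN
      exact (hz N).duhamel ⟨ht, Nat.ceil_le.1 hN⟩ hi
  exact ⟨w, _, hZ, hw_cont, hwZ,
    fun t => reflect_eq_of_tendsto (hw t) fun N => (hz (φ N)).reflect_eq t, hw_duhamel⟩

theorem exists_sobolevSq_le_of_duhamel (hl : 0 < l) {ν C₁ : ℝ} (hν : 0 < ν) {s : ℝ} (hs : 0 ≤ s)
    {z₀ : Mode → ℂ} (hz₀ : sobolevSq l s (fun i => ‖z₀ i‖ₑ) < ∞) {z : ℝ → Mode → ℂ}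
    {Z : Mode → ℝ≥0∞} (hZ : l2Sq Z < ∞) (hzZ : ∀ t i, ‖z t i‖ₑ ≤ Z i)
    (hz : ∀ t, 0 ≤ t → DuhamelModeAt l ν C₁ z₀ z t) :
    ∃ B < ∞, ∀ t, 0 ≤ t → sobolevSq l s (fun i => ‖z t i‖ₑ) ≤ B := by
  let Y (i : Mode) : ℝ≥0∞ := ⨆ t ≥ (0 : ℝ), ‖z t i‖ₑ
  have h_le_Y {t : ℝ} (ht : 0 ≤ t) (i : Mode) : ‖z t i‖ₑ ≤ Y i :=
    le_iSup₂ (f := fun t (_ : t ≥ (0 : ℝ)) => ‖z t i‖ₑ) t ht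
  have hY : l2Sq Y < ∞ := (l2Sq_mono fun i => iSup₂_le fun t _ => hzZ t i).trans_lt hZ
  refine ⟨sobolevSq l s Y, sobolevSq_lt_top_of_le hl (duhamelConst_lt_top l ν) hs hz₀ hY
    fun i => iSup₂_le fun t ht => ?_, fun t ht => sobolevSq_mono le_rfl (h_le_Y ht)⟩
  rw [hz t ht i]
  exact enorm_duhamel_le hl hν ht fun τ hτ =>
    majorant_mono _ (h_le_Y hτ.1.le) (h_le_Y hτ.1.le) i

end Existence

/-! ### Well-posedness -/

section WellPosed

variable {l : ℝ} [hl : Fact (0 < l)]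

theorem sobolevSq1_eq (s : ℝ) (f : L2y l) :
    sobolevSq1 s f = ∑' n, wt1 l n ^ s * ‖hat1 f n‖ₑ ^ 2 := by
  refine tsum_congr fun n => ?_
  have h : 0 < 1 + freq l n ^ 2 := by positivity
  rw [ENNReal.ofReal_mul (by positivity), ← ENNReal.ofReal_rpow_of_pos h,
    ENNReal.ofReal_pow (norm_nonneg _), ofReal_norm, wt1]

theorem sobolevSq2_eq (s : ℝ) (f : L2xy l) :
    sobolevSq2 s f = ∑' k, wt2 l k ^ s * ‖hat2 f k‖ₑ ^ 2 := by
  refine tsum_congr fun k => ?_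
  have h : 0 < 1 + freqSq l k := by have := freqSq_nonneg l k; positivity
  rw [ENNReal.ofReal_mul (by positivity), ← ENNReal.ofReal_rpow_of_pos h,
    ENNReal.ofReal_pow (norm_nonneg _), ofReal_norm, wt2]

theorem sobolevSq_coeffs (s : ℝ) (u : L2y l) (ζ : L2xy l) :
    sobolevSq l s (fun i => ‖coeffs u ζ i‖ₑ) = sobolevSq1 s u + sobolevSq2 s ζ := by
  rw [sobolevSq1_eq, sobolevSq2_eq]
  rfl

theorem reflect_coeffs (u : L2y l) (ζ : L2xy l) : reflect (coeffs u ζ) = coeffs u ζ := by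
  funext i
  rcases i with n | k
  · simp only [reflect, negMode, coeffs, Sum.map_inl, Sum.elim_inl, hat1_neg, Complex.conj_conj]
  · simp only [reflect, negMode, coeffs, Sum.map_inr, Sum.elim_inr, hat2_neg, Complex.conj_conj]

theorem coeffs_injective {u v : L2y l} {ζ η : L2xy l} (h : coeffs u ζ = coeffs v η) :
    u = v ∧ ζ = η :=
  ⟨hat1_injective fun n => congrFun h (.inl n), hat2_injective fun k => congrFun h (.inr k)⟩

theorem exists_stronglyMeasurable_coeffs_eq {w : ℝ → Mode → ℂ}
    (hw : ∀ i, Continuous fun t => w t i) (hw_l2 : ∀ t, l2Sq (fun i => ‖w t i‖ₑ) < ∞)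
    (h_reflect : ∀ t, reflect (w t) = w t) :
    ∃ (u : ℝ → L2y l) (ζ : ℝ → L2xy l), StronglyMeasurable u ∧ StronglyMeasurable ζ ∧
      ∀ t, coeffs (u t) (ζ t) = w t := by
  obtain ⟨u, hu, hu_repr⟩ := exists_stronglyMeasurable_repr_eq (conjSymm_fourierBasis (l := l))
    (fun n => (hw (.inl n)).stronglyMeasurable) (fun t => lt_of_le_of_lt le_self_add (hw_l2 t))
    fun t => apply_inl_neg_of_reflect_eq (h_reflect t)
  obtain ⟨ζ, hζ, hζ_repr⟩ := exists_stronglyMeasurable_repr_eq (conjSymm_fourier2Basis (l := l))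
    (fun k => (hw (.inr k)).stronglyMeasurable) (fun t => lt_of_le_of_lt le_add_self (hw_l2 t))
    fun t => apply_inr_neg_of_reflect_eq (h_reflect t)
  refine ⟨u, ζ, hu, hζ, fun t => funext ?_⟩
  rintro (n | k)
  · exact (hat1_eq_repr _ _).trans (hu_repr t n)
  · exact (hat2_eq_repr _ _).trans (hζ_repr t k)

theorem aestronglyMeasurable_coeffs {μ : Measure ℝ} {u : ℝ → L2y l} {ζ : ℝ → L2xy l}
    (hu : AEStronglyMeasurable u μ) (hζ : AEStronglyMeasurable ζ μ) (i : Mode) :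
    AEStronglyMeasurable (fun t => coeffs (u t) (ζ t) i) μ := by
  rcases i with n | k
  · exact (continuous_hat1 n).comp_aestronglyMeasurable hu
  · exact (continuous_hat2 k).comp_aestronglyMeasurable hζ

theorem l2Sq_coeffs_le {s : ℝ} (hs : 0 ≤ s) (u : L2y l) (ζ : L2xy l) :
    l2Sq (fun i => ‖coeffs u ζ i‖ₑ) ≤ sobolevSq1 s u + sobolevSq2 s ζ := by
  rw [← sobolevSq_zero (l := l), ← sobolevSq_coeffs]
  exact sobolevSq_mono hs fun _ => le_rfl

theorem MemLinftyHs.exists_l2Sq_le {s : ℝ} (hs : 0 ≤ s) {u : ℝ → L2y l} {ζ : ℝ → L2xy l}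
    (h : MemLinftyHs s u ζ) : ∃ M < ∞, ∀ᵐ t ∂(volume.restrict (Ioi (0 : ℝ))),
      l2Sq (fun i => ‖coeffs (u t) (ζ t) i‖ₑ) ≤ M := by
  refine ⟨_, ENNReal.add_lt_top.2 ⟨h.bdd_u, h.bdd_ζ⟩, ?_⟩
  filter_upwards [ENNReal.ae_le_essSup fun t => sobolevSq1 s (u t),
    ENNReal.ae_le_essSup fun t => sobolevSq2 s (ζ t)] with t hu hζ
  exact (l2Sq_coeffs_le hs _ _).trans (add_le_add hu hζ)

theorem memLinftyHs_of_forall_le {s : ℝ} {u : ℝ → L2y l} {ζ : ℝ → L2xy l}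
    (hu : StronglyMeasurable u) (hζ : StronglyMeasurable ζ) {B : ℝ≥0∞} (hB : B < ∞)
    (h : ∀ t, 0 ≤ t → sobolevSq1 s (u t) + sobolevSq2 s (ζ t) ≤ B) : MemLinftyHs s u ζ := by
  have h_ae : ∀ᵐ t ∂(volume.restrict (Ioi (0 : ℝ))),
      sobolevSq1 s (u t) + sobolevSq2 s (ζ t) ≤ B := by
    filter_upwards [ae_restrict_mem measurableSet_Ioi] with t ht using h t (le_of_lt ht)
  exact
    { meas_u := hu.aestronglyMeasurable
      meas_ζ := hζ.aestronglyMeasurable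
      bdd_u := (essSup_le_of_ae_le _ (h_ae.mono fun _ => le_self_add.trans)).trans_lt hB
      bdd_ζ := (essSup_le_of_ae_le _ (h_ae.mono fun _ => le_add_self.trans)).trans_lt hB }

namespace IsMildSolution

variable {ν C₁ s : ℝ} {u₀ : L2y l} {ζ₀ : L2xy l} {u v : ℝ → L2y l} {ζ η : ℝ → L2xy l}

theorem isBoundedSolution (h : IsMildSolution ν C₁ s u₀ ζ₀ u ζ) {M : ℝ≥0∞}
    (hM : ∀ᵐ t ∂(volume.restrict (Ioi (0 : ℝ))), l2Sq (fun i => ‖coeffs (u t) (ζ t) i‖ₑ) ≤ M) :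
    IsBoundedSolution l ν C₁ (coeffs u₀ ζ₀) M fun t => coeffs (u t) (ζ t) where
  aestronglyMeasurable := aestronglyMeasurable_coeffs h.mem.meas_u h.mem.meas_ζ
  l2Sq_le := hM
  duhamel := h.duhamel.mono fun _ => duhamelAt_iff.1

theorem ae_eq (h : IsMildSolution ν C₁ s u₀ ζ₀ u ζ) (h' : IsMildSolution ν C₁ s u₀ ζ₀ v η)
    (hν : 0 < ν) (hs : 0 ≤ s) :
    ∀ᵐ t ∂(volume.restrict (Ioi (0 : ℝ))), u t = v t ∧ ζ t = η t := by
  obtain ⟨M, hM, h_le⟩ := h.mem.exists_l2Sq_le hs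
  obtain ⟨M', hM', h_le'⟩ := h'.mem.exists_l2Sq_le hs
  have hz := h.isBoundedSolution (h_le.mono fun _ ht => ht.trans (le_max_left M M'))
  have hw := h'.isBoundedSolution (h_le'.mono fun _ ht => ht.trans (le_max_right M M'))
  exact (hz.ae_eq hw hl.out hν (max_lt hM hM')).mono fun _ => coeffs_injective

end IsMildSolution

theorem exists_isMildSolution {ν : ℝ} (hν : 0 < ν) (C₁ : ℝ) {s : ℝ} (hs : 0 ≤ s) {u₀ : L2y l}
    (hu₀ : MemHs1 s u₀) {ζ₀ : L2xy l} (hζ₀ : MemHs2 s ζ₀) :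
    ∃ (u : ℝ → L2y l) (ζ : ℝ → L2xy l), IsMildSolution ν C₁ s u₀ ζ₀ u ζ ∧
      ∀ t, 0 ≤ t → DuhamelAt ν C₁ u₀ ζ₀ u ζ t := by
  have h_data : sobolevSq1 s u₀ + sobolevSq2 s ζ₀ < ∞ := ENNReal.add_lt_top.2 ⟨hu₀, hζ₀⟩
  obtain ⟨w, Z, hZ, hw_cont, hwZ, hw_reflect, hw⟩ := exists_duhamel_solution hl.out hν C₁
    (reflect_coeffs u₀ ζ₀) ((l2Sq_coeffs_le hs u₀ ζ₀).trans_lt h_data)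
  obtain ⟨B, hB, hwB⟩ := exists_sobolevSq_le_of_duhamel hl.out hν hs
    (by rwa [sobolevSq_coeffs]) hZ hwZ hw
  obtain ⟨u, ζ, hu, hζ, h_coeffs⟩ := exists_stronglyMeasurable_coeffs_eq (l := l) hw_cont
    (fun t => (l2Sq_mono (hwZ t)).trans_lt hZ) hw_reflect
  have h_duhamel (t : ℝ) (ht : 0 ≤ t) : DuhamelAt ν C₁ u₀ ζ₀ u ζ t := by
    rw [duhamelAt_iff]
    simpa only [h_coeffs] using hw t ht
  have h_mem : MemLinftyHs s u ζ := memLinftyHs_of_forall_le hu hζ hB fun t ht => by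
    rw [← sobolevSq_coeffs, h_coeffs]
    exact hwB t ht
  refine ⟨u, ζ, ⟨h_mem, ?_⟩, h_duhamel⟩
  filter_upwards [ae_restrict_mem measurableSet_Ioi] with t ht using h_duhamel t (le_of_lt ht)

end WellPosed

end EddyMean

end

theorem theorem1 (l : ℝ) [Fact (0 < l)] (ν : ℝ) (hν : 0 < ν) (C₁ : ℝ) (s : ℝ) (hs : 0 ≤ s)
    (u₀ : EddyMean.L2y l) (hu₀ : EddyMean.MemHs1 s u₀)
    (ζ₀ : EddyMean.L2xy l) (hζ₀ : EddyMean.MemHs2 s ζ₀) :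
    ∃ (u : ℝ → EddyMean.L2y l) (ζ : ℝ → EddyMean.L2xy l),
      EddyMean.IsMildSolution ν C₁ s u₀ ζ₀ u ζ ∧
      (∀ t : ℝ, 0 ≤ t → EddyMean.DuhamelAt ν C₁ u₀ ζ₀ u ζ t) ∧
      ∀ (v : ℝ → EddyMean.L2y l) (η : ℝ → EddyMean.L2xy l),
        EddyMean.IsMildSolution ν C₁ s u₀ ζ₀ v η →
          ∀ᵐ t ∂(MeasureTheory.volume.restrict (Set.Ioi (0 : ℝ))), v t = u t ∧ η t = ζ t := by
  obtain ⟨u, ζ, h, hD⟩ := EddyMean.exists_isMildSolution hν C₁ hs hu₀ hζ₀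
  exact ⟨u, ζ, h, hD, fun v η h' => h'.ae_eq h hν hs⟩
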